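/- For integers $k,m\ge 1$ let $H_k^{(m)}=\sum_{n=1}^{k}\frac{1}{n^m}$ and $H_k=H_k^{(1)}$. Let $\zeta$ be the Riemann zeta function and $\operatorname{Li}_5(x)=\sum_{k=1}^{\infty}\frac{x^k}{k^5}$ for $|x|\le 1$. Then the following six series converge, with the stated sums: (i) $\displaystyle\sum_{k=1}^{\infty}\frac{4^kH_k^{(3)}}{k^2\binom{2k}{k}}=\frac{217}{8}\zeta(5)-\frac{9}{2}\zeta(2)\zeta(3)-16\operatorname{Li}_5\left(\tfrac12\right)-\frac{19}{2}\ln(2)\zeta(4)+\frac{8}{3}\ln^3(2)\zeta(2)+\frac{2}{15}\ln^5(2)$; (ii) $\displaystyle\sum_{k=1}^{\infty}\frac{4^kH_k^{(2)}}{k^3\binom{2k}{k}}=\frac{31}{4}\zeta(5)+\frac{3}{2}\zeta(2)\zeta(3)-16\operatorname{Li}_5\left(\tfrac12\right)-2\ln(2)\zeta(4)+\frac{8}{3}\ln^3(2)\zeta(2)+\frac{2}{15}\ln^5(2)$; (iii) $\displaystyle\sum_{k=1}^{\infty}\frac{4^kH_k^2}{k^3\binom{2k}{k}}=-62\zeta(5)-\frac{21}{2}\zeta(2)\zeta(3)+48\operatorname{Li}_5\left(\tfrac12\right)+81\ln(2)\zeta(4)+8\ln^3(2)\zeta(2)-\frac{2}{5}\ln^5(2)$;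 (iv) $\displaystyle\sum_{k=1}^{\infty}\frac{4^kH_k}{k^4\binom{2k}{k}}=-\frac{31}{2}\zeta(5)+3\zeta(2)\zeta(3)+16\operatorname{Li}_5\left(\tfrac12\right)+2\ln(2)\zeta(4)+\frac{16}{3}\ln^3(2)\zeta(2)-\frac{2}{15}\ln^5(2)$; (v) $\displaystyle\sum_{k=1}^{\infty}\frac{4^kH_kH_k^{(2)}}{k^2\binom{2k}{k}}=-\frac{155}{8}\zeta(5)+9\zeta(2)\zeta(3)+16\operatorname{Li}_5\left(\tfrac12\right)+\frac{19}{2}\ln(2)\zeta(4)+\frac{16}{3}\ln^3(2)\zeta(2)-\frac{2}{15}\ln^5(2)$; (vi) $\displaystyle\sum_{k=1}^{\infty}\frac{4^kH_k^3}{k^2\binom{2k}{k}}=-\frac{155}{8}\zeta(5)+18\zeta(2)\zeta(3)+80\operatorname{Li}_5\left(\tfrac12\right)+\frac{455}{2}\ln(2)\zeta(4)+\frac{32}{3}\ln^3(2)\zeta(2)-\frac{2}{3}\ln^5(2)$. -/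

import Mathlib

/-- The generalized harmonic number `H_k^{(m)} = ∑_{n=1}^k 1 / n^m`. -/
noncomputable def genHarmonic (m k : ℕ) : ℝ :=
  ∑ n ∈ Finset.Icc 1 k, 1 / (n : ℝ) ^ m

/-- For `m = 1` the generalized harmonic number is Mathlib's harmonic number. -/
theorem genHarmonic_one (k : ℕ) : genHarmonic 1 k = (harmonic k : ℝ) := by
  simp [genHarmonic, harmonic_eq_sum_Icc]

/-- The value `ζ(m)` of the Riemann zeta function at a natural number, as a real number. -/
noncomputable def realZeta (m : ℕ) : ℝ := (riemannZeta (m : ℂ)).re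

/-- For `m > 1` no information is lost in taking the real part, and the value is the series. -/
theorem realZeta_eq_tsum {m : ℕ} (hm : 1 < m) :
    realZeta m = ∑' k : ℕ, 1 / ((k : ℝ) + 1) ^ m := by
  have h : riemannZeta (m : ℂ) = ((∑' k : ℕ, 1 / ((k : ℝ) + 1) ^ m : ℝ) : ℂ) := by
    rw [zeta_eq_tsum_one_div_nat_add_one_cpow (by simpa using hm)]
    push_cast
    refine tsum_congr fun k => ?_
    rw [Complex.cpow_natCast]
  rw [realZeta, h, Complex.ofReal_re]

theorem ofReal_realZeta {m : ℕ} (hm : 1 < m) : (realZeta m : ℂ) = riemannZeta (m : ℂ) := by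
  rw [realZeta_eq_tsum hm, zeta_eq_tsum_one_div_nat_add_one_cpow (by simpa using hm)]
  push_cast
  refine tsum_congr fun k => ?_
  rw [Complex.cpow_natCast]

/-- The polylogarithm `Li_m(x) = ∑_{k ≥ 1} x^k / k^m` at a real number `x`
(the series converges for `|x| < 1`). -/
noncomputable def realPolylog (m : ℕ) (x : ℝ) : ℝ :=
  ∑' k : ℕ, x ^ (k + 1) / ((k : ℝ) + 1) ^ m

/-- The series that defines `Li_m(x)` converges for `|x| < 1`. -/
theorem hasSum_realPolylog (m : ℕ) {x : ℝ} (hx : |x| < 1) :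
    HasSum (fun k : ℕ => x ^ (k + 1) / ((k : ℝ) + 1) ^ m) (realPolylog m x) := by
  refine Summable.hasSum (Summable.of_norm_bounded
    ((summable_nat_add_iff 1).mpr (summable_geometric_of_lt_one (abs_nonneg x) hx)) fun k => ?_)
  rw [norm_div, norm_pow, norm_pow, Real.norm_eq_abs]
  refine div_le_self (by positivity) (one_le_pow₀ ?_)
  rw [Real.norm_eq_abs, abs_of_nonneg (by positivity)]
  linarith [Nat.cast_nonneg (α := ℝ) k]

open Filter Topology Finset MeasureTheory

/-! ### Series with nonnegative terms -/

/-! Put w_k = 4^k / binom(2k, k), t = 1/k, and let p_m be the m-th power sum of the numbers 1/n, n <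
k. Each of the six summands is w_k times a polynomial of weight five in t, p_1, p_2, p_3. Hence it
suffices to evaluate seven convenient series and to recombine them linearly. Four come from a
duality with sums over odd integers, three from integrals.

Duality. The kernel c(k, j) = k! Γ(j + 1/2) / Γ(k + j + 1/2) equals w_k at j = 0 and has telescoping
differences in both indices (`hasSum_connector_right`, `hasSum_connector_left`). Moving harmonic
factors across this kernel, one at a time, replaces a nested sum weighted by w_k with a nested sum
over odd integers in which no binomial is left. The elementary symmetric e_3 t^2 becomes a single
zeta-like sum; e_2 t^3 and (p_1 p_2 - p_3) t^2 become double sums. The double sums of odd weight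
reduce to zeta values and log 2 by linear algebra on partial fraction, telescoping and stuffle
relations (`oddOdd_one_two`, `oddOdd_one_four`, `oddOdd_three_two`). The series p_3 t^2 and p_2 t^3
lead to triple sums, which one stuffle product ties together (`hasSum_harm_three_of_harm_two`), so
only p_2 t^3 needs another method.

Integrals. The expansions of θ and θ^3 in sin^(2k+1) cos, integrated against powers of -log sin or
-log cos, express t^5, p_2 t^3 and the complete symmetric h_3 t^2 (in the 1/n with n ≤ k) as
integrals over [0, π/2]. These reduce to moments of log(2 cos(φ/2)), the real part of log(1 +
e^{iφ}), whose imaginary part is φ/2. Fourier series give the moments with one logarithm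
(`hasSum_integral_logCos`). Cauchy's theorem for log(1 + z)^m / z on a half disc
(`integral_log_one_add_half_circle`) gives those with more, and its boundary term, the integral of
log(1 + u)^m / u, is what introduces Li_5(1/2). The value Li_4(1/2) appears on the way and cancels.
-/

theorem hasSum_swap_of_nonneg {ι κ : Type*} {f : ι → κ → ℝ} {g : ι → ℝ} {h : κ → ℝ} {S : ℝ}
    (hf : ∀ i j, 0 ≤ f i j) (hg : ∀ i, HasSum (f i) (g i)) (hS : HasSum g S)
    (hh : ∀ j, HasSum (fun i => f i j) (h j)) : HasSum h S := by
  have hsum : Summable (fun p : ι × κ => f p.1 p.2) := by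
    rw [summable_prod_of_nonneg (fun p => hf p.1 p.2)]
    refine ⟨fun i => (hg i).summable, ?_⟩
    simpa only [(hg _).tsum_eq] using hS.summable
  have h1 := hsum.hasSum.prod_fiberwise hg
  have h2 := (((Equiv.prodComm κ ι).hasSum_iff (f := fun p : ι × κ => f p.1 p.2)).2
    hsum.hasSum).prod_fiberwise (f := fun p : κ × ι => f p.2 p.1) hh
  rwa [h1.unique hS] at h2

theorem hasSum_telescope {u : ℕ → ℝ} (hu : Antitone u) (h0 : Tendsto u atTop (𝓝 0)) :
    HasSum (fun n => u n - u (n + 1)) (u 0) := by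
  rw [hasSum_iff_tendsto_nat_of_nonneg fun n => sub_nonneg.2 (hu n.le_succ)]
  simp_rw [Finset.sum_range_sub']
  simpa using h0.const_sub (u 0)

/-- Stuffle product of two series with nonnegative terms. -/
theorem hasSum_stuffle {f g : ℕ → ℝ} {A B : ℝ} (hf : ∀ n, 0 ≤ f n) (hg : ∀ n, 0 ≤ g n)
    (hA : HasSum f A) (hB : HasSum g B) :
    HasSum (fun n => f n * ∑ i ∈ range n, g i + g n * ∑ i ∈ range n, f i + f n * g n) (A * B) := by
  rw [hasSum_iff_tendsto_nat_of_nonneg]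
  · have h := hA.tendsto_sum_nat.mul hB.tendsto_sum_nat
    refine h.congr fun n => ?_
    induction n with
    | zero => simp
    | succ n ih => rw [sum_range_succ (fun n => _ + _), ← ih, sum_range_succ f, sum_range_succ g]; ring
  · intro n
    have := hf n
    have := hg n
    have := sum_nonneg fun i (_ : i ∈ range n) => hf i
    have := sum_nonneg fun i (_ : i ∈ range n) => hg i
    positivity

/-- Summation over `i < n` can be done over `i` first or over `n` first. -/
theorem hasSum_tail_swap {f g ψ : ℕ → ℝ} {S : ℝ} (hf : ∀ n, 0 ≤ f n) (hg : ∀ n, 0 ≤ g n)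
    (hψ : ∀ J, HasSum (fun i => g (J + 1 + i)) (ψ J))
    (hS : HasSum (fun n => g n * ∑ i ∈ range n, f i) S) :
    HasSum (fun J => f J * ψ J) S := by
  refine hasSum_swap_of_nonneg (f := fun n J => if J < n then g n * f J else 0)
    (fun n J => ?_) (fun n => ?_) hS (fun J => ?_)
  · split_ifs
    · exact mul_nonneg (hg n) (hf J)
    · exact le_rfl
  · rw [mul_sum, ← sum_congr rfl fun J hJ => if_pos (mem_range.1 hJ)]
    exact hasSum_sum_of_ne_finset_zero fun J hJ => if_neg fun h => hJ (mem_range.2 h)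
  · have h1 : HasSum (fun i => f J * g (J + 1 + i)) (f J * ψ J) := (hψ J).mul_left _
    rw [← hasSum_nat_add_iff' (J + 1)]
    rw [sum_eq_zero fun i hi => if_neg (by rw [mem_range] at hi; omega), sub_zero]
    refine h1.congr_fun ?_
    intro i
    rw [if_pos (by omega), add_comm i, mul_comm]

theorem tail_hasSum {g : ℕ → ℝ} (hg : Summable g) (J : ℕ) :
    HasSum (fun i => g (J + i)) (∑' i, g (J + i)) :=
  Summable.hasSum (by simpa only [add_comm J] using (summable_nat_add_iff J).2 hg)

/-! ### The connector `k! Γ(j + 1/2) / Γ(k + j + 1/2)` -/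

/-- The Gamma quotient is written as a product so that the step in k is immediate. The ratio of
neighbouring values is rational in both indices, which makes both differences telescope. -/
noncomputable def connector (k j : ℕ) : ℝ := ∏ i ∈ range k, ((i : ℝ) + 1) / (i + j + 1 / 2)

theorem connector_pos (k j : ℕ) : 0 < connector k j :=
  prod_pos fun i _ => by positivity

theorem connector_zero_left (j : ℕ) : connector 0 j = 1 := by simp [connector]

theorem connector_succ_left (k j : ℕ) :
    connector (k + 1) j = connector k j * ((k + 1) / (k + j + 1 / 2)) := prod_range_succ _ _

theorem connector_succ_right (k j : ℕ) :
    connector k (j + 1) = connector k j * ((j + 1 / 2) / (k + j + 1 / 2)) := by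
  induction k with
  | zero =>
    have : (j : ℝ) + 1 / 2 ≠ 0 := by positivity
    simp only [connector_zero_left, Nat.cast_zero, zero_add, one_mul]
    rw [div_self this]
  | succ k ih =>
    rw [connector_succ_left, ih, connector_succ_left]
    have : (k : ℝ) + j + 1 / 2 ≠ 0 := by positivity
    have : (k : ℝ) + j + 1 + 1 / 2 ≠ 0 := by positivity
    push_cast
    field_simp
    ring

theorem connector_zero_right (k : ℕ) : connector k 0 = 4 ^ k / (Nat.centralBinom k : ℝ) := by
  induction k with
  | zero => simp [connector_zero_left]
  | succ k ih =>
    have h := Nat.succ_mul_centralBinom_succ k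
    have h' : ((k : ℝ) + 1) * (k + 1).centralBinom = 2 * (2 * k + 1) * k.centralBinom := by
      exact_mod_cast h
    have h1 : (0 : ℝ) < k.centralBinom := by exact_mod_cast Nat.centralBinom_pos k
    have h2 : (0 : ℝ) < (k + 1).centralBinom := by exact_mod_cast Nat.centralBinom_pos (k + 1)
    rw [connector_succ_left, ih, pow_succ, div_mul_div_comm, div_eq_div_iff (by positivity) (by positivity)]
    push_cast
    linear_combination (4 ^ k : ℝ) * h'

theorem connector_antitone_right (k : ℕ) : Antitone (connector k) := by
  refine antitone_nat_of_succ_le fun j => ?_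
  rw [connector_succ_right]
  refine mul_le_of_le_one_right (connector_pos k j).le ?_
  rw [div_le_one (by positivity)]
  have : (0 : ℝ) ≤ k := by positivity
  linarith

/-- The right index must be positive: at j = 0 the ratio (k + 1) / (k + 1/2) exceeds 1 and the
connector grows. -/
theorem connector_antitone_left (j : ℕ) : Antitone (fun k => connector k (j + 1)) := by
  refine antitone_nat_of_succ_le fun k => ?_
  rw [connector_succ_left]
  refine mul_le_of_le_one_right (connector_pos k _).le ?_
  rw [div_le_one (by positivity)]
  have : (0 : ℝ) ≤ j := by positivity
  push_cast
  linarith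

theorem tendsto_connector_right (k : ℕ) : Tendsto (connector (k + 1)) atTop (𝓝 0) := by
  -- The shift makes the right index positive, so that monotonicity in k bounds everything by the
  -- explicit case k = 1.
  rw [← tendsto_add_atTop_iff_nat 1]
  refine squeeze_zero (fun j => (connector_pos _ _).le)
    (fun j => connector_antitone_left j (show 1 ≤ k + 1 by omega)) ?_
  refine squeeze_zero (fun j => (connector_pos _ _).le) (fun j => ?_)
    (tendsto_one_div_add_atTop_nhds_zero_nat (𝕜 := ℝ))
  change connector (0 + 1) (j + 1) ≤ _
  rw [connector_succ_left, connector_zero_left, one_mul]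
  push_cast
  rw [zero_add]
  apply one_div_le_one_div_of_le <;> [positivity; linarith]

theorem tendsto_connector_left (j : ℕ) : Tendsto (fun k => connector k (j + 1)) atTop (𝓝 0) := by
  -- c(k, 1) decays like k^(-1/2); squaring gives a rational bound that goes through by induction.
  have key : ∀ k, connector k 1 ^ 2 ≤ 1 / ((k : ℝ) + 1) := by
    intro k
    induction k with
    | zero => simp [connector_zero_left]
    | succ k ih =>
      rw [connector_succ_left, mul_pow]
      calc _ ≤ 1 / ((k : ℝ) + 1) * (((k : ℝ) + 1) / (k + (1 : ℕ) + 1 / 2)) ^ 2 := by gcongr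
        _ ≤ _ := by
          push_cast
          rw [div_pow, div_mul_div_comm, div_le_div_iff₀ (by positivity) (by positivity)]
          have : (0 : ℝ) ≤ k := by positivity
          nlinarith [mul_nonneg this this, mul_nonneg (mul_nonneg this this) this]
  have h0 : Tendsto (fun k => connector k 1) atTop (𝓝 0) := by
    have h := squeeze_zero (fun k => sq_nonneg (connector k 1)) key
      (tendsto_one_div_add_atTop_nhds_zero_nat (𝕜 := ℝ))
    have h' := (Real.continuous_sqrt.tendsto 0).comp h
    rw [Real.sqrt_zero] at h'
    exact h'.congr fun k => Real.sqrt_sq (connector_pos k 1).le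
  exact squeeze_zero (fun k => (connector_pos _ _).le)
    (fun k => connector_antitone_right k (show 1 ≤ j + 1 by omega)) h0

/-- Telescoping of c(k+1, j) - c(k+1, j+1) = (k+1) c(k+1, j+1) / (j + 1/2) over j ≥ J. It trades a
factor 1/(k+1) for a sum over j. -/
theorem hasSum_connector_right (k J : ℕ) :
    HasSum (fun i : ℕ => connector (k + 1) (J + 1 + i) / (((J + i : ℕ) : ℝ) + 1 / 2))
      (connector (k + 1) J / (k + 1)) := by
  have h := (hasSum_telescope (u := fun i => connector (k + 1) (J + i))
    (fun a b hab => connector_antitone_right _ (by omega))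
    (by simpa only [add_comm J] using (tendsto_add_atTop_iff_nat J).2 (tendsto_connector_right k))).div_const
      ((k : ℝ) + 1)
  refine h.congr_fun ?_
  intro i
  rw [show J + 1 + i = J + i + 1 by omega, ← add_assoc, connector_succ_right]
  have : ((J + i : ℕ) : ℝ) + 1 / 2 ≠ 0 := by positivity
  have : (k : ℝ) + 1 ≠ 0 := by positivity
  have : (k : ℝ) + 1 + ((J + i : ℕ) : ℝ) + 1 / 2 ≠ 0 := by positivity
  push_cast at *
  field_simp
  ring

/-- Telescoping of c(k, j+1) - c(k+1, j+1) = (j + 1/2) c(k+1, j+1) / (k+1) over k ≥ K. It trades a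
sum over larger k for a factor 1/(j + 1/2). -/
theorem hasSum_connector_left (K j : ℕ) :
    HasSum (fun i : ℕ => connector (K + i + 1) (j + 1) / (((K + i : ℕ) : ℝ) + 1))
      (connector K (j + 1) / (j + 1 / 2)) := by
  have h := (hasSum_telescope (u := fun i => connector (K + i) (j + 1))
    (fun a b hab => connector_antitone_left j (by simpa using hab))
    (by simpa only [add_comm K] using
      (tendsto_add_atTop_iff_nat K).2 (tendsto_connector_left j))).div_const ((j : ℝ) + 1 / 2)
  refine h.congr_fun ?_
  intro i
  rw [← add_assoc, connector_succ_left]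
  have : ((K + i : ℕ) : ℝ) + 1 ≠ 0 := by positivity
  have : (j : ℝ) + 1 / 2 ≠ 0 := by positivity
  have : ((K + i : ℕ) : ℝ) + (j + 1) + 1 / 2 ≠ 0 := by positivity
  push_cast at *
  field_simp
  ring

/-- `φ j = ∑ₖ a k · connector (k + 1) (j + 1)` for all `j`. -/
def IsConnectorDual (a φ : ℕ → ℝ) : Prop :=
  ∀ j, HasSum (fun k => a k * connector (k + 1) (j + 1)) (φ j)

theorem isConnectorDual_inv :
    IsConnectorDual (fun k => 1 / ((k : ℝ) + 1)) (fun j => 1 / ((j : ℝ) + 1 / 2)) := by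
  intro j
  have h := hasSum_connector_left 0 j
  rw [connector_zero_left] at h
  refine h.congr_fun fun k => ?_
  rw [zero_add, one_div_mul_eq_div]

/-- First rule of the duality: exchanging the sums over n < k and applying `hasSum_connector_left`
to the inner one shows that one more level of nesting on the k side is one more power of 1/(j + 1/2)
on the other. -/
theorem IsConnectorDual.sum_range_div {a φ : ℕ → ℝ} (ha : ∀ k, 0 ≤ a k)
    (h : IsConnectorDual a φ) :
    IsConnectorDual (fun k => (∑ n ∈ range k, a n) / ((k : ℝ) + 1))
      (fun j => φ j / ((j : ℝ) + 1 / 2)) := by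
  intro j
  refine hasSum_swap_of_nonneg
    (f := fun n k => if n < k then a n * (connector (k + 1) (j + 1) / ((k : ℝ) + 1)) else 0)
    (fun n k => ?_) (fun n => ?_) ((h j).div_const ((j : ℝ) + 1 / 2)) (fun k => ?_)
  · have := connector_pos (k + 1) (j + 1)
    have := ha n
    split_ifs <;> positivity
  · have h1 := (hasSum_connector_left (n + 1) j).mul_left (a n)
    rw [← hasSum_nat_add_iff' (n + 1)]
    rw [sum_eq_zero fun i hi => if_neg (by rw [mem_range] at hi; omega), sub_zero, mul_div_assoc]
    refine h1.congr_fun fun i => ?_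
    rw [if_pos (by omega), add_comm i]
  · have h2 : HasSum (fun n => if n < k then a n * (connector (k + 1) (j + 1) / ((k : ℝ) + 1)) else 0)
        (∑ n ∈ range k, if n < k then a n * (connector (k + 1) (j + 1) / ((k : ℝ) + 1)) else 0) :=
      hasSum_sum_of_ne_finset_zero fun n hn => if_neg fun h => hn (mem_range.2 h)
    rw [sum_congr rfl fun n hn => if_pos (mem_range.1 hn), ← sum_mul] at h2
    convert h2 using 1
    ring

/-- Second rule: one more power of 1/(k+1) becomes a tail sum over the dual variable, since
`hasSum_connector_right` expands the connector. With J = 0 it ends a transport, because c(k+1, 0) is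
the required weight. -/
theorem IsConnectorDual.hasSum_div {a φ : ℕ → ℝ} (ha : ∀ k, 0 ≤ a k)
    (h : IsConnectorDual a φ) {J : ℕ} {S : ℝ}
    (hS : HasSum (fun i => φ (J + i) / (((J + i : ℕ) : ℝ) + 1 / 2)) S) :
    HasSum (fun k => a k / ((k : ℝ) + 1) * connector (k + 1) J) S := by
  refine hasSum_swap_of_nonneg
    (f := fun i k => a k * (connector (k + 1) (J + i + 1) / (((J + i : ℕ) : ℝ) + 1 / 2)))
    (fun i k => ?_) (fun i => ?_) hS (fun k => ?_)
  · have := connector_pos (k + 1) (J + i + 1)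
    have := ha k
    positivity
  · refine ((h (J + i)).div_const (((J + i : ℕ) : ℝ) + 1 / 2)).congr_fun fun k => ?_
    ring
  · have h1 := (hasSum_connector_right k J).mul_left (a k)
    rw [div_mul_eq_mul_div, mul_div_assoc]
    refine h1.congr_fun fun i => ?_
    rw [add_right_comm]

theorem IsConnectorDual.div {a φ ψ : ℕ → ℝ} (ha : ∀ k, 0 ≤ a k) (h : IsConnectorDual a φ)
    (hψ : ∀ J, HasSum (fun i => φ (J + 1 + i) / (((J + 1 + i : ℕ) : ℝ) + 1 / 2)) (ψ J)) :
    IsConnectorDual (fun k => a k / ((k : ℝ) + 1)) ψ :=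
  fun J => h.hasSum_div ha (hψ J)

theorem IsConnectorDual.hasSum {a φ : ℕ → ℝ} (ha : ∀ k, 0 ≤ a k) (h : IsConnectorDual a φ) {S : ℝ}
    (hS : HasSum (fun j : ℕ => φ j / ((j : ℝ) + 1 / 2)) S) :
    HasSum (fun k => a k / ((k : ℝ) + 1) * connector (k + 1) 0) S :=
  h.hasSum_div ha (by simpa only [zero_add] using hS)

/-! ### Nested harmonic sums weighted by `4 ^ k / centralBinom k` -/

noncomputable def oddInv (n : ℕ) : ℝ := 1 / ((n : ℝ) + 1 / 2)

noncomputable def natInv (n : ℕ) : ℝ := 1 / ((n : ℝ) + 1)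

theorem oddInv_pos (n : ℕ) : 0 < oddInv n := by unfold oddInv; positivity

theorem natInv_pos (n : ℕ) : 0 < natInv n := by unfold natInv; positivity

/-- `∑ 1 / n ^ m` over `1 ≤ n ≤ k`. -/
noncomputable def harm (m k : ℕ) : ℝ := ∑ n ∈ range k, natInv n ^ m

theorem harm_nonneg (m k : ℕ) : 0 ≤ harm m k :=
  sum_nonneg fun n _ => pow_nonneg (natInv_pos n).le _

theorem IsConnectorDual.congr {a φ a' φ' : ℕ → ℝ} (h : IsConnectorDual a φ)
    (ha : ∀ k, a' k = a k) (hφ : ∀ j, φ' j = φ j) : IsConnectorDual a' φ' := by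
  rwa [funext ha, funext hφ]

theorem isConnectorDual_natInv : IsConnectorDual natInv oddInv := isConnectorDual_inv

theorem IsConnectorDual.sum_range_mul {a φ : ℕ → ℝ} (ha : ∀ k, 0 ≤ a k)
    (h : IsConnectorDual a φ) :
    IsConnectorDual (fun k => (∑ n ∈ range k, a n) * natInv k) (fun j => φ j * oddInv j) :=
  (h.sum_range_div ha).congr (fun k => by rw [natInv, mul_one_div]) fun j => by
    rw [oddInv, mul_one_div]

theorem IsConnectorDual.mul_natInv {a φ : ℕ → ℝ} (ha : ∀ k, 0 ≤ a k)
    (h : IsConnectorDual a φ) (hs : Summable fun n => φ n * oddInv n) :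
    IsConnectorDual (fun k => a k * natInv k)
      (fun J => ∑' i, φ (J + 1 + i) * oddInv (J + 1 + i)) :=
  (h.div ha (ψ := fun J => ∑' i, φ (J + 1 + i) * oddInv (J + 1 + i)) fun J => by
    simpa only [oddInv, mul_one_div] using tail_hasSum hs (J + 1)).congr
    (fun k => by rw [natInv, mul_one_div]) fun j => rfl

theorem IsConnectorDual.hasSum_mul {a φ : ℕ → ℝ} (ha : ∀ k, 0 ≤ a k)
    (h : IsConnectorDual a φ) {S : ℝ} (hS : HasSum (fun j => φ j * oddInv j) S) :
    HasSum (fun k => a k * natInv k * connector (k + 1) 0) S := by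
  have := h.hasSum ha (S := S) (by simpa only [oddInv, mul_one_div] using hS)
  simpa only [natInv, mul_one_div] using this

theorem hasSum_tail_tsum {f g : ℕ → ℝ} {S : ℝ} (hf : ∀ n, 0 ≤ f n) (hg : ∀ n, 0 ≤ g n)
    (hs : Summable g) (hS : HasSum (fun n => g n * ∑ i ∈ range n, f i) S) :
    HasSum (fun J => f J * ∑' i, g (J + 1 + i)) S :=
  hasSum_tail_swap hf hg (fun J => tail_hasSum hs (J + 1)) hS

theorem hasSum_tail_tsum_two {f g h : ℕ → ℝ} {S : ℝ} (hf : ∀ n, 0 ≤ f n) (hg : ∀ n, 0 ≤ g n)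
    (hh : ∀ n, 0 ≤ h n) (hs : Summable h) (hs' : Summable fun n => g n * ∑' i, h (n + 1 + i))
    (hS : HasSum (fun n => h n * ∑ i ∈ range n, g i * ∑ j ∈ range i, f j) S) :
    HasSum (fun J => f J * ∑' i, g (J + 1 + i) * ∑' l, h (J + 1 + i + 1 + l)) S := by
  refine hasSum_tail_tsum hf (g := fun n => g n * ∑' i, h (n + 1 + i))
    (fun n => mul_nonneg (hg n) (tsum_nonneg fun _ => hh _)) hs' ?_
  have := hasSum_tail_tsum (f := fun n => g n * ∑ j ∈ range n, f j)
    (fun n => mul_nonneg (hg n) (sum_nonneg fun _ _ => hf _)) hh hs hS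
  exact this.congr_fun fun n => mul_right_comm _ _ _

theorem isConnectorDual_harm_one :
    IsConnectorDual (fun k => harm 1 k * natInv k) (fun j => oddInv j ^ 2) :=
  (isConnectorDual_natInv.sum_range_mul fun k => (natInv_pos k).le).congr
    (fun k => by simp only [harm, pow_one]) fun j => by ring

theorem nested_nonneg {a : ℕ → ℝ} (ha : ∀ k, 0 ≤ a k) (k : ℕ) :
    0 ≤ (∑ n ∈ range k, a n) * natInv k :=
  mul_nonneg (sum_nonneg fun n _ => ha n) (natInv_pos k).le

theorem harm_mul_nonneg (m k : ℕ) : 0 ≤ harm m k * natInv k :=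
  mul_nonneg (harm_nonneg m k) (natInv_pos k).le

theorem isConnectorDual_nested :
    IsConnectorDual (fun k => (∑ j ∈ range k, harm 1 j * natInv j) * natInv k)
      (fun j => oddInv j ^ 3) :=
  (isConnectorDual_harm_one.sum_range_mul (harm_mul_nonneg 1)).congr
    (fun _ => rfl) fun j => by ring

theorem hasSum_connector_nested_one_one_one {S : ℝ} (hS : HasSum (fun n => oddInv n ^ 5) S) :
    HasSum (fun k : ℕ => (∑ i ∈ range k, (∑ j ∈ range i, harm 1 j * natInv j) * natInv i) *
      natInv k * natInv k * connector (k + 1) 0) S := by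
  have h := isConnectorDual_nested.sum_range_mul (nested_nonneg (harm_mul_nonneg 1))
  refine h.hasSum_mul (nested_nonneg (nested_nonneg (harm_mul_nonneg 1))) ?_
  exact hS.congr_fun fun n => by ring

theorem isConnectorDual_sq (hs : Summable fun n => oddInv n ^ 2) :
    IsConnectorDual (fun k => natInv k ^ 2) (fun J => ∑' i, oddInv (J + 1 + i) ^ 2) :=
  (isConnectorDual_natInv.mul_natInv (fun k => (natInv_pos k).le)
    (by simpa only [← sq] using hs)).congr (fun k => sq _) fun j => by simp only [sq]

theorem isConnectorDual_cube (hs : Summable fun n => oddInv n ^ 2)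
    (hs' : Summable fun n => oddInv n * ∑' i, oddInv (n + 1 + i) ^ 2) :
    IsConnectorDual (fun k => natInv k ^ 3)
      (fun J => ∑' i, oddInv (J + 1 + i) * ∑' l, oddInv (J + 1 + i + 1 + l) ^ 2) :=
  ((isConnectorDual_sq hs).mul_natInv (fun k => sq_nonneg _)
    (by simpa only [mul_comm] using hs')).congr (fun k => pow_succ _ 2) fun j => by
      simp only [mul_comm]

/-- The extra factor `natInv k` creates a tail of `oddInv ^ 4`; reversing the order of summation
turns tails into initial segments, the form in which the odd sums are evaluated. The following
lemmas do the same for other exponents. -/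
theorem hasSum_connector_nested_one_one {S : ℝ} (hs : Summable fun n => oddInv n ^ 4)
    (hS : HasSum (fun n => oddInv n ^ 4 * ∑ i ∈ range n, oddInv i) S) :
    HasSum (fun k : ℕ => (∑ j ∈ range k, harm 1 j * natInv j) * natInv k * natInv k * natInv k *
      connector (k + 1) 0) S := by
  have h0 := nested_nonneg (harm_mul_nonneg 1)
  have h2 := isConnectorDual_nested.mul_natInv h0 (by simpa only [← pow_succ] using hs)
  refine h2.hasSum_mul (fun k => mul_nonneg (h0 k) (natInv_pos k).le) ?_
  have h3 := hasSum_tail_tsum (fun n => (oddInv_pos n).le) (fun n => pow_nonneg (oddInv_pos n).le 4) hs hS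
  exact h3.congr_fun fun n => by simp only [← pow_succ]; ring

theorem hasSum_connector_nested_two_one {S : ℝ} (hs : Summable fun n => oddInv n ^ 3)
    (hS : HasSum (fun n => oddInv n ^ 3 * ∑ i ∈ range n, oddInv i ^ 2) S) :
    HasSum (fun k : ℕ => (∑ j ∈ range k, harm 1 j * natInv j * natInv j) * natInv k * natInv k *
      connector (k + 1) 0) S := by
  have h0 : ∀ k, 0 ≤ harm 1 k * natInv k * natInv k := fun k =>
    mul_nonneg (harm_mul_nonneg 1 k) (natInv_pos k).le
  have h1 := (isConnectorDual_harm_one.mul_natInv (harm_mul_nonneg 1)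
    (by simpa only [← pow_succ] using hs)).sum_range_mul h0
  refine h1.hasSum_mul (nested_nonneg h0) ?_
  have h3 := hasSum_tail_tsum (fun n => pow_nonneg (oddInv_pos n).le 2)
    (fun n => pow_nonneg (oddInv_pos n).le 3) hs hS
  exact h3.congr_fun fun n => by simp only [← pow_succ]; ring

theorem isConnectorDual_harm_two (hs : Summable fun n => oddInv n ^ 2) :
    IsConnectorDual (fun k => harm 2 k * natInv k)
      (fun J => (∑' i, oddInv (J + 1 + i) ^ 2) * oddInv J) :=
  (isConnectorDual_sq hs).sum_range_mul fun _ => sq_nonneg _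

theorem hasSum_connector_nested_one_two {S : ℝ} (hs : Summable fun n => oddInv n ^ 2)
    (hS : HasSum (fun n => oddInv n ^ 2 * ∑ i ∈ range n, oddInv i ^ 3) S) :
    HasSum (fun k : ℕ => (∑ j ∈ range k, harm 2 j * natInv j) * natInv k * natInv k *
      connector (k + 1) 0) S := by
  have h1 := (isConnectorDual_harm_two hs).sum_range_mul (harm_mul_nonneg 2)
  refine h1.hasSum_mul (nested_nonneg (harm_mul_nonneg 2)) ?_
  have h3 := hasSum_tail_tsum (fun n => pow_nonneg (oddInv_pos n).le 3)
    (fun n => pow_nonneg (oddInv_pos n).le 2) hs hS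
  exact h3.congr_fun fun n => by ring

theorem hasSum_connector_harm_two {S : ℝ} (hs : Summable fun n => oddInv n ^ 2)
    (hs' : Summable fun n => oddInv n ^ 2 * ∑' i, oddInv (n + 1 + i) ^ 2)
    (hS : HasSum (fun n => oddInv n ^ 2 * ∑ i ∈ range n, oddInv i ^ 2 * ∑ j ∈ range i, oddInv j) S) :
    HasSum (fun k : ℕ => harm 2 k * natInv k * natInv k * natInv k * connector (k + 1) 0) S := by
  have h1 := (isConnectorDual_harm_two hs).mul_natInv (harm_mul_nonneg 2)
    (hs'.congr fun n => by ring)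
  refine h1.hasSum_mul (fun k => mul_nonneg (harm_mul_nonneg 2 k) (natInv_pos k).le) ?_
  have h3 := hasSum_tail_tsum_two (fun n => (oddInv_pos n).le)
    (fun n => pow_nonneg (oddInv_pos n).le 2) (fun n => pow_nonneg (oddInv_pos n).le 2) hs hs' hS
  refine h3.congr_fun fun n => ?_
  rw [mul_comm]
  congr 1
  exact tsum_congr fun i => by ring

theorem hasSum_connector_harm_three {S : ℝ} (hs : Summable fun n => oddInv n ^ 2)
    (hs' : Summable fun n => oddInv n * ∑' i, oddInv (n + 1 + i) ^ 2)
    (hS : HasSum (fun n => oddInv n ^ 2 * ∑ i ∈ range n, oddInv i * ∑ j ∈ range i, oddInv j ^ 2) S) :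
    HasSum (fun k : ℕ => harm 3 k * natInv k * natInv k * connector (k + 1) 0) S := by
  have h1 := (isConnectorDual_cube hs hs').sum_range_mul fun k => pow_nonneg (natInv_pos k).le 3
  refine h1.hasSum_mul (harm_mul_nonneg 3) ?_
  have h3 := hasSum_tail_tsum_two (fun n => pow_nonneg (oddInv_pos n).le 2)
    (fun n => (oddInv_pos n).le) (fun n => pow_nonneg (oddInv_pos n).le 2) hs hs' hS
  exact h3.congr_fun fun n => by ring

/-! ### Double sums over odd and even integers -/

/-- `1 / (2 i + 1)` -/
noncomputable def pInv (i : ℕ) : ℝ := 1 / (2 * (i : ℝ) + 1)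

/-- `1 / (2 i + 2)` -/
noncomputable def eInv (i : ℕ) : ℝ := 1 / (2 * (i : ℝ) + 2)

theorem pInv_pos (i : ℕ) : 0 < pInv i := by unfold pInv; positivity

theorem eInv_pos (i : ℕ) : 0 < eInv i := by unfold eInv; positivity

theorem oddInv_eq (i : ℕ) : oddInv i = 2 * pInv i := by
  unfold oddInv pInv
  field_simp

theorem tendsto_natInv : Tendsto natInv atTop (𝓝 0) := tendsto_one_div_add_atTop_nhds_zero_nat

theorem natInv_antitone : Antitone natInv := fun a b h => by
  unfold natInv
  gcongr

theorem pInv_le (i : ℕ) : pInv i ≤ natInv i := by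
  unfold pInv natInv
  have : (0 : ℝ) ≤ i := by positivity
  gcongr
  linarith

theorem eInv_le (i : ℕ) : eInv i ≤ natInv i := by
  unfold eInv natInv
  have : (0 : ℝ) ≤ i := by positivity
  gcongr <;> linarith

theorem eInv_eq (i : ℕ) : eInv i = natInv i / 2 := by
  unfold eInv natInv
  field_simp

/-- The partial sums are H_{2n} - H_n, where the Euler–Mascheroni constants cancel and log 2
remains. -/
theorem hasSum_pInv_sub_eInv : HasSum (fun j => pInv j - eInv j) (Real.log 2) := by
  rw [hasSum_iff_tendsto_nat_of_nonneg]
  · have h1 : ∀ n, ∑ j ∈ range n, (pInv j - eInv j) = (harmonic (2 * n) : ℝ) - harmonic n := by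
      intro n
      induction n with
      | zero => simp
      | succ n ih =>
        rw [sum_range_succ, ih, mul_add, mul_one, show 2 * n + 2 = 2 * n + 1 + 1 by ring,
          harmonic_succ, harmonic_succ, harmonic_succ]
        unfold pInv eInv
        push_cast
        field_simp
        ring
    have h2 := Real.tendsto_harmonic_sub_log
    have h3 := ((h2.comp (tendsto_id.const_mul_atTop' (two_pos))).sub h2).add_const (Real.log 2)
    rw [sub_self, zero_add] at h3
    refine h3.congr' ?_
    filter_upwards [eventually_gt_atTop 0] with n hn
    rw [h1]
    simp only [Function.comp, id]
    have : (n : ℝ) ≠ 0 := by positivity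
    push_cast
    rw [Real.log_mul two_ne_zero this]
    ring
  · intro j
    unfold pInv eInv
    rw [sub_nonneg]
    gcongr
    norm_num

theorem pInv_antitone : Antitone pInv := fun a b h => by
  unfold pInv
  gcongr

theorem tendsto_pInv : Tendsto pInv atTop (𝓝 0) :=
  squeeze_zero (fun i => (pInv_pos i).le) pInv_le tendsto_natInv

theorem hasSum_telescope_shift {u : ℕ → ℝ} (hu : Antitone u) (h0 : Tendsto u atTop (𝓝 0)) (M : ℕ) :
    HasSum (fun i => u i - u (i + M)) (∑ l ∈ range M, u l) := by
  induction M with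
  | zero => simp
  | succ M ih =>
    have h := hasSum_telescope (u := fun i => u (i + M)) (fun a b h => hu (by omega))
      ((tendsto_add_atTop_iff_nat M).2 h0)
    rw [sum_range_succ]
    convert ih.add h using 1
    · ext i
      rw [add_right_comm, add_assoc]
      ring
    · simp

theorem hasSum_eInv_sub_pInv_shift (M : ℕ) :
    HasSum (fun j => eInv j - pInv (j + M + 1)) (∑ l ∈ range (M + 1), pInv l - Real.log 2) := by
  refine ((hasSum_telescope_shift pInv_antitone tendsto_pInv (M + 1)).sub
    hasSum_pInv_sub_eInv).congr_fun fun j => ?_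
  rw [← add_assoc]
  ring

theorem eInv_antitone : Antitone eInv := fun a b h => by
  unfold eInv
  gcongr

theorem tendsto_eInv : Tendsto eInv atTop (𝓝 0) :=
  squeeze_zero (fun i => (eInv_pos i).le) eInv_le tendsto_natInv

theorem hasSum_pInv_sub_eInv_shift (M : ℕ) :
    HasSum (fun j => pInv j - eInv (j + M)) (Real.log 2 + ∑ l ∈ range M, eInv l) := by
  refine (hasSum_pInv_sub_eInv.add
    (hasSum_telescope_shift eInv_antitone tendsto_eInv M)).congr_fun fun j => ?_
  ring

/-- Reindexing a double series by the sum of the indices. -/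
theorem HasSum.antidiagonal {f : ℕ → ℕ → ℝ} {S : ℝ}
    (h : HasSum (fun p : ℕ × ℕ => f p.1 (p.1 + p.2)) S) :
    HasSum (fun N => ∑ i ∈ range (N + 1), f i N) S := by
  have h1 := (Finset.HasAntidiagonal.sigmaAntidiagonalEquivProd (A := ℕ)).hasSum_iff.2 h
  have h2 := h1.sigma (fun N => hasSum_fintype _)
  convert h2 using 2 with N
  rw [← Finset.Nat.sum_antidiagonal_eq_sum_range_succ (fun i _ => f i N), ← Finset.sum_coe_sort]
  refine Finset.sum_congr rfl fun p _ => ?_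
  simp only [Function.comp, Finset.HasAntidiagonal.sigmaAntidiagonalEquivProd_apply]
  rw [mem_antidiagonal.1 p.2]

theorem HasSum.antidiagonal_succ {f : ℕ → ℕ → ℝ} {S : ℝ}
    (h : HasSum (fun p : ℕ × ℕ => f p.1 (p.1 + p.2 + 1)) S) :
    HasSum (fun N => ∑ i ∈ range N, f i N) S := by
  have := HasSum.antidiagonal (f := fun i N => f i (N + 1)) h
  rw [hasSum_nat_add_iff (f := fun N => ∑ i ∈ range N, f i N) 1] at this
  simpa using this

/-! ### Absolute convergence of the double series -/

theorem summable_natInv_rpow : Summable (fun i => natInv i ^ (3 / 2 : ℝ)) := by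
  have h := (summable_nat_add_iff 1).2 (Real.summable_one_div_nat_rpow (p := 3 / 2).2 (by norm_num))
  refine h.congr fun i => ?_
  unfold natInv
  rw [Real.div_rpow zero_le_one (by positivity), Real.one_rpow]
  push_cast
  rfl

theorem natInv_le_one (i : ℕ) : natInv i ≤ 1 := by
  unfold natInv
  rw [div_le_one (by positivity)]
  have : (0 : ℝ) ≤ i := by positivity
  linarith

/-- The worst case is a = 1, b = 2. The exponent 2 of 1/(i+j+1) is split as 1/2 + 3/2 between the
two indices, giving the product bound (i+1)^(-3/2) (j+1)^(-3/2). -/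
theorem summable_natInv_pair {a b : ℕ} (ha : 1 ≤ a) (hb : 2 ≤ b) :
    Summable (fun p : ℕ × ℕ => natInv p.1 ^ a * natInv (p.1 + p.2) ^ b) := by
  refine Summable.of_nonneg_of_le (fun p => ?_) (fun p => ?_)
    (summable_natInv_rpow.mul_of_nonneg summable_natInv_rpow (fun i => ?_) (fun i => ?_))
  · have := natInv_pos p.1
    have := natInv_pos (p.1 + p.2)
    positivity
  · have h1 := natInv_pos p.1
    have h2 := natInv_pos p.2
    have h3 := natInv_pos (p.1 + p.2)
    calc natInv p.1 ^ a * natInv (p.1 + p.2) ^ b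
        ≤ natInv p.1 ^ 1 * natInv (p.1 + p.2) ^ 2 := by
          gcongr ?_ * ?_
          · exact pow_le_pow_of_le_one h1.le (natInv_le_one _) ha
          · exact pow_le_pow_of_le_one h3.le (natInv_le_one _) hb
      _ = natInv p.1 * (natInv (p.1 + p.2) ^ (1 / 2 : ℝ) * natInv (p.1 + p.2) ^ (3 / 2 : ℝ)) := by
          rw [← Real.rpow_add h3, pow_one, ← Real.rpow_natCast]
          norm_num
      _ ≤ natInv p.1 * (natInv p.1 ^ (1 / 2 : ℝ) * natInv p.2 ^ (3 / 2 : ℝ)) := by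
          have := natInv_antitone (show p.1 ≤ p.1 + p.2 by omega)
          have := natInv_antitone (show p.2 ≤ p.1 + p.2 by omega)
          gcongr
      _ = natInv p.1 ^ (3 / 2 : ℝ) * natInv p.2 ^ (3 / 2 : ℝ) := by
          rw [← mul_assoc]
          nth_rewrite 1 [← Real.rpow_one (natInv p.1)]
          rw [← Real.rpow_add h1]
          norm_num
  all_goals exact Real.rpow_nonneg (natInv_pos i).le _

theorem summable_pair_of_le {x y : ℕ → ℝ} {s : ℕ → ℕ → ℕ} (hx : ∀ i, 0 ≤ x i) (hy : ∀ i, 0 ≤ y i)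
    (hx' : ∀ i, x i ≤ natInv i) (hy' : ∀ i, y i ≤ natInv i) (hs : ∀ i j, i + j ≤ s i j)
    {a b : ℕ} (ha : 1 ≤ a) (hb : 2 ≤ b) :
    Summable (fun p : ℕ × ℕ => x p.1 ^ a * y (s p.1 p.2) ^ b) := by
  refine (summable_natInv_pair ha hb).of_nonneg_of_le
    (fun p => mul_nonneg (pow_nonneg (hx _) _) (pow_nonneg (hy _) _)) fun p => ?_
  have h1 := hx p.1
  have h2 := hy (s p.1 p.2)
  have h3 := natInv_pos p.1
  have := hx' p.1
  have := (hy' (s p.1 p.2)).trans (natInv_antitone (hs p.1 p.2))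
  gcongr

/-- `∑ 1 / (m ^ a n ^ b)` over odd `m < n`, `n` odd. -/
noncomputable def oddOdd (a b : ℕ) : ℝ := ∑' p : ℕ × ℕ, pInv p.1 ^ a * pInv (p.1 + p.2 + 1) ^ b

/-- `∑ 1 / (m ^ a n ^ b)` over `m < n`, `m` odd, `n` even. -/
noncomputable def oddEven (a b : ℕ) : ℝ := ∑' p : ℕ × ℕ, pInv p.1 ^ a * eInv (p.1 + p.2) ^ b

/-- `∑ 1 / (m ^ a n ^ b)` over `m < n`, `m` even, `n` odd. -/
noncomputable def evenOdd (a b : ℕ) : ℝ := ∑' p : ℕ × ℕ, eInv p.1 ^ a * pInv (p.1 + p.2 + 1) ^ b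

theorem hasSum_oddOdd {a b : ℕ} (ha : 1 ≤ a) (hb : 2 ≤ b) :
    HasSum (fun p : ℕ × ℕ => pInv p.1 ^ a * pInv (p.1 + p.2 + 1) ^ b) (oddOdd a b) :=
  (summable_pair_of_le (fun i => (pInv_pos i).le) (fun i => (pInv_pos i).le) pInv_le pInv_le
    (s := fun i j => i + j + 1) (fun i j => by omega) ha hb).hasSum

theorem hasSum_oddEven {a b : ℕ} (ha : 1 ≤ a) (hb : 2 ≤ b) :
    HasSum (fun p : ℕ × ℕ => pInv p.1 ^ a * eInv (p.1 + p.2) ^ b) (oddEven a b) :=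
  (summable_pair_of_le (fun i => (pInv_pos i).le) (fun i => (eInv_pos i).le) pInv_le eInv_le
    (s := fun i j => i + j) (fun i j => by omega) ha hb).hasSum

theorem hasSum_evenOdd {a b : ℕ} (ha : 1 ≤ a) (hb : 2 ≤ b) :
    HasSum (fun p : ℕ × ℕ => eInv p.1 ^ a * pInv (p.1 + p.2 + 1) ^ b) (evenOdd a b) :=
  (summable_pair_of_le (fun i => (eInv_pos i).le) (fun i => (pInv_pos i).le) eInv_le pInv_le
    (s := fun i j => i + j + 1) (fun i j => by omega) ha hb).hasSum

theorem HasSum.prod_swap {f : ℕ → ℕ → ℝ} {S : ℝ} (h : HasSum (fun p : ℕ × ℕ => f p.1 p.2) S) :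
    HasSum (fun p : ℕ × ℕ => f p.2 p.1) S :=
  (Equiv.prodComm ℕ ℕ).hasSum_iff.2 h

theorem hasSum_oddOdd_swap {a b : ℕ} (ha : 1 ≤ a) (hb : 2 ≤ b) :
    HasSum (fun p : ℕ × ℕ => pInv p.2 ^ a * pInv (p.1 + p.2 + 1) ^ b) (oddOdd a b) := by
  simpa only [add_comm] using
    HasSum.prod_swap (f := fun i j => pInv i ^ a * pInv (i + j + 1) ^ b) (hasSum_oddOdd ha hb)

theorem hasSum_oddEven_swap {a b : ℕ} (ha : 1 ≤ a) (hb : 2 ≤ b) :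
    HasSum (fun p : ℕ × ℕ => pInv p.2 ^ a * eInv (p.1 + p.2) ^ b) (oddEven a b) := by
  simpa only [add_comm] using
    HasSum.prod_swap (f := fun i j => pInv i ^ a * eInv (i + j) ^ b) (hasSum_oddEven ha hb)

theorem hasSum_evenOdd_swap {a b : ℕ} (ha : 1 ≤ a) (hb : 2 ≤ b) :
    HasSum (fun p : ℕ × ℕ => eInv p.2 ^ a * pInv (p.1 + p.2 + 1) ^ b) (evenOdd a b) := by
  simpa only [add_comm] using
    HasSum.prod_swap (f := fun i j => eInv i ^ a * pInv (i + j + 1) ^ b) (hasSum_evenOdd ha hb)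

theorem hasSum_oddOdd_nested {a b : ℕ} (ha : 1 ≤ a) (hb : 2 ≤ b) :
    HasSum (fun N => pInv N ^ b * ∑ i ∈ range N, pInv i ^ a) (oddOdd a b) := by
  have := HasSum.antidiagonal_succ (f := fun i N => pInv i ^ a * pInv N ^ b) (hasSum_oddOdd ha hb)
  exact this.congr_fun fun N => by rw [← sum_mul, mul_comm]

theorem hasSum_oddEven_nested {a b : ℕ} (ha : 1 ≤ a) (hb : 2 ≤ b) :
    HasSum (fun N => eInv N ^ b * ∑ i ∈ range (N + 1), pInv i ^ a) (oddEven a b) := by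
  have := HasSum.antidiagonal (f := fun i N => pInv i ^ a * eInv N ^ b) (hasSum_oddEven ha hb)
  exact this.congr_fun fun N => by rw [← sum_mul, mul_comm]

theorem hasSum_evenOdd_nested {a b : ℕ} (ha : 1 ≤ a) (hb : 2 ≤ b) :
    HasSum (fun N => pInv N ^ b * ∑ i ∈ range N, eInv i ^ a) (evenOdd a b) := by
  have := HasSum.antidiagonal_succ (f := fun i N => eInv i ^ a * pInv N ^ b) (hasSum_evenOdd ha hb)
  exact this.congr_fun fun N => by rw [← sum_mul, mul_comm]

/-! ### Single sums over all, even and odd integers -/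

theorem hasSum_natInv_pow {s : ℕ} (hs : 1 < s) : HasSum (fun n => natInv n ^ s) (realZeta s) := by
  have h : Summable (fun n => natInv n ^ s) := by
    refine ((summable_nat_add_iff 1).2 (Real.summable_one_div_nat_pow.2 hs)).congr fun n => ?_
    rw [natInv, div_pow, one_pow]
    push_cast
    rfl
  rw [realZeta_eq_tsum hs]
  convert h.hasSum using 1
  exact tsum_congr fun n => by rw [natInv, div_pow, one_pow]

theorem hasSum_eInv_pow {s : ℕ} (hs : 1 < s) :
    HasSum (fun n => eInv n ^ s) (realZeta s / 2 ^ s) :=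
  ((hasSum_natInv_pow hs).div_const _).congr_fun fun n => by rw [eInv_eq, div_pow]

theorem hasSum_pInv_pow {s : ℕ} (hs : 1 < s) :
    HasSum (fun n => pInv n ^ s) (realZeta s - realZeta s / 2 ^ s) := by
  have h : Summable (fun n => pInv n ^ s) :=
    (hasSum_natInv_pow hs).summable.of_nonneg_of_le (fun n => pow_nonneg (pInv_pos n).le _)
      fun n => pow_le_pow_left₀ (pInv_pos n).le (pInv_le n) _
  have h1 : HasSum (fun n => natInv n ^ s) (∑' n, pInv n ^ s + realZeta s / 2 ^ s) := by
    refine HasSum.even_add_odd (f := fun n => natInv n ^ s) ?_ ?_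
    · exact h.hasSum.congr_fun fun n => by simp only [pInv, natInv]; push_cast; rfl
    · refine (hasSum_eInv_pow hs).congr_fun fun n => ?_
      simp only [eInv, natInv]
      push_cast
      ring
  rw [← eq_sub_of_add_eq ((hasSum_natInv_pow hs).unique h1).symm]
  exact h.hasSum

/-! ### Weight three -/

/-- With m = 2i + 1 and n = 2j + 1 the index i + j encodes the even number m + n, and this is 1/m +
1/n = (m+n)/(mn). In the next lemma n = 2j + 2, so m + n is odd with index i + j + 1. -/
theorem eInv_add_eq (i j : ℕ) : eInv (i + j) * (pInv i + pInv j) = pInv i * pInv j := by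
  simp only [eInv, pInv]
  push_cast
  field_simp
  ring

theorem pInv_add_eq (i j : ℕ) : pInv (i + j + 1) * (pInv i + eInv j) = pInv i * eInv j := by
  simp only [eInv, pInv]
  push_cast
  field_simp
  ring

theorem sub_eInv_add (i j : ℕ) : pInv i * (pInv j - eInv (i + j)) = pInv j * eInv (i + j) := by
  simp only [eInv, pInv]
  push_cast
  field_simp
  ring

theorem eInv_sub_pInv_add (i j : ℕ) :
    pInv i * (eInv j - pInv (i + j + 1)) = eInv j * pInv (i + j + 1) := by
  simp only [eInv, pInv]
  push_cast
  field_simp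
  ring

theorem pInv_sub_pInv_add (i j : ℕ) :
    eInv j * (pInv i - pInv (i + j + 1)) = pInv i * pInv (i + j + 1) := by
  simp only [eInv, pInv]
  push_cast
  field_simp
  ring

/-- Evaluation of `∑ 1 / (m ^ (s - 1) n (m + n))`, `m` odd, `n` even, by telescoping in `n`. -/
theorem odd_even_telescope {s : ℕ} (hs : 2 ≤ s) {S : ℝ}
    (h : HasSum (fun p : ℕ × ℕ => pInv p.1 ^ (s - 1) * eInv p.2 * pInv (p.1 + p.2 + 1)) S) :
    S = oddOdd 1 s + (realZeta (s + 1) - realZeta (s + 1) / 2 ^ (s + 1))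
      - Real.log 2 * (realZeta s - realZeta s / 2 ^ s) := by
  have h1 := h.prod_fiberwise (g := fun i => pInv i ^ s * (∑ l ∈ range (i + 1), pInv l - Real.log 2))
    fun i => ((hasSum_eInv_sub_pInv_shift i).mul_left (pInv i ^ s)).congr_fun fun j => by
      rw [mul_assoc, ← eInv_sub_pInv_add, ← mul_assoc, ← pow_succ, Nat.sub_add_cancel (by omega),
        add_comm j i]
  -- The inner sum runs up to and including the diagonal index, whose term contributes the single
  -- sum of exponent s + 1.
  have h2 := ((hasSum_oddOdd_nested le_rfl hs).add (hasSum_pInv_pow (s := s + 1) (by omega))).sub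
    ((hasSum_pInv_pow (s := s) (by omega)).mul_left (Real.log 2))
  refine h1.unique (h2.congr_fun fun N => ?_)
  simp only [sum_range_succ, pow_one]
  ring

/-- Evaluation of `∑ 1 / (m ^ (s - 1) n (m + n))`, `m, n` odd, by telescoping in `n`. -/
theorem odd_odd_telescope {s : ℕ} (hs : 2 ≤ s) {S : ℝ}
    (h : HasSum (fun p : ℕ × ℕ => pInv p.1 ^ (s - 1) * pInv p.2 * eInv (p.1 + p.2)) S) :
    S = evenOdd 1 s + Real.log 2 * (realZeta s - realZeta s / 2 ^ s) := by
  have h1 := h.prod_fiberwise (g := fun i => pInv i ^ s * (Real.log 2 + ∑ l ∈ range i, eInv l))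
    fun i => ((hasSum_pInv_sub_eInv_shift i).mul_left (pInv i ^ s)).congr_fun fun j => by
      rw [mul_assoc, ← sub_eInv_add, ← mul_assoc, ← pow_succ, Nat.sub_add_cancel (by omega),
        add_comm j i]
  have h2 := (hasSum_evenOdd_nested le_rfl hs).add
    ((hasSum_pInv_pow (s := s) (by omega)).mul_left (Real.log 2))
  refine h1.unique (h2.congr_fun fun N => ?_)
  simp only [pow_one]
  ring

/-- Evaluation of `∑ 1 / (n ^ (s - 1) m (m + n))`, `m` odd, `n` even, by telescoping in `m`. -/
theorem even_odd_telescope {s : ℕ} (hs : 2 ≤ s) {S : ℝ}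
    (h : HasSum (fun p : ℕ × ℕ => eInv p.1 ^ (s - 1) * pInv p.2 * pInv (p.1 + p.2 + 1)) S) :
    S = oddEven 1 s := by
  have h1 := h.prod_fiberwise (g := fun i => eInv i ^ s * ∑ l ∈ range (i + 1), pInv l)
    fun i => ((hasSum_telescope_shift pInv_antitone tendsto_pInv (i + 1)).mul_left
      (eInv i ^ s)).congr_fun fun j => by
      rw [mul_assoc, add_comm i j, ← pInv_sub_pInv_add, ← mul_assoc, ← pow_succ,
        Nat.sub_add_cancel (by omega), add_assoc]
  have h2 := hasSum_oddEven_nested le_rfl hs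
  exact h1.unique (h2.congr_fun fun N => by simp only [pow_one])

/-- Expanding 1/(mn) as (1/m + 1/n)/(m+n) in the three telescoped series gives three linear
equations for the odd–odd, odd–even and even–odd sums of exponents (1, 2). -/
theorem oddOdd_one_two :
    oddOdd 1 2 = Real.log 2 * (3 / 4 * realZeta 2) - 7 / 16 * realZeta 3 := by
  have h1 := odd_even_telescope (s := 2) le_rfl
    (((hasSum_oddOdd (a := 1) (b := 2) le_rfl le_rfl).add
      (hasSum_evenOdd_swap (a := 1) (b := 2) le_rfl le_rfl)).congr_fun fun p => by
        linear_combination -pInv (p.1 + p.2 + 1) * pInv_add_eq p.1 p.2)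
  have h2 := odd_odd_telescope (s := 2) le_rfl
    (((hasSum_oddEven (a := 1) (b := 2) le_rfl le_rfl).add
      (hasSum_oddEven_swap (a := 1) (b := 2) le_rfl le_rfl)).congr_fun fun p => by
        linear_combination -eInv (p.1 + p.2) * eInv_add_eq p.1 p.2)
  have h3 := even_odd_telescope (s := 2) le_rfl
    (((hasSum_oddOdd_swap (a := 1) (b := 2) le_rfl le_rfl).add
      (hasSum_evenOdd (a := 1) (b := 2) le_rfl le_rfl)).congr_fun fun p => by
        have := pInv_add_eq p.2 p.1
        rw [add_comm p.2] at this
        linear_combination -pInv (p.1 + p.2 + 1) * this)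
  norm_num at h1 h2 h3
  linarith

/-! ### Weight five -/

/-- With x = 1/m, y = 1/n, z = 1/(m+n), this is the shuffle decomposition of 1/(m^2 n^3); the
hypothesis is the only relation among the three. -/
theorem partial_fraction_two_three {x y z : ℝ} (h : z * (x + y) = x * y) :
    x ^ 2 * y ^ 3 = 3 * (x * z ^ 4) + x ^ 2 * z ^ 3 + 3 * (y * z ^ 4) + 2 * (y ^ 2 * z ^ 3)
      + y ^ 3 * z ^ 2 := by
  linear_combination (-(x * y ^ 2) - z * (x * y + z * x + z * y + 2 * z ^ 2)
    - z * (y ^ 2 + z * y + z ^ 2)) * h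

theorem partial_fraction_one_three {x y z : ℝ} (h : z * (x + y) = x * y) :
    y ^ 3 * x * z = y ^ 3 * z ^ 2 + y ^ 2 * z ^ 3 + y * z ^ 4 + x * z ^ 4 := by
  linear_combination -z * (y ^ 2 + z * y + z ^ 2) * h

theorem odd_even_telescope_four :
    oddOdd 3 2 + oddOdd 2 3 + oddOdd 1 4 + evenOdd 1 4 = oddOdd 1 4 +
      (realZeta 5 - realZeta 5 / 2 ^ 5) - Real.log 2 * (realZeta 4 - realZeta 4 / 2 ^ 4) := by
  refine odd_even_telescope (s := 4) (by norm_num)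
    (((((hasSum_oddOdd (a := 3) (b := 2) (by norm_num) (by norm_num)).add
    (hasSum_oddOdd (a := 2) (b := 3) (by norm_num) (by norm_num))).add
    (hasSum_oddOdd (a := 1) (b := 4) (by norm_num) (by norm_num))).add
    (hasSum_evenOdd_swap (a := 1) (b := 4) (by norm_num) (by norm_num))).congr_fun fun p => ?_)
  rw [partial_fraction_one_three (x := eInv p.2) (y := pInv p.1) (z := pInv (p.1 + p.2 + 1))
    (by linear_combination pInv_add_eq p.1 p.2), pow_one, pow_one]

theorem odd_odd_telescope_four :
    oddEven 3 2 + oddEven 2 3 + oddEven 1 4 + oddEven 1 4 =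
      evenOdd 1 4 + Real.log 2 * (realZeta 4 - realZeta 4 / 2 ^ 4) := by
  refine odd_odd_telescope (s := 4) (by norm_num)
    (((((hasSum_oddEven (a := 3) (b := 2) (by norm_num) (by norm_num)).add
    (hasSum_oddEven (a := 2) (b := 3) (by norm_num) (by norm_num))).add
    (hasSum_oddEven (a := 1) (b := 4) (by norm_num) (by norm_num))).add
    (hasSum_oddEven_swap (a := 1) (b := 4) (by norm_num) (by norm_num))).congr_fun fun p => ?_)
  rw [partial_fraction_one_three (x := pInv p.2) (y := pInv p.1) (z := eInv (p.1 + p.2))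
    (by linear_combination eInv_add_eq p.1 p.2), pow_one, pow_one]

theorem even_odd_telescope_four :
    evenOdd 3 2 + evenOdd 2 3 + evenOdd 1 4 + oddOdd 1 4 = oddEven 1 4 := by
  refine even_odd_telescope (s := 4) (by norm_num)
    (((((hasSum_evenOdd (a := 3) (b := 2) (by norm_num) (by norm_num)).add
    (hasSum_evenOdd (a := 2) (b := 3) (by norm_num) (by norm_num))).add
    (hasSum_evenOdd (a := 1) (b := 4) (by norm_num) (by norm_num))).add
    (hasSum_oddOdd_swap (a := 1) (b := 4) (by norm_num) (by norm_num))).congr_fun fun p => ?_)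
  rw [partial_fraction_one_three (x := pInv p.2) (y := eInv p.1) (z := pInv (p.1 + p.2 + 1))
    (by have := pInv_add_eq p.2 p.1
        rw [add_comm p.2] at this
        linear_combination this), pow_one, pow_one]

theorem hasSum_mul_of_nonneg {f g : ℕ → ℝ} {A B : ℝ} (hf : ∀ n, 0 ≤ f n) (hg : ∀ n, 0 ≤ g n)
    (hA : HasSum f A) (hB : HasSum g B) : HasSum (fun p : ℕ × ℕ => f p.1 * g p.2) (A * B) := by
  have h := hA.summable.mul_of_nonneg hB.summable hf hg
  exact hA.mul hB h

theorem odd_odd_shuffle :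
    3 * oddEven 1 4 + oddEven 2 3 + 3 * oddEven 1 4 + 2 * oddEven 2 3 + oddEven 3 2 =
      (realZeta 2 - realZeta 2 / 2 ^ 2) * (realZeta 3 - realZeta 3 / 2 ^ 3) := by
  refine HasSum.unique ((((((hasSum_oddEven (a := 1) (b := 4) (by norm_num) (by norm_num)).mul_left 3).add
    (hasSum_oddEven (a := 2) (b := 3) (by norm_num) (by norm_num))).add
    ((hasSum_oddEven_swap (a := 1) (b := 4) (by norm_num) (by norm_num)).mul_left 3)).add
    ((hasSum_oddEven_swap (a := 2) (b := 3) (by norm_num) (by norm_num)).mul_left 2)).add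
    (hasSum_oddEven_swap (a := 3) (b := 2) (by norm_num) (by norm_num)))
    ((hasSum_mul_of_nonneg (fun i => pow_nonneg (pInv_pos i).le _) (fun i => pow_nonneg (pInv_pos i).le _)
      (hasSum_pInv_pow (s := 2) (by norm_num)) (hasSum_pInv_pow (s := 3) (by norm_num))).congr_fun
      fun p => ?_)
  simp only [pow_one]
  exact (partial_fraction_two_three (eInv_add_eq p.1 p.2)).symm

theorem odd_even_shuffle :
    3 * oddOdd 1 4 + oddOdd 2 3 + 3 * evenOdd 1 4 + 2 * evenOdd 2 3 + evenOdd 3 2 =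
      (realZeta 2 - realZeta 2 / 2 ^ 2) * (realZeta 3 / 2 ^ 3) := by
  refine HasSum.unique ((((((hasSum_oddOdd (a := 1) (b := 4) (by norm_num) (by norm_num)).mul_left 3).add
    (hasSum_oddOdd (a := 2) (b := 3) (by norm_num) (by norm_num))).add
    ((hasSum_evenOdd_swap (a := 1) (b := 4) (by norm_num) (by norm_num)).mul_left 3)).add
    ((hasSum_evenOdd_swap (a := 2) (b := 3) (by norm_num) (by norm_num)).mul_left 2)).add
    (hasSum_evenOdd_swap (a := 3) (b := 2) (by norm_num) (by norm_num)))
    ((hasSum_mul_of_nonneg (fun i => pow_nonneg (pInv_pos i).le _) (fun i => pow_nonneg (eInv_pos i).le _)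
      (hasSum_pInv_pow (s := 2) (by norm_num)) (hasSum_eInv_pow (s := 3) (by norm_num))).congr_fun
      fun p => ?_)
  simp only [pow_one]
  exact (partial_fraction_two_three (pInv_add_eq p.1 p.2)).symm

theorem even_odd_shuffle :
    3 * evenOdd 1 4 + evenOdd 2 3 + 3 * oddOdd 1 4 + 2 * oddOdd 2 3 + oddOdd 3 2 =
      (realZeta 2 / 2 ^ 2) * (realZeta 3 - realZeta 3 / 2 ^ 3) := by
  refine HasSum.unique ((((((hasSum_evenOdd (a := 1) (b := 4) (by norm_num) (by norm_num)).mul_left 3).add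
    (hasSum_evenOdd (a := 2) (b := 3) (by norm_num) (by norm_num))).add
    ((hasSum_oddOdd_swap (a := 1) (b := 4) (by norm_num) (by norm_num)).mul_left 3)).add
    ((hasSum_oddOdd_swap (a := 2) (b := 3) (by norm_num) (by norm_num)).mul_left 2)).add
    (hasSum_oddOdd_swap (a := 3) (b := 2) (by norm_num) (by norm_num)))
    ((hasSum_mul_of_nonneg (fun i => pow_nonneg (eInv_pos i).le _) (fun i => pow_nonneg (pInv_pos i).le _)
      (hasSum_eInv_pow (s := 2) (by norm_num)) (hasSum_pInv_pow (s := 3) (by norm_num))).congr_fun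
      fun p => ?_)
  simp only [pow_one]
  refine (partial_fraction_two_three ?_).symm
  have := pInv_add_eq p.2 p.1
  rw [add_comm p.2] at this
  linear_combination this

theorem odd_odd_stuffle :
    oddOdd 2 3 + oddOdd 3 2 + (realZeta 5 - realZeta 5 / 2 ^ 5) =
      (realZeta 2 - realZeta 2 / 2 ^ 2) * (realZeta 3 - realZeta 3 / 2 ^ 3) := by
  refine HasSum.unique (((hasSum_oddOdd_nested (a := 2) (b := 3) (by norm_num) (by norm_num)).add
    (hasSum_oddOdd_nested (a := 3) (b := 2) (by norm_num) (by norm_num))).add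
    (hasSum_pInv_pow (s := 5) (by norm_num)))
    ((hasSum_stuffle (fun i => pow_nonneg (pInv_pos i).le _) (fun i => pow_nonneg (pInv_pos i).le _)
      (hasSum_pInv_pow (s := 2) (by norm_num)) (hasSum_pInv_pow (s := 3) (by norm_num))).congr_fun
      fun n => ?_)
  ring

theorem odd_even_stuffle {a b : ℕ} (ha : 2 ≤ a) (hb : 2 ≤ b) :
    oddEven a b + evenOdd b a = (realZeta a - realZeta a / 2 ^ a) * (realZeta b / 2 ^ b) := by
  refine HasSum.unique ((hasSum_oddEven_nested (a := a) (b := b) (by omega) (by omega)).add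
    (hasSum_evenOdd_nested (a := b) (b := a) (by omega) (by omega)))
    ((hasSum_stuffle (fun i => pow_nonneg (pInv_pos i).le _) (fun i => pow_nonneg (eInv_pos i).le _)
      (hasSum_pInv_pow (s := a) (by omega)) (hasSum_eInv_pow (s := b) (by omega))).congr_fun
      fun n => ?_)
  rw [sum_range_succ]
  ring

/-- There are nine unknowns, three parity patterns with exponents (1,4), (2,3), (3,2), and nine
linear relations: three telescopings, three shuffles and three stuffles. -/
theorem oddOdd_one_four :
    oddOdd 1 4 = 15 / 16 * Real.log 2 * realZeta 4 - 31 / 64 * realZeta 5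
      - 3 / 32 * realZeta 2 * realZeta 3 := by
  have := odd_even_telescope_four
  have := odd_odd_telescope_four
  have := even_odd_telescope_four
  have := odd_odd_shuffle
  have := odd_even_shuffle
  have := even_odd_shuffle
  have := odd_odd_stuffle
  have := odd_even_stuffle (a := 2) (b := 3) (by norm_num) (by norm_num)
  have := odd_even_stuffle (a := 3) (b := 2) (by norm_num) (by norm_num)
  linarith

theorem oddOdd_three_two :
    oddOdd 3 2 = 3 / 8 * realZeta 2 * realZeta 3 - 31 / 64 * realZeta 5 := by
  have := odd_even_telescope_four
  have := odd_odd_telescope_four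
  have := even_odd_telescope_four
  have := odd_odd_shuffle
  have := odd_even_shuffle
  have := even_odd_shuffle
  have := odd_odd_stuffle
  have := odd_even_stuffle (a := 2) (b := 3) (by norm_num) (by norm_num)
  have := odd_even_stuffle (a := 3) (b := 2) (by norm_num) (by norm_num)
  linarith

/-! ### The sums dual to odd double and triple sums -/

theorem hasSum_oddInv_pow {s : ℕ} (hs : 1 < s) :
    HasSum (fun n => oddInv n ^ s) (2 ^ s * (realZeta s - realZeta s / 2 ^ s)) :=
  ((hasSum_pInv_pow hs).mul_left _).congr_fun fun n => by rw [oddInv_eq, mul_pow]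

theorem hasSum_oddInv_nested {a b : ℕ} (ha : 1 ≤ a) (hb : 2 ≤ b) :
    HasSum (fun n => oddInv n ^ b * ∑ i ∈ range n, oddInv i ^ a) (2 ^ (a + b) * oddOdd a b) :=
  ((hasSum_oddOdd_nested ha hb).mul_left _).congr_fun fun n => by
    simp only [oddInv_eq, mul_pow, ← mul_sum]
    ring

theorem summable_oddInv_mul_tail {a : ℕ} (ha : 1 ≤ a) :
    Summable fun n => oddInv n ^ a * ∑' i, oddInv (n + 1 + i) ^ 2 :=
  (hasSum_tail_tsum (fun n => pow_nonneg (oddInv_pos n).le a)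
    (fun n => pow_nonneg (oddInv_pos n).le 2) (hasSum_oddInv_pow one_lt_two).summable
    (hasSum_oddInv_nested ha le_rfl)).summable

theorem sum_oddInv_sq_mul_sum (N : ℕ) :
    (∑ i ∈ range N, oddInv i ^ 2) * ∑ i ∈ range N, oddInv i =
      ∑ i ∈ range N, oddInv i ^ 2 * ∑ j ∈ range i, oddInv j +
      ∑ i ∈ range N, oddInv i * ∑ j ∈ range i, oddInv j ^ 2 + ∑ i ∈ range N, oddInv i ^ 3 := by
  induction N with
  | zero => simp
  | succ N ih => simp only [sum_range_succ]; linear_combination ih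

/-- The stuffle product of `∑ 1 / n ^ 2` and `∑ 1 / (m n ^ 2)` over odd numbers. -/
theorem hasSum_oddInv_triple {S : ℝ}
    (hS : HasSum (fun n => oddInv n ^ 2 * ∑ i ∈ range n, oddInv i ^ 2 * ∑ j ∈ range i, oddInv j) S) :
    HasSum (fun n => oddInv n ^ 2 * ∑ i ∈ range n, oddInv i * ∑ j ∈ range i, oddInv j ^ 2)
      (32 * (3 / 4 * realZeta 2 * oddOdd 1 2 - oddOdd 3 2 - oddOdd 1 4) - 2 * S) := by
  have h0 := oddInv_pos
  have h := hasSum_stuffle (f := fun n => oddInv n ^ 2) (g := fun n => oddInv n ^ 2 * ∑ i ∈ range n, oddInv i ^ 1)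
    (fun n => pow_nonneg (h0 n).le 2)
    (fun n => mul_nonneg (pow_nonneg (h0 n).le 2) (sum_nonneg fun i _ => pow_nonneg (h0 i).le 1))
    (hasSum_oddInv_pow one_lt_two) (hasSum_oddInv_nested le_rfl le_rfl)
  have h' := (((h.sub (hasSum_oddInv_nested (a := 3) (b := 2) (by norm_num) le_rfl)).sub
    (hasSum_oddInv_nested (a := 1) (b := 4) le_rfl (by norm_num))).sub (hS.mul_left 2))
  rw [show 32 * (3 / 4 * realZeta 2 * oddOdd 1 2 - oddOdd 3 2 - oddOdd 1 4) - 2 * S =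
    2 ^ 2 * (realZeta 2 - realZeta 2 / 2 ^ 2) * (2 ^ (1 + 2) * oddOdd 1 2) - 2 ^ (3 + 2) * oddOdd 3 2 -
        2 ^ (1 + 4) * oddOdd 1 4 - 2 * S by ring]
  refine h'.congr_fun fun n => ?_
  simp only [pow_one]
  linear_combination -oddInv n ^ 2 * sum_oddInv_sq_mul_sum n

/-- The series is dominated by one of the nonnegative parts of a convergent stuffle product. Only
existence is needed: uniqueness of sums on the dual side identifies the value later. -/
theorem exists_hasSum_oddInv_triple : ∃ S, HasSum
    (fun n => oddInv n ^ 2 * ∑ i ∈ range n, oddInv i ^ 2 * ∑ j ∈ range i, oddInv j) S := by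
  have h0 := oddInv_pos
  have h := hasSum_stuffle (f := fun n => oddInv n ^ 2) (g := fun n => oddInv n ^ 2 * ∑ i ∈ range n, oddInv i ^ 1)
    (fun n => pow_nonneg (h0 n).le 2)
    (fun n => mul_nonneg (pow_nonneg (h0 n).le 2) (sum_nonneg fun i _ => pow_nonneg (h0 i).le 1))
    (hasSum_oddInv_pow one_lt_two) (hasSum_oddInv_nested le_rfl le_rfl)
  refine (h.summable.of_nonneg_of_le (fun n => ?_) fun n => ?_)
  · exact mul_nonneg (sq_nonneg _) (sum_nonneg fun i _ =>
      mul_nonneg (sq_nonneg _) (sum_nonneg fun i _ => (h0 i).le))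
  · simp only [pow_one]
    have h1 : 0 ≤ oddInv n ^ 2 * (∑ i ∈ range n, oddInv i) * ∑ i ∈ range n, oddInv i ^ 2 :=
      mul_nonneg (mul_nonneg (sq_nonneg _) (sum_nonneg fun i _ => (h0 i).le))
        (sum_nonneg fun i _ => sq_nonneg _)
    have h2 : 0 ≤ oddInv n ^ 2 * (oddInv n ^ 2 * ∑ i ∈ range n, oddInv i) :=
      mul_nonneg (sq_nonneg _) (mul_nonneg (sq_nonneg _) (sum_nonneg fun i _ => (h0 i).le))
    linarith

/-- `∑ 4 ^ k / (k ^ 2 binom(2k, k)) · e₃` in the numbers `1 / n`, `n < k`. -/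
theorem hasSum_elementary_three :
    HasSum (fun k : ℕ => (∑ i ∈ range k, (∑ j ∈ range i, harm 1 j * natInv j) * natInv i) *
      natInv k * natInv k * connector (k + 1) 0) (31 * realZeta 5) := by
  convert hasSum_connector_nested_one_one_one (hasSum_oddInv_pow (s := 5) (by norm_num)) using 1
  ring

theorem hasSum_elementary_two :
    HasSum (fun k : ℕ => (∑ j ∈ range k, harm 1 j * natInv j) * natInv k * natInv k * natInv k *
      connector (k + 1) 0)
      (30 * Real.log 2 * realZeta 4 - 31 / 2 * realZeta 5 - 3 * realZeta 2 * realZeta 3) := by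
  convert hasSum_connector_nested_one_one (hasSum_oddInv_pow (s := 4) (by norm_num)).summable
    (by simpa only [pow_one] using hasSum_oddInv_nested (a := 1) (b := 4) le_rfl (by norm_num)) using 1
  rw [oddOdd_one_four]
  ring

theorem hasSum_nested_two_one_add_one_two :
    HasSum (fun k : ℕ => ((∑ j ∈ range k, harm 1 j * natInv j * natInv j) +
      ∑ j ∈ range k, harm 2 j * natInv j) * natInv k * natInv k * connector (k + 1) 0)
      (21 * realZeta 2 * realZeta 3 - 31 * realZeta 5) := by
  have h1 := hasSum_connector_nested_two_one (hasSum_oddInv_pow (s := 3) (by norm_num)).summable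
    (hasSum_oddInv_nested (a := 2) (b := 3) (by norm_num) (by norm_num))
  have h2 := hasSum_connector_nested_one_two (hasSum_oddInv_pow (s := 2) (by norm_num)).summable
    (hasSum_oddInv_nested (a := 3) (b := 2) (by norm_num) (by norm_num))
  rw [show 21 * realZeta 2 * realZeta 3 - 31 * realZeta 5 =
    2 ^ (2 + 3) * oddOdd 2 3 + 2 ^ (3 + 2) * oddOdd 3 2 by linear_combination -32 * odd_odd_stuffle]
  exact (h1.add h2).congr_fun fun k => by ring

/-- The two triple sums dual to these series occur together in the stuffle product of
`hasSum_oddInv_triple`, so one determines the other modulo the known double sums. -/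
theorem hasSum_harm_three_of_harm_two {S : ℝ}
    (hS : HasSum (fun k : ℕ => harm 2 k * natInv k * natInv k * natInv k * connector (k + 1) 0) S) :
    HasSum (fun k : ℕ => harm 3 k * natInv k * natInv k * connector (k + 1) 0)
      (18 * Real.log 2 * realZeta 2 ^ 2 - 30 * Real.log 2 * realZeta 4 + 31 * realZeta 5
        - 39 / 2 * realZeta 2 * realZeta 3 - 2 * S) := by
  obtain ⟨S', hS'⟩ := exists_hasSum_oddInv_triple
  have hs := (hasSum_oddInv_pow one_lt_two).summable
  have h := hasSum_connector_harm_two hs (summable_oddInv_mul_tail one_le_two) hS'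
  rw [h.unique hS] at hS'
  convert hasSum_connector_harm_three hs
    (by simpa only [pow_one] using summable_oddInv_mul_tail le_rfl) (hasSum_oddInv_triple hS') using 1
  rw [oddOdd_one_two, oddOdd_three_two, oddOdd_one_four]
  ring

/-! ### Integrability of powers of logarithms -/

/-- From |log x| x^(1/(2m)) < 2m, raised to the m-th power. The singularity x^(-1/2) is integrable,
whatever m is. -/
theorem abs_log_pow_le {x : ℝ} (h0 : 0 < x) (h1 : x ≤ 1) (m : ℕ) :
    |Real.log x| ^ m ≤ (2 * m + 1 : ℝ) ^ m * x ^ (-(1 / 2) : ℝ) := by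
  rcases Nat.eq_zero_or_pos m with rfl | hm
  · simp only [pow_zero, one_mul]
    exact Real.one_le_rpow_of_pos_of_le_one_of_nonpos h0 h1 (by norm_num)
  have hm' : (0 : ℝ) < m := by exact_mod_cast hm
  have h := Real.abs_log_mul_self_rpow_lt x (1 / (2 * m)) h0 h1 (by positivity)
  rw [abs_mul, abs_of_pos (Real.rpow_pos_of_pos h0 _), one_div_one_div] at h
  have h2 := pow_le_pow_left₀ (by positivity) h.le m
  rw [mul_pow, ← Real.rpow_natCast (x ^ _), ← Real.rpow_mul h0.le,
    show 1 / (2 * (m : ℝ)) * m = 1 / 2 by field_simp] at h2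
  rw [Real.rpow_neg h0.le, ← div_eq_mul_inv, le_div_iff₀ (by positivity)]
  refine h2.trans (pow_le_pow_left₀ (by positivity) (by linarith) m)

theorem intervalIntegrable_abs_log_pow (m : ℕ) :
    IntervalIntegrable (fun x => |Real.log x| ^ m) volume 0 1 := by
  have h := (intervalIntegral.intervalIntegrable_rpow' (a := 0) (b := 1) (r := -(1 / 2))
    (by norm_num)).const_mul ((2 * m + 1 : ℝ) ^ m)
  refine h.mono_fun' (by fun_prop) ?_
  rw [Set.uIoc_of_le zero_le_one]
  filter_upwards [ae_restrict_mem measurableSet_Ioc] with x hx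
  rw [norm_pow, Real.norm_eq_abs, abs_abs]
  exact abs_log_pow_le hx.1 hx.2 m

theorem measurable_abs_log_sin : Measurable fun x => |Real.log (Real.sin x)| :=
  (Real.measurable_log.comp Real.measurable_sin).norm

/-- On [0, π/2] Jordan's inequality sin x ≥ 2x/π reduces the claim to powers of log x; the
reflection x ↦ π - x gives the other half. -/
theorem intervalIntegrable_abs_log_sin_pow (m : ℕ) :
    IntervalIntegrable (fun x => |Real.log (Real.sin x)| ^ m) volume 0 Real.pi := by
  have hpi := Real.pi_pos
  have h1 : IntervalIntegrable (fun x => |Real.log (Real.sin x)| ^ m) volume 0 (Real.pi / 2) := by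
    have h := (intervalIntegrable_abs_log_pow m).comp_mul_left (c := 2 / Real.pi)
    rw [zero_div, one_div_div] at h
    refine h.mono_fun' (measurable_abs_log_sin.pow_const m).aestronglyMeasurable ?_
    rw [Set.uIoc_of_le (by positivity)]
    filter_upwards [ae_restrict_mem measurableSet_Ioc] with x hx
    have h2 : 2 / Real.pi * x ≤ Real.sin x := Real.mul_le_sin hx.1.le hx.2
    have h3 : 0 < 2 / Real.pi * x := mul_pos (by positivity) hx.1
    rw [norm_pow, Real.norm_eq_abs, abs_abs]
    refine pow_le_pow_left₀ (abs_nonneg _) ?_ m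
    have h4 := Real.log_le_log h3 h2
    have h5 := Real.log_nonpos (h3.le.trans h2) (Real.sin_le_one x)
    rw [abs_of_nonpos h5, abs_of_nonpos (h4.trans h5)]
    linarith
  have h2 := h1.comp_sub_left Real.pi
  simp only [Real.sin_pi_sub, sub_zero] at h2
  rw [show Real.pi - Real.pi / 2 = Real.pi / 2 by ring] at h2
  exact h1.trans h2.symm

theorem intervalIntegrable_const_add_abs_log_sin_pow {c : ℝ} (hc : 0 ≤ c) (m : ℕ) :
    IntervalIntegrable (fun x => (c + |Real.log (Real.sin x)|) ^ m) volume 0 Real.pi := by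
  have h := ((intervalIntegrable_const (μ := volume) (a := 0) (b := Real.pi) (c := c ^ m)).add
    (intervalIntegrable_abs_log_sin_pow m)).const_mul (2 ^ (m - 1))
  refine h.mono_fun' ((measurable_abs_log_sin.const_add c).pow_const m).aestronglyMeasurable
    (ae_of_all _ fun x => ?_)
  beta_reduce
  rw [norm_pow, Real.norm_eq_abs, abs_of_nonneg (by positivity)]
  exact add_pow_le hc (abs_nonneg _) m

/-! ### Powers of `log (1 + z)` on the half circle -/

/-- Rotating by e^{-iφ} leaves r real and puts -sin φ in the imaginary part. The bound does not
depend on r, as domination up to r = 1 requires. -/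
theorem sin_le_norm_one_add {r φ : ℝ} :
    Real.sin φ ≤ ‖1 + (r : ℂ) * Complex.exp (φ * Complex.I)‖ := by
  have h : ‖1 + (r : ℂ) * Complex.exp (φ * Complex.I)‖ =
      ‖Complex.exp ((-φ : ℝ) * Complex.I) + r‖ := by
    rw [show 1 + (r : ℂ) * Complex.exp (φ * Complex.I) = Complex.exp (φ * Complex.I) *
      (Complex.exp ((-φ : ℝ) * Complex.I) + r) by
        rw [mul_add, ← Complex.exp_add]
        push_cast
        rw [show (φ : ℂ) * Complex.I + -φ * Complex.I = 0 by ring, Complex.exp_zero]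
        ring, norm_mul, Complex.norm_exp_ofReal_mul_I, one_mul]
  rw [h]
  refine le_trans ?_ (Complex.abs_im_le_norm _)
  rw [Complex.add_im, Complex.exp_ofReal_mul_I_im, Complex.ofReal_im, Real.sin_neg, add_zero, abs_neg]
  exact le_abs_self _

theorem norm_log_one_add_le {r φ : ℝ} (h0 : 0 ≤ r) (h1 : r ≤ 1) (hφ : φ ∈ Set.Ioo 0 Real.pi) :
    ‖Complex.log (1 + (r : ℂ) * Complex.exp (φ * Complex.I))‖ ≤
      (Real.pi + Real.log 2) + |Real.log (Real.sin φ)| := by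
  have hs := Real.sin_pos_of_mem_Ioo hφ
  have hn := sin_le_norm_one_add (r := r) (φ := φ)
  have hn2 : ‖1 + (r : ℂ) * Complex.exp (φ * Complex.I)‖ ≤ 2 := by
    refine (norm_add_le _ _).trans ?_
    rw [norm_one, norm_mul, Complex.norm_exp_ofReal_mul_I, mul_one, Complex.norm_real,
      Real.norm_of_nonneg h0]
    linarith
  refine (Complex.norm_le_abs_re_add_abs_im _).trans ?_
  rw [Complex.log_re, Complex.log_im]
  have h3 := Real.log_le_log hs hn
  have h4 := Real.log_le_log (hs.trans_le hn) hn2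
  have h5 := Complex.abs_arg_le_pi (1 + (r : ℂ) * Complex.exp (φ * Complex.I))
  have h6 := Real.log_nonneg one_le_two
  have h7 : |Real.log ‖1 + (r : ℂ) * Complex.exp (φ * Complex.I)‖| ≤
      Real.log 2 + |Real.log (Real.sin φ)| := by
    rw [abs_le]
    constructor
    · linarith [neg_abs_le (Real.log (Real.sin φ))]
    · linarith [abs_nonneg (Real.log (Real.sin φ))]
  linarith

theorem one_add_mem_slitPlane {r φ : ℝ} (h0 : 0 ≤ r) (hφ : φ ∈ Set.Ioo 0 Real.pi) :
    1 + (r : ℂ) * Complex.exp (φ * Complex.I) ∈ Complex.slitPlane := by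
  rcases h0.eq_or_lt with rfl | h0
  · simp
  · right
    rw [Complex.add_im, Complex.im_ofReal_mul, Complex.exp_ofReal_mul_I_im, Complex.one_im, zero_add]
    exact (mul_pos h0 (Real.sin_pos_of_mem_Ioo hφ)).ne'

theorem ae_mem_Ioo_of_uIoc : ∀ᵐ φ : ℝ, φ ∈ Set.uIoc 0 Real.pi → φ ∈ Set.Ioo 0 Real.pi := by
  filter_upwards [Measure.ae_ne volume Real.pi] with φ hφ h
  rw [Set.uIoc_of_le Real.pi_pos.le] at h
  exact ⟨h.1, lt_of_le_of_ne h.2 hφ⟩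

/-- Dominated convergence reaches the boundary r = 1 in spite of the singularity at z = -1. This is
used both for Cauchy's theorem and for Abel summation of the Fourier series. -/
theorem continuousOn_integral_log_one_add (j m : ℕ) :
    ContinuousOn (fun r : ℝ => ∫ φ in 0..Real.pi, (φ : ℂ) ^ j *
      Complex.log (1 + (r : ℂ) * Complex.exp (φ * Complex.I)) ^ m) (Set.Icc 0 1) := by
  intro r₀ hr₀
  refine intervalIntegral.continuousWithinAt_of_dominated_interval
    (bound := fun φ => Real.pi ^ j * ((Real.pi + Real.log 2) + |Real.log (Real.sin φ)|) ^ m)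
    (Eventually.of_forall fun r => ?_) ?_ ?_ ?_
  · exact Measurable.aestronglyMeasurable (by fun_prop)
  · filter_upwards [self_mem_nhdsWithin] with r hr
    filter_upwards [ae_mem_Ioo_of_uIoc] with φ hφ h
    have h' := hφ h
    rw [norm_mul, norm_pow, norm_pow, Complex.norm_real, Real.norm_of_nonneg h'.1.le]
    have := norm_log_one_add_le hr.1 hr.2 h'
    have := h'.1
    have := h'.2.le
    gcongr
  · exact (intervalIntegrable_const_add_abs_log_sin_pow
      (add_nonneg Real.pi_pos.le (Real.log_nonneg one_le_two)) m).const_mul _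
  · filter_upwards [ae_mem_Ioo_of_uIoc] with φ hφ h
    have h' := one_add_mem_slitPlane hr₀.1 (hφ h)
    have h2 : ContinuousAt (fun r : ℝ => Complex.log (1 + (r : ℂ) * Complex.exp (φ * Complex.I))) r₀ :=
      ContinuousAt.clog (by fun_prop) h'
    exact (continuousAt_const.mul (h2.pow m)).continuousWithinAt

/-- Cauchy's theorem for `log (1 + z) ^ m / z` on a half annulus. -/
theorem integral_log_one_add_half_annulus (m : ℕ) {r₀ r₁ : ℝ} (h0 : 0 < r₀) (h01 : r₀ ≤ r₁)
    (h1 : r₁ < 1) :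
    (∫ φ in 0..Real.pi, Complex.log (1 + (r₁ : ℂ) * Complex.exp (φ * Complex.I)) ^ m) -
      ∫ φ in 0..Real.pi, Complex.log (1 + (r₀ : ℂ) * Complex.exp (φ * Complex.I)) ^ m =
    Complex.I * ((∫ u in r₀..r₁, (Real.log (1 + u) ^ m - Real.log (1 - u) ^ m) / u : ℝ) : ℂ) := by
  have hr1 := h0.trans_le h01
  have hsub : ∀ u : ℝ, u ∈ Set.uIcc r₀ r₁ → 0 < u ∧ u < 1 := by
    intro u hu
    rw [Set.uIcc_of_le h01] at hu
    exact ⟨h0.trans_le hu.1, hu.2.trans_lt h1⟩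
  -- The substitution z = e^w makes the half annulus a rectangle and dz/z into dw; the edges Im w =
  -- 0 and Im w = π are the radii z = u and z = -u.
  have H := Complex.integral_boundary_rect_eq_zero_of_differentiableOn
    (fun w => Complex.log (1 + Complex.exp w) ^ m) (Real.log r₀ : ℂ)
    ((Real.log r₁ : ℂ) + Real.pi * Complex.I) ?_
  · simp only [Complex.ofReal_re, Complex.add_re, Complex.add_im, Complex.ofReal_im,
      Complex.re_ofReal_mul, Complex.im_ofReal_mul, Complex.I_re, Complex.I_im, mul_zero, mul_one, add_zero,
      zero_add, Complex.ofReal_zero, zero_mul, smul_eq_mul, Complex.exp_add, Complex.exp_pi_mul_I,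
      ← Complex.ofReal_exp, Real.exp_log h0, Real.exp_log hr1] at H
    have hint : ∀ f : ℝ → ℝ, (∀ u ∈ Set.uIcc r₀ r₁, ContinuousAt f u) →
        ∫ x in Real.log r₀..Real.log r₁, f (Real.exp x) = ∫ u in r₀..r₁, f u / u := by
      intro f hf
      have := intervalIntegral.integral_comp_mul_deriv' (f := Real.exp) (f' := Real.exp)
        (g := fun u => f u / u) (a := Real.log r₀) (b := Real.log r₁)
        (fun x _ => Real.hasDerivAt_exp x) Real.continuous_exp.continuousOn ?_
      · rw [Real.exp_log h0, Real.exp_log hr1] at this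
        rw [← this]
        refine intervalIntegral.integral_congr fun x _ => ?_
        simp only [Function.comp]
        rw [div_mul_cancel₀ _ (Real.exp_pos x).ne']
      · rintro _ ⟨x, hx, rfl⟩
        have hx' : Real.exp x ∈ Set.uIcc r₀ r₁ := by
          have hl := Real.log_le_log h0 h01
          rw [Set.uIcc_of_le hl] at hx
          rw [Set.uIcc_of_le h01]
          exact ⟨(Real.log_le_iff_le_exp h0).1 hx.1, (Real.le_log_iff_exp_le hr1).1 hx.2⟩
        exact ((hf _ hx').div continuousAt_id (Real.exp_pos x).ne').continuousWithinAt
    have c1 : ∀ u ∈ Set.uIcc r₀ r₁, ContinuousAt (fun u => Real.log (1 + u) ^ m) u := fun u hu =>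
      ContinuousAt.pow (ContinuousAt.log (by fun_prop) (by linarith [hsub u hu])) m
    have c2 : ∀ u ∈ Set.uIcc r₀ r₁, ContinuousAt (fun u => Real.log (1 - u) ^ m) u := fun u hu =>
      ContinuousAt.pow (ContinuousAt.log (by fun_prop) (by linarith [hsub u hu])) m
    have e1 : ∫ x in Real.log r₀..Real.log r₁, Complex.log (1 + (Real.exp x : ℂ)) ^ m =
        ((∫ u in r₀..r₁, Real.log (1 + u) ^ m / u : ℝ) : ℂ) := by
      rw [← hint _ c1, ← intervalIntegral.integral_ofReal]
      refine intervalIntegral.integral_congr fun x _ => ?_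
      rw [Complex.ofReal_pow, Complex.ofReal_log (by positivity)]
      push_cast
      rfl
    have e2 : ∫ x in Real.log r₀..Real.log r₁, Complex.log (1 + (Real.exp x : ℂ) * -1) ^ m =
        ((∫ u in r₀..r₁, Real.log (1 - u) ^ m / u : ℝ) : ℂ) := by
      rw [← hint _ c2, ← intervalIntegral.integral_ofReal]
      refine intervalIntegral.integral_congr fun x hx => ?_
      rw [Set.uIcc_of_le (Real.log_le_log h0 h01)] at hx
      have : Real.exp x < 1 := ((Real.le_log_iff_exp_le hr1).1 hx.2).trans_lt h1
      rw [Complex.ofReal_pow, Complex.ofReal_log (by linarith)]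
      push_cast
      ring_nf
    rw [e1, e2] at H
    have e3 : ∫ u in r₀..r₁, (Real.log (1 + u) ^ m - Real.log (1 - u) ^ m) / u =
        (∫ u in r₀..r₁, Real.log (1 + u) ^ m / u) - ∫ u in r₀..r₁, Real.log (1 - u) ^ m / u := by
      rw [← intervalIntegral.integral_sub]
      · simp only [sub_div]
      · exact ContinuousOn.intervalIntegrable fun u hu =>
          ((c1 u hu).div continuousAt_id (hsub u hu).1.ne').continuousWithinAt
      · exact ContinuousOn.intervalIntegrable fun u hu =>
          ((c2 u hu).div continuousAt_id (hsub u hu).1.ne').continuousWithinAt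
    rw [e3]
    push_cast
    linear_combination (-Complex.I) * H + (1 : ℂ) * ((∫ φ in 0..Real.pi, Complex.log (1 + (r₁ : ℂ) * Complex.exp (φ * Complex.I)) ^ m) -
      ∫ φ in 0..Real.pi, Complex.log (1 + (r₀ : ℂ) * Complex.exp (φ * Complex.I)) ^ m) * Complex.I_sq
  · intro w hw
    have hre : w.re ≤ Real.log r₁ := by
      have := hw.1
      simp only [Complex.ofReal_re, Complex.add_re, Complex.re_ofReal_mul, Complex.I_re, mul_zero,
        add_zero, Set.mem_preimage] at this
      rw [Set.uIcc_of_le (Real.log_le_log h0 h01)] at this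
      exact this.2
    have hn : ‖Complex.exp w‖ < 1 := by
      rw [Complex.norm_exp]
      exact ((Real.le_log_iff_exp_le hr1).1 hre).trans_lt h1
    have hs := Complex.mem_slitPlane_of_norm_lt_one hn
    have hd : DifferentiableAt ℂ (fun w => Complex.log (1 + Complex.exp w)) w :=
      DifferentiableAt.clog (by fun_prop) hs
    exact (hd.pow m).differentiableWithinAt

theorem intervalIntegrable_log_one_add_pow_div {m : ℕ} (hm : 1 ≤ m) :
    IntervalIntegrable (fun u => Real.log (1 + u) ^ m / u) volume 0 1 := by
  refine (intervalIntegrable_const (c := (1 : ℝ))).mono_fun' (Measurable.aestronglyMeasurable ?_) ?_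
  · exact ((Real.measurable_log.comp (measurable_const.add measurable_id)).pow_const m).div measurable_id
  rw [Set.uIoc_of_le zero_le_one]
  filter_upwards [ae_restrict_mem measurableSet_Ioc] with u hu
  have h0 : 0 ≤ Real.log (1 + u) := Real.log_nonneg (by linarith [hu.1])
  have h1 : Real.log (1 + u) ≤ u := by linarith [Real.log_le_sub_one_of_pos (show 0 < 1 + u by linarith [hu.1])]
  rw [Real.norm_of_nonneg (div_nonneg (pow_nonneg h0 m) hu.1.le), div_le_one hu.1]
  calc Real.log (1 + u) ^ m ≤ Real.log (1 + u) ^ 1 :=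
        pow_le_pow_of_le_one h0 (h1.trans hu.2) hm
    _ ≤ u := by rwa [pow_one]

theorem intervalIntegrable_abs_log_one_sub_pow (m : ℕ) :
    IntervalIntegrable (fun u => |Real.log (1 - u)| ^ m) volume 0 1 := by
  have h := (intervalIntegrable_abs_log_pow m).comp_sub_left 1
  simpa using h.symm

/-- The factor u on the right cancels the pole of log(1 - u)^m / u at 0, leaving powers of the
logarithm as the dominating function. -/
theorem neg_log_one_sub_le {u : ℝ} (h1 : u < 1) :
    -Real.log (1 - u) ≤ u * (1 + -Real.log (1 - u)) := by
  have h := Real.one_sub_inv_le_log_of_pos (sub_pos.2 h1)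
  have h2 := mul_le_mul_of_nonneg_left h (sub_pos.2 h1).le
  rw [mul_sub, mul_inv_cancel₀ (sub_pos.2 h1).ne'] at h2
  linarith

theorem intervalIntegrable_log_one_sub_pow_div {m : ℕ} (hm : 1 ≤ m) :
    IntervalIntegrable (fun u => Real.log (1 - u) ^ m / u) volume 0 1 := by
  obtain ⟨m, rfl⟩ := Nat.exists_eq_add_of_le' hm
  refine ((intervalIntegrable_abs_log_one_sub_pow m).add
    (intervalIntegrable_abs_log_one_sub_pow (m + 1))).mono_fun' (Measurable.aestronglyMeasurable ?_) ?_
  · exact ((Real.measurable_log.comp (measurable_const.sub measurable_id)).pow_const _).div measurable_id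
  rw [Set.uIoc_of_le zero_le_one]
  filter_upwards [ae_restrict_mem measurableSet_Ioc, ae_restrict_of_ae (Measure.ae_ne volume (1 : ℝ))]
    with u hu hu1
  have hu2 := lt_of_le_of_ne hu.2 hu1
  have h0 : Real.log (1 - u) ≤ 0 := Real.log_nonpos (by linarith) (by linarith [hu.1])
  have h := neg_log_one_sub_le hu2
  rw [norm_div, norm_pow, Real.norm_eq_abs, Real.norm_of_nonneg hu.1.le, div_le_iff₀ hu.1, pow_succ]
  rw [← abs_of_nonpos h0] at h
  calc |Real.log (1 - u)| ^ m * |Real.log (1 - u)|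
      ≤ |Real.log (1 - u)| ^ m * (u * (1 + |Real.log (1 - u)|)) := by gcongr
    _ = _ := by
      ring

/-- Cauchy's theorem for `log (1 + z) ^ m / z` on the upper half disc. -/
theorem integral_log_one_add_half_circle {m : ℕ} (hm : 1 ≤ m) :
    ∫ φ in 0..Real.pi, Complex.log (1 + Complex.exp (φ * Complex.I)) ^ m =
    Complex.I * (((∫ u in (0 : ℝ)..1, Real.log (1 + u) ^ m / u) -
      ∫ u in (0 : ℝ)..1, Real.log (1 - u) ^ m / u : ℝ) : ℂ) := by
  have hA := intervalIntegrable_log_one_add_pow_div hm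
  have hB := intervalIntegrable_log_one_sub_pow_div hm
  have hK : IntervalIntegrable (fun u => (Real.log (1 + u) ^ m - Real.log (1 - u) ^ m) / u) volume 0 1 := by
    simpa only [sub_div] using hA.sub hB
  rw [← intervalIntegral.integral_sub hA hB]
  simp only [← sub_div]
  have hJ := continuousOn_integral_log_one_add 0 m
  simp only [pow_zero, one_mul] at hJ
  have hP := intervalIntegral.continuousOn_primitive_interval' hK Set.left_mem_uIcc
  rw [Set.uIcc_of_le zero_le_one] at hP
  have ht : Tendsto (fun n : ℕ => 1 / ((n : ℝ) + 1) / 2) atTop (𝓝 0) := by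
    simpa using (tendsto_one_div_add_atTop_nhds_zero_nat (𝕜 := ℝ)).div_const 2
  have hε : ∀ n : ℕ, 0 < 1 / ((n : ℝ) + 1) / 2 ∧ 1 / ((n : ℝ) + 1) / 2 ≤ 1 / 2 := by
    intro n
    have := natInv_le_one n
    unfold natInv at this
    exact ⟨by positivity, by linarith⟩
  have ht0 : Tendsto (fun n : ℕ => 1 / ((n : ℝ) + 1) / 2) atTop (𝓝[Set.Icc 0 1] 0) :=
    tendsto_nhdsWithin_iff.2 ⟨ht, Eventually.of_forall fun n => ⟨(hε n).1.le, by linarith [(hε n).2]⟩⟩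
  have ht1 : Tendsto (fun n : ℕ => 1 - 1 / ((n : ℝ) + 1) / 2) atTop (𝓝[Set.Icc 0 1] 1) :=
    tendsto_nhdsWithin_iff.2 ⟨by simpa using ht.const_sub 1,
      Eventually.of_forall fun n => ⟨by linarith [(hε n).2], by linarith [(hε n).1]⟩⟩
  have l0 := (hJ 0 (by simp)).tendsto.comp ht0
  have l1 := (hJ 1 (by simp)).tendsto.comp ht1
  have p0 := (hP 0 (by simp)).tendsto.comp ht0
  have p1 := (hP 1 (by simp)).tendsto.comp ht1
  have hlim := tendsto_nhds_unique (l1.sub l0) (((Complex.continuous_ofReal.tendsto _).comp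
    (p1.sub p0) |>.const_mul Complex.I).congr fun n => ?_)
  -- The inner arc shrinks to a point and contributes log(1)^m, which vanishes because m ≥ 1.
  · simp only [Complex.ofReal_one, one_mul, Complex.ofReal_zero, zero_mul, add_zero, Complex.log_one,
      zero_pow (show m ≠ 0 by omega), intervalIntegral.integral_zero, sub_zero,
      intervalIntegral.integral_same] at hlim
    exact hlim
  · simp only [Function.comp]
    rw [integral_log_one_add_half_annulus m (hε n).1 (by linarith [(hε n).2]) (by linarith [(hε n).1])]
    rw [intervalIntegral.integral_interval_sub_left]
    · refine hK.mono_set ?_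
      rw [Set.uIcc_of_le zero_le_one, Set.uIcc_of_le (by linarith [(hε n).2])]
      exact Set.Icc_subset_Icc_right (by linarith [(hε n).1])
    · refine hK.mono_set ?_
      rw [Set.uIcc_of_le zero_le_one, Set.uIcc_of_le (hε n).1.le]
      exact Set.Icc_subset_Icc_right (by linarith [(hε n).2])

/-! ### Termwise integration -/

/-- Nonnegativity bounds the partial sums of the integrated norms by the integral of F, which
supplies the summability needed for termwise integration. -/
theorem hasSum_intervalIntegral_of_nonneg {f : ℕ → ℝ → ℝ} {F : ℝ → ℝ} {a b : ℝ} (hab : a ≤ b)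
    (hf : ∀ n, IntervalIntegrable (f n) volume a b) (hF : IntervalIntegrable F volume a b)
    (hpos : ∀ n, ∀ x ∈ Set.Ioo a b, 0 ≤ f n x) (hsum : ∀ x ∈ Set.Ioo a b, HasSum (fun n => f n x) (F x)) :
    HasSum (fun n => ∫ x in a..b, f n x) (∫ x in a..b, F x) := by
  simp only [intervalIntegral.integral_of_le hab]
  have hf' : ∀ n, IntegrableOn (f n) (Set.Ioo a b) := fun n =>
    ((intervalIntegrable_iff_integrableOn_Ioc_of_le hab).1 (hf n)).mono_set Set.Ioo_subset_Ioc_self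
  have hF' : IntegrableOn F (Set.Ioo a b) :=
    ((intervalIntegrable_iff_integrableOn_Ioc_of_le hab).1 hF).mono_set Set.Ioo_subset_Ioc_self
  simp only [integral_Ioc_eq_integral_Ioo]
  have hnorm : ∀ n, ∫ x in Set.Ioo a b, ‖f n x‖ = ∫ x in Set.Ioo a b, f n x := fun n =>
    setIntegral_congr_fun measurableSet_Ioo fun x hx => Real.norm_of_nonneg (hpos n x hx)
  have hs : Summable fun n => ∫ x in Set.Ioo a b, ‖f n x‖ := by
    simp only [hnorm]
    refine summable_of_sum_range_le (c := ∫ x in Set.Ioo a b, F x)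
      (fun n => setIntegral_nonneg measurableSet_Ioo (hpos n)) fun n => ?_
    rw [← integral_finsetSum _ fun i _ => hf' i]
    refine setIntegral_mono_on (integrable_finsetSum _ fun i _ => hf' i) hF' measurableSet_Ioo
      fun x hx => ?_
    exact sum_le_hasSum _ (fun i _ => hpos i x hx) (hsum x hx)
  have h := hasSum_integral_of_summable_integral_norm hf' hs
  rwa [setIntegral_congr_fun measurableSet_Ioo fun x hx => (hsum x hx).tsum_eq] at h

/-! ### Logarithmic integrals on the unit interval -/

theorem tendsto_pow_mul_neg_log_pow {n : ℕ} (hn : 1 ≤ n) (m : ℕ) :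
    Tendsto (fun x : ℝ => x ^ n * (-Real.log x) ^ m) (𝓝[>] 0) (𝓝 0) := by
  have h : Tendsto (fun x : ℝ => (2 * m + 1 : ℝ) ^ m * x ^ (1 / 2 : ℝ)) (𝓝[>] 0) (𝓝 0) := by
    have := ((Real.continuous_rpow_const (q := 1 / 2) (by norm_num)).tendsto 0).const_mul ((2 * m + 1 : ℝ) ^ m)
    rw [Real.zero_rpow (by norm_num), mul_zero] at this
    exact this.mono_left nhdsWithin_le_nhds
  refine squeeze_zero_norm' ?_ h
  filter_upwards [Ioo_mem_nhdsGT (zero_lt_one' ℝ)] with x hx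
  rw [norm_mul, norm_pow, norm_pow, norm_neg, Real.norm_eq_abs, Real.norm_eq_abs, abs_of_pos hx.1]
  calc x ^ n * |Real.log x| ^ m ≤ x ^ 1 * ((2 * m + 1 : ℝ) ^ m * x ^ (-(1 / 2) : ℝ)) := by
        have := hx.1
        gcongr ?_ * ?_
        · exact pow_le_pow_of_le_one hx.1.le hx.2.le hn
        · exact abs_log_pow_le hx.1 hx.2.le m
    _ = _ := by
        rw [mul_left_comm, pow_one]
        nth_rewrite 1 [← Real.rpow_one x]
        rw [← Real.rpow_add hx.1]
        norm_num

theorem intervalIntegrable_mul_neg_log_pow {g : ℝ → ℝ} (hg : ContinuousOn g (Set.Icc 0 1)) (m : ℕ) :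
    IntervalIntegrable (fun x => g x * (-Real.log x) ^ m) volume 0 1 := by
  have h : IntervalIntegrable (fun x => (-Real.log x) ^ m) volume 0 1 := by
    refine (intervalIntegrable_abs_log_pow m).mono_fun
      (Real.measurable_log.neg.pow_const m).aestronglyMeasurable (ae_of_all _ fun x => ?_)
    simp
  exact h.continuousOn_mul (by rwa [Set.uIcc_of_le zero_le_one])

theorem integral_pow_mul_neg_log_pow (n m : ℕ) :
    ∫ x in (0 : ℝ)..1, x ^ n * (-Real.log x) ^ m = m.factorial / ((n : ℝ) + 1) ^ (m + 1) := by
  have hn : (n : ℝ) + 1 ≠ 0 := by positivity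
  induction m with
  | zero => simp [integral_pow]
  | succ m ih =>
    have hi : ∀ m, IntervalIntegrable (fun x : ℝ => x ^ n * (-Real.log x) ^ m) volume 0 1 := fun m =>
      intervalIntegrable_mul_neg_log_pow (by fun_prop) m
    have h := intervalIntegral.integral_eq_sub_of_hasDerivAt_of_tendsto (zero_lt_one' ℝ)
      (f := fun x => x ^ (n + 1) * (-Real.log x) ^ (m + 1))
      (f' := fun x => ((n : ℝ) + 1) * (x ^ n * (-Real.log x) ^ (m + 1)) -
        ((m : ℝ) + 1) * (x ^ n * (-Real.log x) ^ m)) (fa := 0) (fb := 0) ?_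
      (((hi (m + 1)).const_mul _).sub ((hi m).const_mul _))
      (tendsto_pow_mul_neg_log_pow (by omega) _) ?_
    · rw [intervalIntegral.integral_sub ((hi (m + 1)).const_mul _) ((hi m).const_mul _),
        intervalIntegral.integral_const_mul, intervalIntegral.integral_const_mul, ih] at h
      rw [Nat.factorial_succ, eq_div_iff (by positivity)]
      push_cast
      have h' := congrArg (· * ((n : ℝ) + 1) ^ (m + 1)) h
      simp only [sub_mul, sub_zero, zero_mul] at h'
      rw [mul_assoc ((m : ℝ) + 1), div_mul_cancel₀ _ (by positivity)] at h'
      linear_combination h'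
    · intro x hx
      have hx0 : x ≠ 0 := hx.1.ne'
      have h1 := (hasDerivAt_pow (n + 1) x).fun_mul (((Real.hasDerivAt_log hx0).fun_neg).fun_pow (m + 1))
      refine h1.congr_deriv ?_
      simp only [Nat.add_sub_cancel]
      push_cast
      field_simp
      ring
    · have hc : ContinuousAt (fun x : ℝ => x ^ (n + 1) * (-Real.log x) ^ (m + 1)) 1 :=
        (continuousAt_id.pow _).mul ((Real.continuousAt_log one_ne_zero).neg.pow _)
      have := hc.tendsto
      simp only [Real.log_one, neg_zero, zero_pow (Nat.succ_ne_zero m), mul_zero] at this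
      exact this.mono_left nhdsWithin_le_nhds

/-- Reflect u to 1 - x and expand 1/(1 - x) as a geometric series; the terms are the integrals of
x^n (-log x)^m. -/
theorem integral_neg_log_one_sub_pow_div {m : ℕ} (hm : 1 ≤ m) :
    ∫ u in (0 : ℝ)..1, Real.log (1 - u) ^ m / u = (-1) ^ m * (m.factorial * realZeta (m + 1)) := by
  have hB := intervalIntegrable_log_one_sub_pow_div hm
  have hB' : IntervalIntegrable (fun x => (-Real.log x) ^ m / (1 - x)) volume 0 1 := by
    have := ((hB.const_mul ((-1) ^ m)).comp_sub_left 1).symm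
    simp only [sub_zero, sub_self, sub_sub_cancel] at this
    refine this.congr fun x _ => ?_
    rw [neg_pow (Real.log x)]
    ring
  have h := hasSum_intervalIntegral_of_nonneg (f := fun n x => x ^ n * (-Real.log x) ^ m)
    zero_le_one (fun n => intervalIntegrable_mul_neg_log_pow (by fun_prop) m) hB' ?_ ?_
  · simp only [integral_pow_mul_neg_log_pow] at h
    have h2 := (hasSum_natInv_pow (s := m + 1) (by omega)).mul_left (m.factorial : ℝ)
    have h3 := h.unique (h2.congr_fun fun n => by rw [natInv, div_pow, one_pow, mul_one_div])
    have h4 := intervalIntegral.integral_comp_sub_left (a := 0) (b := 1)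
      (fun x => (-1) ^ m * ((-Real.log x) ^ m / (1 - x))) (1 : ℝ)
    rw [sub_zero, sub_self, intervalIntegral.integral_const_mul ((-1) ^ m) fun x => (-Real.log x) ^ m / (1 - x), h3] at h4
    rw [← h4]
    refine intervalIntegral.integral_congr fun x _ => ?_
    rw [sub_sub_cancel, neg_pow (Real.log _), mul_div_assoc, ← mul_assoc, ← mul_pow]
    norm_num
  · intro n x hx
    exact mul_nonneg (pow_nonneg hx.1.le n) (pow_nonneg (neg_nonneg.2 (Real.log_nonpos hx.1.le hx.2.le)) m)
  · intro x hx
    have := (hasSum_geometric_of_lt_one hx.1.le hx.2).mul_right ((-Real.log x) ^ m)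
    rwa [inv_mul_eq_div] at this

/-- `∫ log (1 + u) ^ m / (1 + u) ^ n` over the unit interval. -/
noncomputable def logQuot (m n : ℕ) : ℝ := ∫ u in (0 : ℝ)..1, Real.log (1 + u) ^ m / (1 + u) ^ n

theorem continuousOn_logQuot (m n : ℕ) :
    ContinuousOn (fun u : ℝ => Real.log (1 + u) ^ m / (1 + u) ^ n) (Set.uIcc 0 1) := by
  rw [Set.uIcc_of_le zero_le_one]
  intro u hu
  have h : 1 + u ≠ 0 := by linarith [hu.1]
  refine ContinuousAt.continuousWithinAt (ContinuousAt.div ?_ (by fun_prop) (pow_ne_zero _ h))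
  exact (ContinuousAt.log (by fun_prop) h).pow m

theorem hasDerivAt_log_one_add {u : ℝ} (hu : u ∈ Set.uIcc (0 : ℝ) 1) :
    HasDerivAt (fun u => Real.log (1 + u)) (1 / (1 + u)) u := by
  rw [Set.uIcc_of_le zero_le_one] at hu
  exact ((hasDerivAt_id u).const_add 1).log (by simp only [id]; linarith [hu.1])

theorem logQuot_one (m : ℕ) : logQuot m 1 = Real.log 2 ^ (m + 1) / (m + 1) := by
  have h := intervalIntegral.integral_eq_sub_of_hasDerivAt (a := 0) (b := 1)
    (f := fun u => Real.log (1 + u) ^ (m + 1) / (m + 1))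
    (f' := fun u => Real.log (1 + u) ^ m / (1 + u) ^ 1) (fun u hu => ?_)
    (continuousOn_logQuot m 1).intervalIntegrable
  · rw [logQuot, h]
    norm_num
  · have h1 := ((hasDerivAt_log_one_add hu).pow (m + 1)).div_const ((m : ℝ) + 1)
    refine h1.congr_deriv ?_
    have : (m : ℝ) + 1 ≠ 0 := by positivity
    simp only [Nat.add_sub_cancel]
    push_cast
    rw [pow_one]
    field_simp

theorem logQuot_zero_add_two (n : ℕ) :
    logQuot 0 (n + 2) = (1 - (1 / 2) ^ (n + 1)) * natInv n := by
  have h := intervalIntegral.integral_eq_sub_of_hasDerivAt (a := 0) (b := 1)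
    (f := fun u => ((1 + u) ^ (n + 1))⁻¹)
    (f' := fun u => -((n + 1) * (Real.log (1 + u) ^ 0 / (1 + u) ^ (n + 2)))) (fun u hu => ?_)
    ((continuousOn_logQuot 0 (n + 2)).intervalIntegrable.const_mul _).neg
  · rw [intervalIntegral.integral_neg, intervalIntegral.integral_const_mul] at h
    change -(_ * logQuot 0 (n + 2)) = _ at h
    norm_num at h
    have hn : (n : ℝ) + 1 ≠ 0 := by positivity
    rw [natInv, mul_one_div, eq_div_iff hn, div_pow, one_pow]
    linear_combination -h
  · have hu' : 1 + u ≠ 0 := by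
      rw [Set.uIcc_of_le zero_le_one] at hu
      linarith [hu.1]
    have h1 := (((hasDerivAt_id u).const_add 1).fun_pow (n + 1)).fun_inv (pow_ne_zero _ hu')
    refine h1.congr_deriv ?_
    simp only [Nat.add_sub_cancel, id]
    push_cast
    field_simp
    ring

theorem logQuot_succ_add_two (m n : ℕ) :
    logQuot (m + 1) (n + 2) =
      ((m + 1) * logQuot m (n + 2) - Real.log 2 ^ (m + 1) * (1 / 2) ^ (n + 1)) * natInv n := by
  have hc := fun m => (continuousOn_logQuot m (n + 2)).intervalIntegrable (μ := volume)
  have h := intervalIntegral.integral_eq_sub_of_hasDerivAt (a := 0) (b := 1)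
    (f := fun u => Real.log (1 + u) ^ (m + 1) * ((1 + u) ^ (n + 1))⁻¹)
    (f' := fun u => (m + 1) * (Real.log (1 + u) ^ m / (1 + u) ^ (n + 2)) -
      (n + 1) * (Real.log (1 + u) ^ (m + 1) / (1 + u) ^ (n + 2))) (fun u hu => ?_)
    (((hc m).const_mul _).sub ((hc (m + 1)).const_mul _))
  · rw [intervalIntegral.integral_sub ((hc m).const_mul _) ((hc (m + 1)).const_mul _),
      intervalIntegral.integral_const_mul, intervalIntegral.integral_const_mul] at h
    change _ * logQuot m (n + 2) - _ * logQuot (m + 1) (n + 2) = _ at h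
    norm_num at h
    have hn : (n : ℝ) + 1 ≠ 0 := by positivity
    rw [natInv, mul_one_div, eq_div_iff hn, div_pow, one_pow]
    linear_combination -h
  · have hu' : 1 + u ≠ 0 := by
      rw [Set.uIcc_of_le zero_le_one] at hu
      linarith [hu.1]
    have h1 := ((hasDerivAt_log_one_add hu).fun_pow (m + 1)).fun_mul
      ((((hasDerivAt_id u).const_add 1).fun_pow (n + 1)).fun_inv (pow_ne_zero _ hu'))
    refine h1.congr_deriv ?_
    simp only [Nat.add_sub_cancel, id]
    push_cast
    field_simp
    ring

/-- For u > 0, 1/u is the geometric sum of (1+u)^(-n) over n ≥ 1. The term n = 1 integrates to a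
pure power of log 2 and is split off, since the integration by parts recursion starts at exponent 2.
-/
theorem hasSum_logQuot {m : ℕ} (hm : 1 ≤ m) :
    HasSum (fun n => logQuot m (n + 2))
      ((∫ u in (0 : ℝ)..1, Real.log (1 + u) ^ m / u) - Real.log 2 ^ (m + 1) / (m + 1)) := by
  have h := hasSum_intervalIntegral_of_nonneg (f := fun n u => Real.log (1 + u) ^ m / (1 + u) ^ (n + 1))
    zero_le_one (fun n => (continuousOn_logQuot m (n + 1)).intervalIntegrable)
    (intervalIntegrable_log_one_add_pow_div hm) ?_ ?_
  · have h1 := (hasSum_nat_add_iff' 1).2 h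
    rw [sum_range_one] at h1
    change HasSum _ (_ - logQuot m 1) at h1
    rwa [logQuot_one] at h1
  · intro n u hu
    exact div_nonneg (pow_nonneg (Real.log_nonneg (by linarith [hu.1])) m) (pow_nonneg (by linarith [hu.1]) _)
  · intro u hu
    have hu' : 0 < 1 + u := by linarith [hu.1]
    have h1 := (hasSum_geometric_of_lt_one (r := (1 + u)⁻¹) (by positivity)
      (inv_lt_one_of_one_lt₀ (by linarith [hu.1]))).mul_left (Real.log (1 + u) ^ m / (1 + u))
    have hu0 := hu.1.ne'
    rw [show Real.log (1 + u) ^ m / (1 + u) * (1 - (1 + u)⁻¹)⁻¹ = Real.log (1 + u) ^ m / u by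
      rw [show 1 - (1 + u)⁻¹ = u / (1 + u) by field_simp; ring]
      field_simp] at h1
    refine h1.congr_fun fun n => ?_
    rw [inv_pow, pow_succ]
    field_simp

theorem hasSum_polylog_half (s : ℕ) :
    HasSum (fun n => (1 / 2 : ℝ) ^ (n + 1) * natInv n ^ s) (realPolylog s (1 / 2)) :=
  (hasSum_realPolylog s (x := 1 / 2) (by rw [abs_of_pos] <;> norm_num)).congr_fun fun n => by
    rw [natInv, div_pow 1 ((n : ℝ) + 1), one_pow, mul_one_div]

theorem realPolylog_one_half : realPolylog 1 (1 / 2) = Real.log 2 := by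
  have h := Real.hasSum_pow_div_log_of_abs_lt_one (x := 1 / 2) (by rw [abs_of_pos] <;> norm_num)
  have h2 := hasSum_realPolylog 1 (x := 1 / 2) (by rw [abs_of_pos] <;> norm_num)
  simp only [pow_one] at h2
  rw [h2.unique h, show (1 : ℝ) - 1 / 2 = 2⁻¹ by norm_num, Real.log_inv, neg_neg]

theorem hasSum_logQuot_zero {s : ℕ} (hs : 1 ≤ s) :
    HasSum (fun n => logQuot 0 (n + 2) * natInv n ^ s)
      (realZeta (s + 1) - realPolylog (s + 1) (1 / 2)) :=
  ((hasSum_natInv_pow (by omega)).sub (hasSum_polylog_half (s + 1))).congr_fun fun n => by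
    rw [logQuot_zero_add_two]
    ring

/-- Each integration by parts gains one logarithm at the price of one power of `natInv n`, its
boundary term at u = 1 being a polylogarithm at 1/2. Iteration from m = 0 down to s = 0 yields the
integrals below. -/
theorem hasSum_logQuot_succ {m s : ℕ} {S : ℝ}
    (h : HasSum (fun n => logQuot m (n + 2) * natInv n ^ (s + 1)) S) :
    HasSum (fun n => logQuot (m + 1) (n + 2) * natInv n ^ s)
      ((m + 1) * S - Real.log 2 ^ (m + 1) * realPolylog (s + 1) (1 / 2)) :=
  ((h.mul_left _).sub ((hasSum_polylog_half (s + 1)).mul_left _)).congr_fun fun n => by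
    rw [logQuot_succ_add_two]
    ring

theorem integral_log_one_add_div :
    ∫ u in (0 : ℝ)..1, Real.log (1 + u) ^ 1 / u =
      realZeta 2 - realPolylog 2 (1 / 2) - Real.log 2 ^ 2 / 2 := by
  have h := hasSum_logQuot_succ (s := 0) (hasSum_logQuot_zero le_rfl)
  simp only [pow_zero, mul_one] at h
  have := (hasSum_logQuot (m := 1) le_rfl).unique h
  norm_num [realPolylog_one_half] at this ⊢
  linear_combination this

theorem integral_log_one_add_sq_div :
    ∫ u in (0 : ℝ)..1, Real.log (1 + u) ^ 2 / u =
      2 * realZeta 3 - 2 * realPolylog 3 (1 / 2) - 2 * Real.log 2 * realPolylog 2 (1 / 2)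
        - 2 / 3 * Real.log 2 ^ 3 := by
  have h := hasSum_logQuot_succ (s := 0) (hasSum_logQuot_succ (hasSum_logQuot_zero one_le_two))
  simp only [pow_zero, mul_one] at h
  have := (hasSum_logQuot (m := 2) (by norm_num)).unique h
  norm_num [realPolylog_one_half] at this ⊢
  linear_combination this

theorem integral_log_one_add_cube_div :
    ∫ u in (0 : ℝ)..1, Real.log (1 + u) ^ 3 / u =
      6 * realZeta 4 - 6 * realPolylog 4 (1 / 2) - 6 * Real.log 2 * realPolylog 3 (1 / 2)
        - 3 * Real.log 2 ^ 2 * realPolylog 2 (1 / 2) - 3 / 4 * Real.log 2 ^ 4 := by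
  have h := hasSum_logQuot_succ (s := 0) (hasSum_logQuot_succ (hasSum_logQuot_succ
    (hasSum_logQuot_zero (s := 3) (by norm_num))))
  simp only [pow_zero, mul_one] at h
  have := (hasSum_logQuot (m := 3) (by norm_num)).unique h
  norm_num [realPolylog_one_half] at this ⊢
  linear_combination this

theorem integral_log_one_add_pow_four_div :
    ∫ u in (0 : ℝ)..1, Real.log (1 + u) ^ 4 / u =
      24 * realZeta 5 - 24 * realPolylog 5 (1 / 2) - 24 * Real.log 2 * realPolylog 4 (1 / 2)
        - 12 * Real.log 2 ^ 2 * realPolylog 3 (1 / 2) - 4 * Real.log 2 ^ 3 * realPolylog 2 (1 / 2)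
        - 4 / 5 * Real.log 2 ^ 5 := by
  have h := hasSum_logQuot_succ (s := 0) (hasSum_logQuot_succ (hasSum_logQuot_succ
    (hasSum_logQuot_succ (hasSum_logQuot_zero (s := 4) (by norm_num)))))
  simp only [pow_zero, mul_one] at h
  have := (hasSum_logQuot (m := 4) (by norm_num)).unique h
  norm_num [realPolylog_one_half] at this ⊢
  linear_combination this

/-! ### Integrals of powers of `log (2 cos (φ / 2))` -/

noncomputable def logCos (φ : ℝ) : ℝ := Real.log (2 * Real.cos (φ / 2))

theorem measurable_logCos : Measurable logCos :=
  Real.measurable_log.comp ((Real.measurable_cos.comp (measurable_id.div_const 2)).const_mul 2)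

/-- The polar form is 1 + e^{iφ} = 2 cos(φ/2) e^{iφ/2}; for 0 < φ < π the modulus is positive and
φ/2 is the principal argument. -/
theorem log_one_add_exp {φ : ℝ} (hφ : φ ∈ Set.Ioo 0 Real.pi) :
    Complex.log (1 + Complex.exp (φ * Complex.I)) = (logCos φ : ℂ) + ((φ / 2 : ℝ) : ℂ) * Complex.I := by
  have hpi := Real.pi_pos
  have hc : 0 < Real.cos (φ / 2) :=
    Real.cos_pos_of_mem_Ioo ⟨by linarith [hφ.1], by linarith [hφ.2]⟩
  have h : 1 + Complex.exp (φ * Complex.I) =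
      ((2 * Real.cos (φ / 2) : ℝ) : ℂ) * Complex.exp (((φ / 2 : ℝ) : ℂ) * Complex.I) := by
    push_cast
    rw [Complex.cos, mul_div_cancel₀ _ two_ne_zero, add_mul, ← Complex.exp_add, ← Complex.exp_add, add_comm]
    congr 2
    · ring
    · rw [show (φ : ℂ) / 2 * Complex.I = -(-(φ / 2) * Complex.I) by ring, add_neg_cancel, Complex.exp_zero]
  rw [h, Complex.log_ofReal_mul (by positivity) (Complex.exp_ne_zero _), Complex.log_exp, logCos]
  · simp only [Complex.mul_I_im, Complex.ofReal_re]
    linarith [hφ.1]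
  · simp only [Complex.mul_I_im, Complex.ofReal_re]
    linarith [hφ.2]

theorem intervalIntegrable_pow_mul_logCos_pow (j k : ℕ) :
    IntervalIntegrable (fun φ => φ ^ j * logCos φ ^ k) volume 0 Real.pi := by
  have h : IntervalIntegrable (fun φ => logCos φ ^ k) volume 0 Real.pi := by
    refine (intervalIntegrable_const_add_abs_log_sin_pow (c := Real.pi + Real.log 2)
      (add_nonneg Real.pi_pos.le (Real.log_nonneg one_le_two)) k).mono_fun'
      (measurable_logCos.pow_const k).aestronglyMeasurable ?_
    rw [EventuallyLE, ae_restrict_iff' measurableSet_uIoc]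
    filter_upwards [ae_mem_Ioo_of_uIoc] with φ hφ h
    have h1 := norm_log_one_add_le zero_le_one le_rfl (hφ h)
    rw [Complex.ofReal_one, one_mul, log_one_add_exp (hφ h)] at h1
    have h2 := (Complex.abs_re_le_norm _).trans h1
    rw [Complex.add_re, Complex.ofReal_re, Complex.re_ofReal_mul, Complex.I_re, mul_zero, add_zero] at h2
    rw [norm_pow, Real.norm_eq_abs]
    exact pow_le_pow_left₀ (abs_nonneg _) h2 k
  exact h.continuousOn_mul (by fun_prop)

theorem intervalIntegrable_ofReal {f : ℝ → ℝ} {a b : ℝ} (h : IntervalIntegrable f volume a b) :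
    IntervalIntegrable (fun x => (f x : ℂ)) volume a b :=
  ⟨h.1.ofReal, h.2.ofReal⟩

/-- The contour integral is purely imaginary, so the real part of the m-th power integrates to zero
and the imaginary part to the boundary integrals. -/
theorem integral_logCos_of_re_im {m : ℕ} (hm : 1 ≤ m) {P Q : ℝ → ℝ}
    (hP : IntervalIntegrable P volume 0 Real.pi) (hQ : IntervalIntegrable Q volume 0 Real.pi)
    (h : ∀ φ : ℝ, ((logCos φ : ℂ) + ((φ / 2 : ℝ) : ℂ) * Complex.I) ^ m = P φ + Q φ * Complex.I) :
    ∫ φ in 0..Real.pi, P φ = 0 ∧ ∫ φ in 0..Real.pi, Q φ =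
      (∫ u in (0 : ℝ)..1, Real.log (1 + u) ^ m / u) - (-1) ^ m * (m.factorial * realZeta (m + 1)) := by
  have H := integral_log_one_add_half_circle hm
  rw [integral_neg_log_one_sub_pow_div hm] at H
  have e : ∫ φ in 0..Real.pi, Complex.log (1 + Complex.exp (φ * Complex.I)) ^ m =
      ∫ φ in 0..Real.pi, ((P φ : ℂ) + Q φ * Complex.I) := by
    refine intervalIntegral.integral_congr_ae ?_
    filter_upwards [ae_mem_Ioo_of_uIoc] with φ hφ hφ'
    rw [log_one_add_exp (hφ hφ'), h]
  rw [e, intervalIntegral.integral_add (intervalIntegrable_ofReal hP)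
    ((intervalIntegrable_ofReal hQ).mul_const _),
    intervalIntegral.integral_mul_const, intervalIntegral.integral_ofReal,
    intervalIntegral.integral_ofReal] at H
  generalize (∫ u in (0 : ℝ)..1, Real.log (1 + u) ^ m / u) - (-1) ^ m * (m.factorial * realZeta (m + 1)) = X
    at H ⊢
  constructor
  · simpa using congrArg Complex.re H
  · simpa using congrArg Complex.im H

theorem hasSum_log_norm_one_add {r φ : ℝ} (h0 : 0 ≤ r) (h1 : r < 1) :
    HasSum (fun n : ℕ => (-1) ^ n * r ^ (n + 1) * natInv n * Real.cos ((n + 1) * φ))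
      (Complex.log (1 + (r : ℂ) * Complex.exp (φ * Complex.I))).re := by
  have hz : ‖(r : ℂ) * Complex.exp (φ * Complex.I)‖ < 1 := by
    rwa [norm_mul, Complex.norm_exp_ofReal_mul_I, mul_one, Complex.norm_real, Real.norm_of_nonneg h0]
  have h := Complex.hasSum_re (Complex.hasSum_taylorSeries_log hz)
  have h2 := (hasSum_nat_add_iff' 1).2 h
  simp only [sum_range_one, pow_zero, Nat.cast_zero, div_zero, Complex.zero_re, sub_zero] at h2
  refine h2.congr_fun fun n => ?_
  rw [mul_pow, ← Complex.exp_nat_mul, natInv]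
  rw [show (-1 : ℂ) ^ (n + 1 + 1) * ((r : ℂ) ^ (n + 1) * Complex.exp (((n + 1 : ℕ) : ℂ) * (φ * Complex.I))) /
      ((n + 1 : ℕ) : ℂ) = (((-1) ^ n * r ^ (n + 1) * (1 / ((n : ℝ) + 1)) : ℝ) : ℂ) *
        Complex.exp ((((n + 1) * φ : ℝ) : ℂ) * Complex.I) by
    push_cast
    rw [mul_assoc ((n : ℂ) + 1)]
    ring, Complex.re_ofReal_mul, Complex.exp_ofReal_mul_I_re]

/-- Abel summation: for r < 1 the series of log |1 + r e^{iφ}| is integrated term by term, then r →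
1. The left side converges by domination, the right side because the coefficients are absolutely
summable. -/
theorem hasSum_integral_logCos {j : ℕ} {C : ℕ → ℝ}
    (hC : ∀ n : ℕ, ∫ φ in 0..Real.pi, φ ^ j * Real.cos (((n : ℝ) + 1) * φ) = C n)
    (hs : Summable fun n => |natInv n * C n|) :
    HasSum (fun n : ℕ => (-1) ^ n * (natInv n * C n)) (∫ φ in 0..Real.pi, φ ^ j * logCos φ) := by
  have hr : ∀ r ∈ Set.Ico (0 : ℝ) 1,
      (∫ φ in 0..Real.pi, (φ : ℂ) ^ j * Complex.log (1 + (r : ℂ) * Complex.exp (φ * Complex.I)) ^ 1).re =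
      ∑' n : ℕ, r ^ (n + 1) * ((-1) ^ n * (natInv n * C n)) := by
    intro r hr
    have hint : IntervalIntegrable (fun φ : ℝ => (φ : ℂ) ^ j *
        Complex.log (1 + (r : ℂ) * Complex.exp (φ * Complex.I)) ^ 1) volume 0 Real.pi := by
      refine Continuous.intervalIntegrable ?_ _ _
      refine Continuous.mul (by fun_prop) (Continuous.pow (Continuous.clog (by fun_prop) fun φ => ?_) 1)
      refine Complex.mem_slitPlane_of_norm_lt_one ?_
      rw [norm_mul, Complex.norm_exp_ofReal_mul_I, mul_one, Complex.norm_real, Real.norm_of_nonneg hr.1]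
      exact hr.2
    have hre := (Complex.reCLM.intervalIntegral_comp_comm hint).symm
    simp only [Complex.reCLM_apply] at hre
    rw [hre]
    have h := intervalIntegral.hasSum_integral_of_dominated_convergence (μ := volume) (a := 0) (b := Real.pi)
      (F := fun (n : ℕ) (φ : ℝ) => φ ^ j * ((-1) ^ n * r ^ (n + 1) * natInv n * Real.cos ((n + 1) * φ)))
      (f := fun φ => ((φ : ℂ) ^ j * Complex.log (1 + (r : ℂ) * Complex.exp (φ * Complex.I)) ^ 1).re)
      (fun n _ => Real.pi ^ j * r ^ (n + 1)) (fun n => (by fun_prop : Continuous _).aestronglyMeasurable)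
      (fun n => ?_) ?_ ?_ ?_
    · refine h.tsum_eq.symm.trans (tsum_congr fun n => ?_)
      rw [← hC n, ← intervalIntegral.integral_const_mul, ← intervalIntegral.integral_const_mul,
        ← intervalIntegral.integral_const_mul]
      exact intervalIntegral.integral_congr fun φ _ => by ring
    · filter_upwards [ae_mem_Ioo_of_uIoc] with φ hφ hφ'
      have hφ'' := hφ hφ'
      rw [norm_mul, norm_pow, Real.norm_of_nonneg hφ''.1.le]
      have h1 : ‖(-1) ^ n * r ^ (n + 1) * natInv n * Real.cos ((n + 1) * φ)‖ ≤ r ^ (n + 1) := by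
        rw [norm_mul, norm_mul, norm_mul, norm_pow, norm_neg, norm_one, one_pow, one_mul, norm_pow,
          Real.norm_of_nonneg hr.1, Real.norm_of_nonneg (natInv_pos n).le, mul_assoc]
        refine mul_le_of_le_one_right (pow_nonneg hr.1 _) ?_
        exact mul_le_one₀ (natInv_le_one n) (norm_nonneg _) (Real.abs_cos_le_one _)
      have := hφ''.1.le
      have := hφ''.2.le
      gcongr
    · refine ae_of_all _ fun φ _ => ?_
      exact ((summable_nat_add_iff 1).2 (summable_geometric_of_lt_one hr.1 hr.2)).mul_left _
    · exact intervalIntegrable_const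
    · refine ae_of_all _ fun φ _ => ?_
      rw [← Complex.ofReal_pow, Complex.re_ofReal_mul, pow_one]
      exact (hasSum_log_norm_one_add hr.1 hr.2).mul_left _
  have hs' : Summable fun n : ℕ => (-1) ^ n * (natInv n * C n) := by
    refine Summable.of_norm ?_
    simpa using hs
  have ht : Tendsto (fun n : ℕ => 1 - 1 / ((n : ℝ) + 1)) atTop (𝓝 1) := by
    simpa using (tendsto_one_div_add_atTop_nhds_zero_nat (𝕜 := ℝ)).const_sub 1
  have hm : ∀ n : ℕ, 1 - 1 / ((n : ℝ) + 1) ∈ Set.Ico (0 : ℝ) 1 := fun n =>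
    ⟨by linarith [natInv_le_one n, show natInv n = 1 / ((n : ℝ) + 1) from rfl],
      by linarith [natInv_pos n, show natInv n = 1 / ((n : ℝ) + 1) from rfl]⟩
  have h1 := (Complex.continuous_re.tendsto _).comp
    (((continuousOn_integral_log_one_add j 1) 1 (by simp)).tendsto.comp
    (tendsto_nhdsWithin_iff.2 ⟨ht, Eventually.of_forall fun n => Set.Ico_subset_Icc_self (hm n)⟩))
  have h2 : Tendsto (fun k : ℕ => ∑' n : ℕ, (1 - 1 / ((k : ℝ) + 1)) ^ (n + 1) * ((-1) ^ n * (natInv n * C n)))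
      atTop (𝓝 (∑' n : ℕ, (-1) ^ n * (natInv n * C n))) := by
    refine tendsto_tsum_of_dominated_convergence hs (fun n => ?_) (Eventually.of_forall fun k n => ?_)
    · simpa using (ht.pow (n + 1)).mul_const ((-1) ^ n * (natInv n * C n))
    · rw [norm_mul, norm_pow, Real.norm_of_nonneg (hm k).1, norm_mul, norm_pow, norm_neg, norm_one, one_pow,
        one_mul, Real.norm_eq_abs]
      exact mul_le_of_le_one_left (abs_nonneg _) (pow_le_one₀ (hm k).1 (hm k).2.le)
  have h3 := tendsto_nhds_unique (h1.congr fun k => hr _ (hm k)) h2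
  have h4 : (∫ φ in 0..Real.pi, (φ : ℂ) ^ j * Complex.log (1 + ((1 : ℝ) : ℂ) * Complex.exp (φ * Complex.I)) ^ 1).re =
      ∫ φ in 0..Real.pi, φ ^ j * logCos φ := by
    have e : ∫ φ in 0..Real.pi, (φ : ℂ) ^ j * Complex.log (1 + ((1 : ℝ) : ℂ) * Complex.exp (φ * Complex.I)) ^ 1 =
        ∫ φ in 0..Real.pi, (((φ ^ j * logCos φ ^ 1 : ℝ) : ℂ) + ((φ ^ j * (φ / 2) : ℝ) : ℂ) * Complex.I) := by
      refine intervalIntegral.integral_congr_ae ?_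
      filter_upwards [ae_mem_Ioo_of_uIoc] with φ hφ hφ'
      rw [Complex.ofReal_one, one_mul, pow_one, log_one_add_exp (hφ hφ')]
      push_cast
      ring
    rw [e, intervalIntegral.integral_add
      (intervalIntegrable_ofReal (intervalIntegrable_pow_mul_logCos_pow j 1))
      ((intervalIntegrable_ofReal (f := fun φ => φ ^ j * (φ / 2))
        (Continuous.intervalIntegrable (by fun_prop) _ _)).mul_const _),
      intervalIntegral.integral_mul_const, intervalIntegral.integral_ofReal,
      intervalIntegral.integral_ofReal]
    simp
  rw [h4.symm.trans h3]
  exact hs'.hasSum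

/-! ### Fourier coefficients of powers -/

theorem cos_succ_mul_pi (n : ℕ) : Real.cos (((n : ℝ) + 1) * Real.pi) = (-1) ^ (n + 1) := by
  have := Real.cos_nat_mul_pi (n + 1)
  push_cast at this
  exact this

theorem sin_succ_mul_pi (n : ℕ) : Real.sin (((n : ℝ) + 1) * Real.pi) = 0 := by
  have := Real.sin_nat_mul_pi (n + 1)
  push_cast at this
  exact this

theorem hasDerivAt_sin_mul (c x : ℝ) : HasDerivAt (fun x => Real.sin (c * x)) (Real.cos (c * x) * c) x := by
  simpa using ((hasDerivAt_id x).const_mul c).sin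

theorem hasDerivAt_cos_mul (c x : ℝ) : HasDerivAt (fun x => Real.cos (c * x)) (-Real.sin (c * x) * c) x := by
  simpa using ((hasDerivAt_id x).const_mul c).cos

theorem natInv_mul_cancel (n : ℕ) : natInv n * ((n : ℝ) + 1) = 1 := by
  unfold natInv
  field_simp

theorem integral_pow_one_mul_cos (n : ℕ) :
    ∫ φ in 0..Real.pi, φ ^ 1 * Real.cos (((n : ℝ) + 1) * φ) = natInv n ^ 2 * ((-1) ^ (n + 1) - 1) := by
  have hn := natInv_mul_cancel n
  rw [intervalIntegral.integral_eq_sub_of_hasDerivAt (f := fun φ => natInv n * φ * Real.sin (((n : ℝ) + 1) * φ) +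
    natInv n ^ 2 * Real.cos (((n : ℝ) + 1) * φ)) (fun φ _ => ?_) (Continuous.intervalIntegrable (by fun_prop) _ _)]
  · rw [cos_succ_mul_pi, sin_succ_mul_pi]
    simp
    ring
  · have h1 := (((hasDerivAt_id φ).const_mul (natInv n)).fun_mul (hasDerivAt_sin_mul (n + 1) φ)).add
      ((hasDerivAt_cos_mul (n + 1) φ).const_mul (natInv n ^ 2))
    refine h1.congr_deriv ?_
    simp only [id]
    linear_combination (φ * Real.cos (((n : ℝ) + 1) * φ) - natInv n * Real.sin (((n : ℝ) + 1) * φ)) * hn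

theorem integral_pow_two_mul_cos (n : ℕ) :
    ∫ φ in 0..Real.pi, φ ^ 2 * Real.cos (((n : ℝ) + 1) * φ) = 2 * Real.pi * natInv n ^ 2 * (-1) ^ (n + 1) := by
  have hn := natInv_mul_cancel n
  rw [intervalIntegral.integral_eq_sub_of_hasDerivAt (f := fun φ =>
    natInv n * φ ^ 2 * Real.sin (((n : ℝ) + 1) * φ) + 2 * natInv n ^ 2 * φ * Real.cos (((n : ℝ) + 1) * φ) -
    2 * natInv n ^ 3 * Real.sin (((n : ℝ) + 1) * φ)) (fun φ _ => ?_)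
    (Continuous.intervalIntegrable (by fun_prop) _ _)]
  · rw [cos_succ_mul_pi, sin_succ_mul_pi]
    simp
    ring
  · have h1 := ((((hasDerivAt_pow 2 φ).const_mul (natInv n)).fun_mul (hasDerivAt_sin_mul (n + 1) φ)).add
      (((hasDerivAt_id φ).const_mul (2 * natInv n ^ 2)).fun_mul (hasDerivAt_cos_mul (n + 1) φ))).sub
      ((hasDerivAt_sin_mul (n + 1) φ).const_mul (2 * natInv n ^ 3))
    refine h1.congr_deriv ?_
    simp only [id]
    push_cast
    linear_combination (φ ^ 2 * Real.cos (((n : ℝ) + 1) * φ) - 2 * natInv n * φ * Real.sin (((n : ℝ) + 1) * φ) -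
      2 * natInv n ^ 2 * Real.cos (((n : ℝ) + 1) * φ)) * hn

theorem integral_pow_three_mul_cos (n : ℕ) :
    ∫ φ in 0..Real.pi, φ ^ 3 * Real.cos (((n : ℝ) + 1) * φ) =
      3 * Real.pi ^ 2 * natInv n ^ 2 * (-1) ^ (n + 1) - 6 * natInv n ^ 4 * ((-1) ^ (n + 1) - 1) := by
  have hn := natInv_mul_cancel n
  rw [intervalIntegral.integral_eq_sub_of_hasDerivAt (f := fun φ =>
    natInv n * φ ^ 3 * Real.sin (((n : ℝ) + 1) * φ) + 3 * natInv n ^ 2 * φ ^ 2 * Real.cos (((n : ℝ) + 1) * φ) -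
    6 * natInv n ^ 3 * φ * Real.sin (((n : ℝ) + 1) * φ) - 6 * natInv n ^ 4 * Real.cos (((n : ℝ) + 1) * φ))
    (fun φ _ => ?_) (Continuous.intervalIntegrable (by fun_prop) _ _)]
  · rw [cos_succ_mul_pi, sin_succ_mul_pi]
    simp
    ring
  · have h1 := (((((hasDerivAt_pow 3 φ).const_mul (natInv n)).fun_mul (hasDerivAt_sin_mul (n + 1) φ)).add
      (((hasDerivAt_pow 2 φ).const_mul (3 * natInv n ^ 2)).fun_mul (hasDerivAt_cos_mul (n + 1) φ))).sub
      (((hasDerivAt_id φ).const_mul (6 * natInv n ^ 3)).fun_mul (hasDerivAt_sin_mul (n + 1) φ))).sub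
      ((hasDerivAt_cos_mul (n + 1) φ).const_mul (6 * natInv n ^ 4))
    refine h1.congr_deriv ?_
    simp only [id]
    push_cast
    linear_combination (φ ^ 3 * Real.cos (((n : ℝ) + 1) * φ) - 3 * natInv n * φ ^ 2 * Real.sin (((n : ℝ) + 1) * φ) -
      6 * natInv n ^ 2 * φ * Real.cos (((n : ℝ) + 1) * φ) + 6 * natInv n ^ 3 * Real.sin (((n : ℝ) + 1) * φ)) * hn

theorem hasSum_neg_one_pow_mul_natInv_pow {s : ℕ} (hs : 1 < s) :
    HasSum (fun n => (-1) ^ n * natInv n ^ s) (realZeta s - 2 * (realZeta s / 2 ^ s)) := by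
  rw [show realZeta s - 2 * (realZeta s / 2 ^ s) = (realZeta s - realZeta s / 2 ^ s) + -(realZeta s / 2 ^ s) by ring]
  refine HasSum.even_add_odd (f := fun n => (-1) ^ n * natInv n ^ s) ?_ ?_
  · refine (hasSum_pInv_pow hs).congr_fun fun n => ?_
    simp only [pInv, natInv, pow_mul]
    push_cast
    norm_num
  · refine (hasSum_eInv_pow hs).neg.congr_fun fun n => ?_
    simp only [eInv, natInv, pow_mul, pow_succ (-1 : ℝ)]
    push_cast
    norm_num
    ring

theorem integral_logCos_eq {j : ℕ} {C : ℕ → ℝ} {S K : ℝ} {s : ℕ} (hs : 1 < s)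
    (hC : ∀ n : ℕ, ∫ φ in 0..Real.pi, φ ^ j * Real.cos (((n : ℝ) + 1) * φ) = C n)
    (hb : ∀ n, |natInv n * C n| ≤ K * natInv n ^ s)
    (hS : HasSum (fun n : ℕ => (-1) ^ n * (natInv n * C n)) S) :
    ∫ φ in 0..Real.pi, φ ^ j * logCos φ = S :=
  (hasSum_integral_logCos hC (((hasSum_natInv_pow hs).summable.mul_left K).of_nonneg_of_le
    (fun _ => abs_nonneg _) hb)).unique hS

theorem integral_mul_logCos : ∫ φ in 0..Real.pi, φ ^ 1 * logCos φ = -(7 / 4) * realZeta 3 := by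
  refine integral_logCos_eq (s := 3) (K := 2) (by norm_num) integral_pow_one_mul_cos (fun n => ?_) ?_
  · rw [← mul_assoc, ← pow_succ', abs_mul, abs_of_nonneg (pow_nonneg (natInv_pos n).le _), mul_comm]
    gcongr
    · exact pow_nonneg (natInv_pos n).le _
    · rcases neg_one_pow_eq_or ℝ (n + 1) with h | h <;> rw [h] <;> norm_num
  · have h := ((hasSum_neg_one_pow_mul_natInv_pow (s := 3) (by norm_num)).add
      (hasSum_natInv_pow (s := 3) (by norm_num))).neg
    rw [show -(7 / 4) * realZeta 3 = -(realZeta 3 - 2 * (realZeta 3 / 2 ^ 3) + realZeta 3) by ring]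
    refine h.congr_fun fun n => ?_
    have : ((-1 : ℝ) ^ n) ^ 2 = 1 := by rw [← pow_mul, mul_comm, pow_mul]; simp
    linear_combination -natInv n ^ 3 * this

theorem integral_sq_mul_logCos : ∫ φ in 0..Real.pi, φ ^ 2 * logCos φ = -2 * Real.pi * realZeta 3 := by
  have hpi := Real.pi_pos
  refine integral_logCos_eq (s := 3) (K := 2 * Real.pi) (by norm_num) integral_pow_two_mul_cos (fun n => ?_) ?_
  · rw [show natInv n * (2 * Real.pi * natInv n ^ 2 * (-1) ^ (n + 1)) =
      2 * Real.pi * natInv n ^ 3 * (-1) ^ (n + 1) by ring, abs_mul, abs_pow, abs_neg, abs_one, one_pow, mul_one]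
    rw [abs_of_nonneg (mul_nonneg (by positivity) (pow_nonneg (natInv_pos n).le _))]
  · refine ((hasSum_natInv_pow (s := 3) (by norm_num)).mul_left (-2 * Real.pi)).congr_fun fun n => ?_
    have : ((-1 : ℝ) ^ n) ^ 2 = 1 := by rw [← pow_mul, mul_comm, pow_mul]; simp
    linear_combination (-2 * Real.pi * natInv n ^ 3) * this

theorem integral_cube_mul_logCos : ∫ φ in 0..Real.pi, φ ^ 3 * logCos φ =
    -3 * Real.pi ^ 2 * realZeta 3 + 93 / 8 * realZeta 5 := by
  have hpi := Real.pi_pos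
  refine integral_logCos_eq (s := 3) (K := 3 * Real.pi ^ 2 + 12) (by norm_num) integral_pow_three_mul_cos
    (fun n => ?_) ?_
  · have h0 := (natInv_pos n).le
    have h1 : natInv n ^ 5 ≤ natInv n ^ 3 := pow_le_pow_of_le_one h0 (natInv_le_one n) (by norm_num)
    have h5 := pow_nonneg h0 5
    have h6 : 0 ≤ Real.pi ^ 2 * natInv n ^ 3 := mul_nonneg (by positivity) (pow_nonneg h0 3)
    rw [abs_le]
    rcases neg_one_pow_eq_or ℝ (n + 1) with h | h <;> rw [h] <;> constructor <;> nlinarith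
  · have h := ((hasSum_natInv_pow (s := 3) (by norm_num)).mul_left (-3 * Real.pi ^ 2)).add
      (((hasSum_neg_one_pow_mul_natInv_pow (s := 5) (by norm_num)).add
      (hasSum_natInv_pow (s := 5) (by norm_num))).mul_left 6)
    rw [show -3 * Real.pi ^ 2 * realZeta 3 + 93 / 8 * realZeta 5 = -3 * Real.pi ^ 2 * realZeta 3 +
      6 * (realZeta 5 - 2 * (realZeta 5 / 2 ^ 5) + realZeta 5) by ring]
    refine h.congr_fun fun n => ?_
    have : ((-1 : ℝ) ^ n) ^ 2 = 1 := by rw [← pow_mul, mul_comm, pow_mul]; simp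
    linear_combination (-3 * Real.pi ^ 2 * natInv n ^ 3 + 6 * natInv n ^ 5) * this

/-! ### Moments of `logCos` -/

theorem realZeta_two : realZeta 2 = Real.pi ^ 2 / 6 := by
  have h := (hasSum_nat_add_iff' 1).2 hasSum_zeta_two
  have h2 := (hasSum_natInv_pow (s := 2) (by norm_num)).unique (h.congr_fun fun n => by
    rw [natInv, div_pow, one_pow]
    push_cast
    rfl)
  simpa using h2

theorem realZeta_four : realZeta 4 = Real.pi ^ 4 / 90 := by
  have h := (hasSum_nat_add_iff' 1).2 hasSum_zeta_four
  have h2 := (hasSum_natInv_pow (s := 4) (by norm_num)).unique (h.congr_fun fun n => by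
    rw [natInv, div_pow, one_pow]
    push_cast
    rfl)
  simpa using h2

/-- `∫ φ ^ j * log (2 cos (φ / 2)) ^ k` over `[0, π]`. -/
noncomputable def logCosMoment (j k : ℕ) : ℝ := ∫ φ in 0..Real.pi, φ ^ j * logCos φ ^ k

theorem logCosMoment_pow_zero (j : ℕ) : logCosMoment j 0 = Real.pi ^ (j + 1) / (j + 1) := by
  simp [logCosMoment, integral_pow]

theorem integral_logCosMoment_add {a b : ℝ} {j k j' k' : ℕ} :
    IntervalIntegrable (fun φ => a * (φ ^ j * logCos φ ^ k) + b * (φ ^ j' * logCos φ ^ k')) volume 0 Real.pi ∧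
    ∫ φ in 0..Real.pi, (a * (φ ^ j * logCos φ ^ k) + b * (φ ^ j' * logCos φ ^ k')) =
      a * logCosMoment j k + b * logCosMoment j' k' := by
  have h1 := (intervalIntegrable_pow_mul_logCos_pow j k).const_mul a
  have h2 := (intervalIntegrable_pow_mul_logCos_pow j' k').const_mul b
  exact ⟨h1.add h2, by rw [intervalIntegral.integral_add h1 h2, intervalIntegral.integral_const_mul,
    intervalIntegral.integral_const_mul]; rfl⟩

theorem logCosMoment_one : logCosMoment 0 1 = 0 ∧ 1 / 2 * logCosMoment 1 0 =
    (∫ u in (0 : ℝ)..1, Real.log (1 + u) ^ 1 / u) + realZeta 2 := by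
  -- The zero coefficients only pad the real and imaginary parts to the two-term shape of
  -- `integral_logCosMoment_add`.
  have h := integral_logCos_of_re_im (m := 1) le_rfl
    (integral_logCosMoment_add (a := 1) (b := 0) (j := 0) (k := 1) (j' := 0) (k' := 0)).1
    (integral_logCosMoment_add (a := 1 / 2) (b := 0) (j := 1) (k := 0) (j' := 0) (k' := 0)).1
    fun φ => by push_cast; ring
  rw [integral_logCosMoment_add.2, integral_logCosMoment_add.2] at h
  norm_num at h ⊢
  exact h

theorem logCosMoment_two : logCosMoment 0 2 = 1 / 4 * logCosMoment 2 0 ∧ logCosMoment 1 1 =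
    (∫ u in (0 : ℝ)..1, Real.log (1 + u) ^ 2 / u) - 2 * realZeta 3 := by
  have h := integral_logCos_of_re_im (m := 2) (by norm_num)
    (integral_logCosMoment_add (a := 1) (b := -(1 / 4)) (j := 0) (k := 2) (j' := 2) (k' := 0)).1
    (integral_logCosMoment_add (a := 1) (b := 0) (j := 1) (k := 1) (j' := 0) (k' := 0)).1
    fun φ => by push_cast; linear_combination (φ / 2 : ℂ) ^ 2 * Complex.I_sq
  rw [integral_logCosMoment_add.2, integral_logCosMoment_add.2] at h
  norm_num at h ⊢
  exact ⟨by linarith [h.1], h.2⟩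

theorem logCosMoment_three : logCosMoment 0 3 = 3 / 4 * logCosMoment 2 1 ∧
    3 / 2 * logCosMoment 1 2 - 1 / 8 * logCosMoment 3 0 =
    (∫ u in (0 : ℝ)..1, Real.log (1 + u) ^ 3 / u) + 6 * realZeta 4 := by
  have h := integral_logCos_of_re_im (m := 3) (by norm_num)
    (integral_logCosMoment_add (a := 1) (b := -(3 / 4)) (j := 0) (k := 3) (j' := 2) (k' := 1)).1
    (integral_logCosMoment_add (a := 3 / 2) (b := -(1 / 8)) (j := 1) (k := 2) (j' := 3) (k' := 0)).1
    fun φ => by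
      push_cast
      linear_combination (3 * (logCos φ : ℂ) * (φ / 2 : ℂ) ^ 2 + (φ / 2 : ℂ) ^ 3 * Complex.I) * Complex.I_sq
  rw [integral_logCosMoment_add.2, integral_logCosMoment_add.2] at h
  norm_num [Nat.factorial] at h ⊢
  exact ⟨by linarith [h.1], by linarith [h.2]⟩

theorem logCosMoment_four : 2 * logCosMoment 1 3 - 1 / 2 * logCosMoment 3 1 =
    (∫ u in (0 : ℝ)..1, Real.log (1 + u) ^ 4 / u) - 24 * realZeta 5 := by
  -- The real part of the fourth power has three terms; only its integrability is used, since the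
  -- imaginary part alone is kept.
  have hI : IntervalIntegrable (fun φ => (1 * (φ ^ 0 * logCos φ ^ 4) + -(3 / 2) * (φ ^ 2 * logCos φ ^ 2)) +
      1 / 16 * (φ ^ 4 * logCos φ ^ 0)) volume 0 Real.pi :=
    integral_logCosMoment_add.1.add ((intervalIntegrable_pow_mul_logCos_pow 4 0).const_mul _)
  have h := integral_logCos_of_re_im (m := 4) (by norm_num) hI
    (integral_logCosMoment_add (a := 2) (b := -(1 / 2)) (j := 1) (k := 3) (j' := 3) (k' := 1)).1
    fun φ => by
      push_cast
      linear_combination (6 * (logCos φ : ℂ) ^ 2 * (φ / 2 : ℂ) ^ 2 +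
        4 * (logCos φ : ℂ) * (φ / 2 : ℂ) ^ 3 * Complex.I + (φ / 2 : ℂ) ^ 4 * (Complex.I ^ 2 - 1)) * Complex.I_sq
  rw [integral_logCosMoment_add.2] at h
  norm_num [Nat.factorial] at h ⊢
  linarith [h.2]

/-! ### Integrals of powers of `-log sin` -/

theorem intervalIntegrable_mul_neg_log_sin_pow {h : ℝ → ℝ} (hh : Continuous h) (m : ℕ) :
    IntervalIntegrable (fun θ => h θ * (-Real.log (Real.sin θ)) ^ m) volume 0 (Real.pi / 2) := by
  have hpi := Real.pi_pos
  have h1 : IntervalIntegrable (fun θ => (-Real.log (Real.sin θ)) ^ m) volume 0 (Real.pi / 2) := by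
    refine ((intervalIntegrable_abs_log_sin_pow m).mono_set ?_).mono_fun
      ((Real.measurable_log.comp Real.measurable_sin).neg.pow_const m).aestronglyMeasurable
      (ae_of_all _ fun x => by simp)
    rw [Set.uIcc_of_le hpi.le, Set.uIcc_of_le (by positivity)]
    exact Set.Icc_subset_Icc_right (by linarith)
  exact h1.continuousOn_mul hh.continuousOn

theorem integral_comp_pi_div_two_sub (f : ℝ → ℝ) :
    ∫ θ in 0..Real.pi / 2, f (Real.pi / 2 - θ) = ∫ θ in 0..Real.pi / 2, f θ := by
  rw [intervalIntegral.integral_comp_sub_left, sub_self, sub_zero]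

theorem intervalIntegrable_mul_neg_log_cos_pow {h : ℝ → ℝ} (hh : Continuous h) (m : ℕ) :
    IntervalIntegrable (fun θ => h θ * (-Real.log (Real.cos θ)) ^ m) volume 0 (Real.pi / 2) := by
  have h1 := ((intervalIntegrable_mul_neg_log_sin_pow (h := fun θ => h (Real.pi / 2 - θ))
    (hh.comp (by fun_prop)) m).comp_sub_left (Real.pi / 2)).symm
  simpa only [sub_sub_cancel, Real.sin_pi_div_two_sub, sub_self, sub_zero] using h1

theorem integral_comp_sin_mul_cos {p : ℝ → ℝ} (hp : Continuous p) (m : ℕ) :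
    ∫ θ in 0..Real.pi / 2, p (Real.sin θ) * (-Real.log (Real.sin θ)) ^ m * Real.cos θ =
      ∫ y in (0 : ℝ)..1, p y * (-Real.log y) ^ m := by
  have hpi := Real.pi_pos
  have hI := intervalIntegrable_mul_neg_log_pow (g := p) hp.continuousOn m
  have h := intervalIntegral.integral_comp_mul_deriv''' (f := Real.sin) (f' := Real.cos) (a := 0)
    (b := Real.pi / 2) (g := fun y => p y * (-Real.log y) ^ m) Real.continuous_sin.continuousOn
    (fun x _ => (Real.hasDerivAt_sin x).hasDerivWithinAt) ?_ ?_ ?_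
  · rw [Real.sin_zero, Real.sin_pi_div_two] at h
    exact h
  · rintro _ ⟨x, hx, rfl⟩
    rw [min_eq_left (by positivity), max_eq_right (by positivity)] at hx
    have : Real.sin x ≠ 0 := (Real.sin_pos_of_pos_of_lt_pi hx.1 (by linarith [hx.2])).ne'
    exact (hp.continuousAt.mul ((Real.continuousAt_log this).neg.pow m)).continuousWithinAt
  · rw [intervalIntegrable_iff_integrableOn_Icc_of_le zero_le_one] at hI
    refine hI.mono_set ?_
    rintro _ ⟨x, hx, rfl⟩
    rw [Set.uIcc_of_le (by positivity)] at hx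
    exact ⟨Real.sin_nonneg_of_nonneg_of_le_pi hx.1 (by linarith [hx.2]), Real.sin_le_one x⟩
  · have h2 := intervalIntegrable_mul_neg_log_sin_pow
      (h := fun θ => p (Real.sin θ) * Real.cos θ) (by fun_prop) m
    rw [intervalIntegrable_iff_integrableOn_Icc_of_le (by positivity)] at h2
    rw [Set.uIcc_of_le (by positivity)]
    refine h2.congr_fun (fun x _ => ?_) measurableSet_Icc
    simp only [Function.comp]
    ring

theorem integral_sin_pow_mul_cos_mul_neg_log_sin_pow (k m : ℕ) :
    ∫ θ in 0..Real.pi / 2, Real.sin θ ^ (2 * k + 1) * Real.cos θ * (-Real.log (Real.sin θ)) ^ m =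
      m.factorial * (natInv k / 2) ^ (m + 1) := by
  have h := integral_comp_sin_mul_cos (p := fun y => y ^ (2 * k + 1)) (by fun_prop) m
  rw [integral_pow_mul_neg_log_pow] at h
  rw [show (m.factorial : ℝ) * (natInv k / 2) ^ (m + 1) =
    m.factorial / (((2 * k + 1 : ℕ) : ℝ) + 1) ^ (m + 1) by
      rw [natInv, div_div, div_pow, one_pow, mul_one_div]
      push_cast
      ring_nf, ← h]
  exact intervalIntegral.integral_congr fun θ _ => by ring

/-- `∫ y (1 - y ^ 2) ^ k (-log y) ^ m` over the unit interval. -/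
noncomputable def logSqMoment (m k : ℕ) : ℝ :=
  ∫ y in (0 : ℝ)..1, (y * (1 - y ^ 2) ^ k) * (-Real.log y) ^ m

theorem logSqMoment_zero (k : ℕ) : logSqMoment 0 k = natInv k / 2 := by
  have h := intervalIntegral.integral_eq_sub_of_hasDerivAt (a := 0) (b := 1)
    (f := fun y : ℝ => -(natInv k / 2) * (1 - y ^ 2) ^ (k + 1))
    (f' := fun y => (y * (1 - y ^ 2) ^ k) * (-Real.log y) ^ 0) (fun y _ => ?_)
    (intervalIntegrable_mul_neg_log_pow (by fun_prop) 0)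
  · rw [logSqMoment, h]
    simp
  · have h1 := ((((hasDerivAt_pow 2 y).const_sub 1).fun_pow (k + 1)).const_mul (-(natInv k / 2)))
    refine h1.congr_deriv ?_
    simp only [Nat.add_sub_cancel]
    push_cast
    linear_combination (y * (1 - y ^ 2) ^ k) * natInv_mul_cancel k

/-- Integration by parts with the primitive 1 - (1 - y^2)^(k+1). The constant makes it vanish at 0,
which kills the logarithm there, and its quotient by y is y times a geometric sum. -/
theorem logSqMoment_succ (m k : ℕ) :
    logSqMoment (m + 1) k = (m + 1) * (natInv k / 2) * ∑ j ∈ range (k + 1), logSqMoment m j := by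
  have hi : ∀ m k, IntervalIntegrable (fun y : ℝ => (y * (1 - y ^ 2) ^ k) * (-Real.log y) ^ m) volume 0 1 :=
    fun m k => intervalIntegrable_mul_neg_log_pow (by fun_prop) m
  have hg : ∀ y : ℝ, y ^ 2 * ∑ j ∈ range (k + 1), (1 - y ^ 2) ^ j = 1 - (1 - y ^ 2) ^ (k + 1) := by
    intro y
    have := mul_neg_geom_sum (1 - y ^ 2) (k + 1)
    linear_combination this
  have hsum : IntervalIntegrable (fun y : ℝ => ∑ j ∈ range (k + 1), (y * (1 - y ^ 2) ^ j) * (-Real.log y) ^ m)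
      volume 0 1 := by
    simpa only [← sum_mul] using intervalIntegrable_mul_neg_log_pow
      (g := fun y => ∑ j ∈ range (k + 1), y * (1 - y ^ 2) ^ j) (by fun_prop) m
  have h := intervalIntegral.integral_eq_sub_of_hasDerivAt_of_tendsto (zero_lt_one' ℝ)
    (f := fun y => (1 - (1 - y ^ 2) ^ (k + 1)) * (-Real.log y) ^ (m + 1))
    (f' := fun y => 2 * ((k : ℝ) + 1) * ((y * (1 - y ^ 2) ^ k) * (-Real.log y) ^ (m + 1)) -
      ((m : ℝ) + 1) * ∑ j ∈ range (k + 1), (y * (1 - y ^ 2) ^ j) * (-Real.log y) ^ m)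
    (fa := 0) (fb := 0) ?_ (((hi (m + 1) k).const_mul _).sub (hsum.const_mul _)) ?_ ?_
  · rw [intervalIntegral.integral_sub ((hi (m + 1) k).const_mul _) (hsum.const_mul _),
      intervalIntegral.integral_const_mul, intervalIntegral.integral_const_mul,
      intervalIntegral.integral_finsetSum fun j _ => hi m j] at h
    change _ * logSqMoment (m + 1) k - _ * ∑ j ∈ range (k + 1), logSqMoment m j = _ at h
    linear_combination (natInv k / 2) * h - logSqMoment (m + 1) k * natInv_mul_cancel k
  · intro y hy
    have hy0 : y ≠ 0 := hy.1.ne'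
    have h1 := ((((hasDerivAt_pow 2 y).const_sub 1).fun_pow (k + 1)).const_sub 1).fun_mul
      (((Real.hasDerivAt_log hy0).fun_neg).fun_pow (m + 1))
    refine h1.congr_deriv ?_
    simp only [Nat.add_sub_cancel]
    rw [← hg y, ← sum_mul, ← mul_sum]
    push_cast
    field_simp
    ring
  · have h1 := ((tendsto_pow_mul_neg_log_pow (n := 2) (by norm_num) (m + 1))).mul
      (((by fun_prop : Continuous fun y : ℝ => ∑ j ∈ range (k + 1), (1 - y ^ 2) ^ j).tendsto 0).mono_left
        nhdsWithin_le_nhds)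
    rw [zero_mul] at h1
    refine h1.congr fun y => ?_
    rw [← hg y]
    ring
  · have hc : ContinuousAt (fun y : ℝ => (1 - (1 - y ^ 2) ^ (k + 1)) * (-Real.log y) ^ (m + 1)) 1 :=
      ContinuousAt.mul (by fun_prop) ((Real.continuousAt_log one_ne_zero).neg.pow _)
    have := hc.tendsto
    simp only [Real.log_one, neg_zero, zero_pow (Nat.succ_ne_zero m), mul_zero] at this
    exact this.mono_left nhdsWithin_le_nhds

/-! ### Symmetric functions of the reciprocals -/

theorem harm_succ (m k : ℕ) : harm m (k + 1) = harm m k + natInv k ^ m := sum_range_succ _ _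

theorem sum_harm_one_mul (k : ℕ) :
    ∑ j ∈ range k, natInv j * harm 1 (j + 1) = (harm 1 k ^ 2 + harm 2 k) / 2 := by
  induction k with
  | zero => simp [harm]
  | succ k ih =>
    rw [sum_range_succ, ih, harm_succ, harm_succ]
    ring

/-- The complete symmetric polynomials satisfy h_3(k) = ∑ x_j h_2(j), sorting monomials by their
largest index j. The right side is h_3 in power sums. -/
theorem sum_harm_complete (k : ℕ) :
    ∑ j ∈ range k, natInv j * ((harm 1 (j + 1) ^ 2 + harm 2 (j + 1)) / 2) =
      (harm 1 k ^ 3 + 3 * harm 1 k * harm 2 k + 2 * harm 3 k) / 6 := by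
  induction k with
  | zero => simp [harm]
  | succ k ih =>
    rw [sum_range_succ, ih, harm_succ, harm_succ, harm_succ]
    ring

theorem logSqMoment_three (k : ℕ) : logSqMoment 3 k = 3 / 8 * natInv k *
    ((harm 1 (k + 1) ^ 3 + 3 * harm 1 (k + 1) * harm 2 (k + 1) + 2 * harm 3 (k + 1)) / 6) := by
  have h1 : ∀ k, logSqMoment 1 k = natInv k * harm 1 (k + 1) / 4 := by
    intro k
    rw [logSqMoment_succ]
    simp only [logSqMoment_zero, ← sum_div, harm, pow_one]
    push_cast
    ring
  have h2 : ∀ k, logSqMoment 2 k = natInv k * ((harm 1 (k + 1) ^ 2 + harm 2 (k + 1)) / 2) / 4 := by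
    intro k
    rw [logSqMoment_succ]
    simp only [h1, ← sum_div, sum_harm_one_mul]
    push_cast
    ring
  rw [logSqMoment_succ]
  simp only [h2, ← sum_div, sum_harm_complete]
  push_cast
  ring

theorem integral_sin_pow_mul_cos_mul_neg_log_cos_cube (k : ℕ) :
    ∫ θ in 0..Real.pi / 2, Real.sin θ ^ (2 * k + 1) * Real.cos θ * (-Real.log (Real.cos θ)) ^ 3 =
      logSqMoment 3 k := by
  rw [← integral_comp_pi_div_two_sub, logSqMoment,
    ← integral_comp_sin_mul_cos (p := fun y => y * (1 - y ^ 2) ^ k) (by fun_prop) 3]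
  refine intervalIntegral.integral_congr fun θ _ => ?_
  rw [Real.sin_pi_div_two_sub, Real.cos_pi_div_two_sub, ← Real.cos_sq', ← pow_mul, pow_succ]
  ring

/-! ### Power series in `sin` for powers of the angle -/

/-- The coefficients `4 ^ k / (k * (2k).choose k)`, with `k` shifted by one. -/
noncomputable def arcsinCoeff (k : ℕ) : ℝ := connector (k + 1) 0 * natInv k

theorem arcsinCoeff_pos (k : ℕ) : 0 < arcsinCoeff k := mul_pos (connector_pos _ _) (natInv_pos k)

theorem arcsinCoeff_zero : arcsinCoeff 0 = 2 := by
  rw [arcsinCoeff, connector_succ_left, connector_zero_left, natInv]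
  norm_num

theorem arcsinCoeff_succ (k : ℕ) :
    (2 * k + 3) * arcsinCoeff (k + 1) = (2 * k + 2) * arcsinCoeff k := by
  rw [arcsinCoeff, arcsinCoeff, connector_succ_left, natInv, natInv]
  have : (k : ℝ) + 1 + 0 + 1 / 2 ≠ 0 := by positivity
  push_cast
  field_simp
  ring

theorem arcsinCoeff_le_two (k : ℕ) : arcsinCoeff k ≤ 2 := by
  induction k with
  | zero => exact arcsinCoeff_zero.le
  | succ k ih =>
    have h := arcsinCoeff_succ k
    have h1 := arcsinCoeff_pos k
    have hk : (0 : ℝ) ≤ k := k.cast_nonneg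
    by_contra! h2
    nlinarith

theorem sin_pow_mul_cos_eq (k : ℕ) (θ : ℝ) : Real.sin θ ^ (2 * k + 1) * Real.cos θ =
    (2 * k + 1) * (∫ t in 0..θ, Real.sin t ^ (2 * k)) - (2 * k + 2) * ∫ t in 0..θ, Real.sin t ^ (2 * (k + 1)) := by
  rw [← intervalIntegral.integral_const_mul, ← intervalIntegral.integral_const_mul,
    ← intervalIntegral.integral_sub (Continuous.intervalIntegrable (by fun_prop) _ _)
      (Continuous.intervalIntegrable (by fun_prop) _ _),
    intervalIntegral.integral_eq_sub_of_hasDerivAt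
      (f := fun t => Real.sin t ^ (2 * k + 1) * Real.cos t) (fun t _ => ?_)
      (Continuous.intervalIntegrable (by fun_prop) _ _)]
  · simp
  · refine (((Real.hasDerivAt_sin t).fun_pow (2 * k + 1)).fun_mul (Real.hasDerivAt_cos t)).congr_deriv ?_
    simp only [Nat.add_sub_cancel]
    push_cast
    linear_combination (2 * (k : ℝ) + 1) * Real.sin t ^ (2 * k) * Real.sin_sq_add_cos_sq t

/-- Termwise integration turns an even power series in `sin` into an odd one times `cos`. -/
theorem hasSum_mul_sin_pow_mul_cos {g d : ℕ → ℝ} {F : ℝ → ℝ} {C θ : ℝ} (h0 : 0 ≤ θ) (h1 : θ < Real.pi / 2)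
    (hd0 : d 0 = g 0) (hd : ∀ k : ℕ, d (k + 1) = (2 * k + 3) * g (k + 1) - (2 * k + 2) * g k)
    (hg : ∀ k, 0 ≤ g k) (hgC : ∀ k, g k ≤ C) (hdn : ∀ k, 0 ≤ d k)
    (hF : IntervalIntegrable F volume 0 θ)
    (hsum : ∀ t ∈ Set.Ioo 0 θ, HasSum (fun k => d k * Real.sin t ^ (2 * k)) (F t)) :
    HasSum (fun k => g k * (Real.sin θ ^ (2 * k + 1) * Real.cos θ)) (∫ t in 0..θ, F t) := by
  have hs : 0 ≤ Real.sin θ := Real.sin_nonneg_of_nonneg_of_le_pi h0 (by linarith)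
  have hc : 0 < Real.cos θ := Real.cos_pos_of_mem_Ioo ⟨by linarith, h1⟩
  have hs1 : Real.sin θ < 1 := by nlinarith [Real.sin_sq_add_cos_sq θ]
  have hmain := hasSum_intervalIntegral_of_nonneg h0
    (f := fun k t => d k * Real.sin t ^ (2 * k)) (fun k => Continuous.intervalIntegrable (by fun_prop) _ _) hF
    (fun k t ht => mul_nonneg (hdn k) (by rw [pow_mul]; positivity)) hsum
  simp only [intervalIntegral.integral_const_mul] at hmain
  set J : ℕ → ℝ := fun k => ∫ t in 0..θ, Real.sin t ^ (2 * k) with hJ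
  have hJ0 : ∀ k, 0 ≤ J k := fun k => intervalIntegral.integral_nonneg h0 fun t _ => by
    rw [pow_mul]; positivity
  have hJ1 : ∀ k, J k ≤ θ * Real.sin θ ^ (2 * k) := by
    intro k
    have := intervalIntegral.integral_mono_on (μ := volume) h0 (f := fun t => Real.sin t ^ (2 * k))
      (g := fun _ => Real.sin θ ^ (2 * k)) (Continuous.intervalIntegrable (by fun_prop) _ _)
      (Continuous.intervalIntegrable (by fun_prop) _ _) fun t ht =>
        pow_le_pow_left₀ (Real.sin_nonneg_of_nonneg_of_le_pi ht.1 (by linarith [ht.2]))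
          (Real.sin_le_sin_of_le_of_le_pi_div_two (by linarith [ht.1]) h1.le ht.2) _
    simpa using this
  -- Summation by parts: `sin_pow_mul_cos_eq` and the recursion for d make everything cancel except
  -- one boundary term.
  have hpartial : ∀ N, ∑ k ∈ range (N + 1), g k * (Real.sin θ ^ (2 * k + 1) * Real.cos θ) =
      ∑ k ∈ range (N + 1), d k * J k - g N * ((2 * N + 2) * J (N + 1)) := by
    intro N
    induction N with
    | zero =>
      rw [sum_range_one, sum_range_one, sin_pow_mul_cos_eq, hd0]
      simp only [hJ]
      push_cast
      ring
    | succ N ih =>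
      rw [sum_range_succ, ih, sum_range_succ _ (N + 1), sin_pow_mul_cos_eq, hd]
      simp only [hJ]
      push_cast
      ring
  -- The boundary term is at most Cθ(2N+2) sin(θ)^(2N+2), which tends to 0 because θ < π/2.
  have hrem : Tendsto (fun N : ℕ => g N * ((2 * N + 2) * J (N + 1))) atTop (𝓝 0) := by
    have h2 := ((tendsto_self_mul_const_pow_of_lt_one hs hs1).comp
      (tendsto_atTop_mono (fun N : ℕ => (by lia : N ≤ 2 * (N + 1))) tendsto_id)).const_mul (C * θ)
    rw [mul_zero] at h2
    refine squeeze_zero (fun N => mul_nonneg (hg N) (mul_nonneg (by positivity) (hJ0 _))) (fun N => ?_) h2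
    have h3 := mul_le_mul (hgC N) (mul_le_mul_of_nonneg_left (hJ1 (N + 1)) (by positivity : (0 : ℝ) ≤ 2 * N + 2))
      (mul_nonneg (by positivity) (hJ0 _)) ((hg N).trans (hgC N))
    refine h3.trans_eq ?_
    simp only [Function.comp]
    push_cast
    ring
  rw [hasSum_iff_tendsto_nat_of_nonneg fun k => mul_nonneg (hg k) (mul_nonneg (pow_nonneg hs _) hc.le),
    ← tendsto_add_atTop_iff_nat 1]
  simp only [hpartial]
  simpa using ((tendsto_add_atTop_iff_nat 1).2 hmain.tendsto_sum_nat).sub hrem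

/-- The recursion `arcsinCoeff_succ` says exactly that d vanishes after its first term 2, so F is
the constant 2. -/
theorem hasSum_arcsinCoeff_mul_sin_pow_mul_cos {θ : ℝ} (h0 : 0 ≤ θ) (h1 : θ < Real.pi / 2) :
    HasSum (fun k => arcsinCoeff k * (Real.sin θ ^ (2 * k + 1) * Real.cos θ)) (2 * θ) := by
  have h := hasSum_mul_sin_pow_mul_cos (d := fun k => if k = 0 then 2 else 0) (F := fun _ => 2) h0 h1
    (by simp [arcsinCoeff_zero]) (fun k => by simp [arcsinCoeff_succ]) (fun k => (arcsinCoeff_pos k).le)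
    arcsinCoeff_le_two (fun k => by positivity) (by simp) fun t _ => by
      have := hasSum_single (f := fun k => (if k = 0 then (2 : ℝ) else 0) * Real.sin t ^ (2 * k)) 0
        fun k hk => by simp [hk]
      simpa using this
  simpa [mul_comm] using h

theorem hasSum_arcsinCoeff_mul_natInv_mul_sin_pow {θ : ℝ} (h0 : 0 ≤ θ) (h1 : θ < Real.pi / 2) :
    HasSum (fun k => arcsinCoeff k * natInv k * Real.sin θ ^ (2 * (k + 1))) (2 * θ ^ 2) := by
  have h := hasSum_intervalIntegral_of_nonneg h0
    (f := fun k t => arcsinCoeff k * (Real.sin t ^ (2 * k + 1) * Real.cos t)) (F := fun t => 2 * t)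
    (fun k => Continuous.intervalIntegrable (by fun_prop) _ _) (Continuous.intervalIntegrable (by fun_prop) _ _)
    (fun k t ht => mul_nonneg (arcsinCoeff_pos k).le (mul_nonneg
      (pow_nonneg (Real.sin_nonneg_of_nonneg_of_le_pi ht.1.le (by linarith [ht.2])) _)
      (Real.cos_pos_of_mem_Ioo ⟨by linarith [ht.1], by linarith [ht.2]⟩).le))
    fun t ht => hasSum_arcsinCoeff_mul_sin_pow_mul_cos ht.1.le (ht.2.trans h1)
  have h2 := h.mul_left 2
  rw [intervalIntegral.integral_const_mul, integral_id,
    show 2 * (2 * ((θ ^ 2 - 0 ^ 2) / 2)) = 2 * θ ^ 2 by ring] at h2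
  simp only [intervalIntegral.integral_const_mul] at h2
  refine h2.congr_fun fun k => ?_
  rw [intervalIntegral.integral_eq_sub_of_hasDerivAt
    (f := fun t => natInv k / 2 * Real.sin t ^ (2 * (k + 1))) (fun t _ => ?_)
    (Continuous.intervalIntegrable (by fun_prop) _ _)]
  · simp only [Real.sin_zero, mul_add, mul_one, pow_add]
    ring
  · refine (((Real.hasDerivAt_sin t).fun_pow (2 * (k + 1))).const_mul _).congr_deriv ?_
    rw [show 2 * (k + 1) - 1 = 2 * k + 1 by lia]
    push_cast
    linear_combination Real.sin t ^ (2 * k + 1) * Real.cos t * natInv_mul_cancel k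

/-- With the factor `harm 2 k`, the recursion leaves d_{k+1} = 2 `arcsinCoeff k` / (k+1). These are
the coefficients of 4t^2 from the preceding expansion, and integrating gives 4θ^3/3. -/
theorem hasSum_arcsinCoeff_mul_harm_mul_sin_pow_mul_cos {θ : ℝ} (h0 : 0 ≤ θ) (h1 : θ < Real.pi / 2) :
    HasSum (fun k => arcsinCoeff k * harm 2 k * (Real.sin θ ^ (2 * k + 1) * Real.cos θ)) (4 / 3 * θ ^ 3) := by
  have hz := hasSum_natInv_pow (s := 2) (by norm_num)
  have hh : ∀ k, harm 2 k ≤ realZeta 2 := fun k =>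
    sum_le_hasSum _ (fun i _ => pow_nonneg (natInv_pos i).le _) hz
  have h := hasSum_mul_sin_pow_mul_cos (g := fun k => arcsinCoeff k * harm 2 k)
    (d := fun k => Nat.casesOn k 0 fun k => 2 * (arcsinCoeff k * natInv k)) (F := fun t => 4 * t ^ 2)
    (C := 2 * realZeta 2) h0 h1
    (by simp [harm]) (fun k => by
      rw [harm_succ]
      linear_combination -2 * arcsinCoeff k * natInv k * natInv_mul_cancel k -
        (harm 2 k + natInv k ^ 2) * arcsinCoeff_succ k)
    (fun k => mul_nonneg (arcsinCoeff_pos k).le (harm_nonneg _ _))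
    (fun k => mul_le_mul (arcsinCoeff_le_two k) (hh k) (harm_nonneg _ _) (by norm_num))
    (fun k => by
      cases k with
      | zero => exact le_rfl
      | succ k => exact mul_nonneg zero_le_two (mul_nonneg (arcsinCoeff_pos k).le (natInv_pos k).le))
    (Continuous.intervalIntegrable (by fun_prop) _ _) fun t ht => by
      rw [← hasSum_nat_add_iff' 1]
      have := (hasSum_arcsinCoeff_mul_natInv_mul_sin_pow ht.1.le (ht.2.trans h1)).mul_left 2
      rw [sum_range_one]
      change HasSum (fun k => 2 * (arcsinCoeff k * natInv k) * Real.sin t ^ (2 * (k + 1)))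
        (4 * t ^ 2 - 0 * Real.sin t ^ (2 * 0))
      rw [show 4 * t ^ 2 - 0 * Real.sin t ^ (2 * 0) = 2 * (2 * t ^ 2) by ring]
      exact this.congr_fun fun k => by ring
  rw [intervalIntegral.integral_const_mul, integral_pow] at h
  convert h using 1
  push_cast
  ring

/-! ### Series as integrals of powers of the angle against logarithms -/

/-- Integration of a series in `sin ^ (2 * k + 1) * cos` against a nonnegative weight. -/
theorem hasSum_integral_mul_weight {g : ℕ → ℝ} {w F : ℝ → ℝ} (hg : ∀ k, 0 ≤ g k)
    (hw : ∀ θ ∈ Set.Ioo 0 (Real.pi / 2), 0 ≤ w θ)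
    (hi : ∀ {h : ℝ → ℝ}, Continuous h → IntervalIntegrable (fun θ => h θ * w θ) volume 0 (Real.pi / 2))
    (hF : Continuous F) (hsum : ∀ θ ∈ Set.Ioo 0 (Real.pi / 2),
      HasSum (fun k => g k * (Real.sin θ ^ (2 * k + 1) * Real.cos θ)) (F θ)) :
    HasSum (fun k => g k * ∫ θ in 0..Real.pi / 2, Real.sin θ ^ (2 * k + 1) * Real.cos θ * w θ)
      (∫ θ in 0..Real.pi / 2, F θ * w θ) := by
  have hpi := Real.pi_pos
  have h := hasSum_intervalIntegral_of_nonneg (by positivity : (0 : ℝ) ≤ Real.pi / 2)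
    (f := fun k θ => g k * (Real.sin θ ^ (2 * k + 1) * Real.cos θ * w θ)) (F := fun θ => F θ * w θ)
    (fun k => (hi (by fun_prop)).const_mul _) (hi hF)
    (fun k θ hθ => mul_nonneg (hg k) (mul_nonneg (mul_nonneg
      (pow_nonneg (Real.sin_nonneg_of_nonneg_of_le_pi hθ.1.le (by linarith [hθ.2])) _)
      (Real.cos_pos_of_mem_Ioo ⟨by linarith [hθ.1], by linarith [hθ.2]⟩).le) (hw θ hθ)))
    fun θ hθ => ((hsum θ hθ).mul_right (w θ)).congr_fun fun k => by ring
  simpa only [intervalIntegral.integral_const_mul] using h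

theorem neg_log_sin_nonneg (θ : ℝ) (hθ : θ ∈ Set.Ioo 0 (Real.pi / 2)) : 0 ≤ -Real.log (Real.sin θ) := by
  have := Real.pi_pos
  exact neg_nonneg.2 (Real.log_nonpos
    (Real.sin_nonneg_of_nonneg_of_le_pi hθ.1.le (by linarith [hθ.2])) (Real.sin_le_one _))

theorem neg_log_cos_nonneg (θ : ℝ) (hθ : θ ∈ Set.Ioo 0 (Real.pi / 2)) : 0 ≤ -Real.log (Real.cos θ) :=
  neg_nonneg.2 (Real.log_nonpos
    (Real.cos_pos_of_mem_Ioo ⟨by linarith [hθ.1, hθ.2], hθ.2⟩).le (Real.cos_le_one _))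

theorem hasSum_connector_mul_natInv_pow_five :
    HasSum (fun k => natInv k ^ 5 * connector (k + 1) 0)
      (16 / 3 * ∫ θ in 0..Real.pi / 2, θ * (-Real.log (Real.sin θ)) ^ 3) := by
  -- The final factor 8/3 undoes the 3!/2^4 produced by integrating the cubed logarithm.
  have h := (hasSum_integral_mul_weight (w := fun θ => (-Real.log (Real.sin θ)) ^ 3) (F := fun θ => 2 * θ)
    (fun k => (arcsinCoeff_pos k).le) (fun θ hθ => pow_nonneg (neg_log_sin_nonneg θ hθ) 3)
    (fun hh => intervalIntegrable_mul_neg_log_sin_pow hh 3) (by fun_prop)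
    fun θ hθ => hasSum_arcsinCoeff_mul_sin_pow_mul_cos hθ.1.le hθ.2).mul_left (8 / 3)
  simp only [integral_sin_pow_mul_cos_mul_neg_log_sin_pow, mul_assoc (2 : ℝ),
    intervalIntegral.integral_const_mul] at h
  rw [show (16 / 3 : ℝ) = 8 / 3 * 2 by norm_num, mul_assoc]
  refine h.congr_fun fun k => ?_
  norm_num [arcsinCoeff, Nat.factorial]
  ring

theorem hasSum_harm_two_mul_connector :
    HasSum (fun k => harm 2 k * natInv k * natInv k * natInv k * connector (k + 1) 0)
      (16 / 3 * ∫ θ in 0..Real.pi / 2, θ ^ 3 * (-Real.log (Real.sin θ)) ^ 1) := by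
  have h := (hasSum_integral_mul_weight (w := fun θ => (-Real.log (Real.sin θ)) ^ 1)
    (F := fun θ => 4 / 3 * θ ^ 3) (fun k => mul_nonneg (arcsinCoeff_pos k).le (harm_nonneg 2 k))
    (fun θ hθ => pow_nonneg (neg_log_sin_nonneg θ hθ) 1)
    (fun hh => intervalIntegrable_mul_neg_log_sin_pow hh 1) (by fun_prop)
    fun θ hθ => hasSum_arcsinCoeff_mul_harm_mul_sin_pow_mul_cos hθ.1.le hθ.2).mul_left 4
  simp only [integral_sin_pow_mul_cos_mul_neg_log_sin_pow, mul_assoc (4 / 3 : ℝ),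
    intervalIntegral.integral_const_mul] at h
  rw [show (16 / 3 : ℝ) = 4 * (4 / 3) by norm_num, mul_assoc]
  refine h.congr_fun fun k => ?_
  norm_num [arcsinCoeff]
  ring

theorem hasSum_complete_three_mul_connector :
    HasSum (fun k => (harm 1 (k + 1) ^ 3 + 3 * harm 1 (k + 1) * harm 2 (k + 1) + 2 * harm 3 (k + 1)) / 6 *
      natInv k * natInv k * connector (k + 1) 0)
      (16 / 3 * ∫ θ in 0..Real.pi / 2, θ * (-Real.log (Real.cos θ)) ^ 3) := by
  have h := (hasSum_integral_mul_weight (w := fun θ => (-Real.log (Real.cos θ)) ^ 3) (F := fun θ => 2 * θ)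
    (fun k => (arcsinCoeff_pos k).le) (fun θ hθ => pow_nonneg (neg_log_cos_nonneg θ hθ) 3)
    (fun hh => intervalIntegrable_mul_neg_log_cos_pow hh 3) (by fun_prop)
    fun θ hθ => hasSum_arcsinCoeff_mul_sin_pow_mul_cos hθ.1.le hθ.2).mul_left (8 / 3)
  simp only [integral_sin_pow_mul_cos_mul_neg_log_cos_cube, logSqMoment_three, mul_assoc (2 : ℝ),
    intervalIntegral.integral_const_mul] at h
  rw [show (16 / 3 : ℝ) = 8 / 3 * 2 by norm_num, mul_assoc]
  refine h.congr_fun fun k => ?_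
  rw [arcsinCoeff]
  ring

/-! ### Evaluation of the logarithmic integrals -/

theorem neg_log_cos_eq {φ : ℝ} (hφ : φ ∈ Set.Ioo 0 Real.pi) :
    -Real.log (Real.cos (φ / 2)) = Real.log 2 - logCos φ := by
  have hc : 0 < Real.cos (φ / 2) :=
    Real.cos_pos_of_mem_Ioo ⟨by linarith [hφ.1, Real.pi_pos], by linarith [hφ.2]⟩
  rw [logCos, Real.log_mul two_ne_zero hc.ne']
  ring

/-- Substitute θ = φ/2 and expand the power of log 2 - `logCos φ` binomially. -/
theorem integral_pow_mul_neg_log_cos_pow (j k : ℕ) :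
    ∫ θ in 0..Real.pi / 2, θ ^ j * (-Real.log (Real.cos θ)) ^ k = (1 / 2) ^ (j + 1) *
      ∑ i ∈ range (k + 1), (-1) ^ i * Real.log 2 ^ (k - i) * k.choose i * logCosMoment j i := by
  have h := intervalIntegral.integral_comp_div (a := 0) (b := Real.pi)
    (fun θ => θ ^ j * (-Real.log (Real.cos θ)) ^ k) (two_ne_zero' ℝ)
  rw [zero_div, smul_eq_mul] at h
  have h2 : ∫ φ in 0..Real.pi, (φ / 2) ^ j * (-Real.log (Real.cos (φ / 2))) ^ k =
      ∫ φ in 0..Real.pi, ∑ i ∈ range (k + 1),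
        (1 / 2) ^ j * ((-1) ^ i * Real.log 2 ^ (k - i) * k.choose i) * (φ ^ j * logCos φ ^ i) := by
    refine intervalIntegral.integral_congr_ae ?_
    filter_upwards [ae_mem_Ioo_of_uIoc] with φ hφ hφ'
    rw [neg_log_cos_eq (hφ hφ'), sub_eq_neg_add, add_pow, mul_sum]
    refine sum_congr rfl fun i _ => ?_
    rw [neg_pow]
    ring
  rw [h2, intervalIntegral.integral_finsetSum fun i _ =>
    (intervalIntegrable_pow_mul_logCos_pow j i).const_mul _] at h
  simp only [intervalIntegral.integral_const_mul] at h
  simp only [mul_assoc ((1 / 2 : ℝ) ^ j), ← mul_sum] at h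
  simp only [logCosMoment, pow_succ (1 / 2 : ℝ) j]
  linear_combination -(1 / 2) * h

theorem integral_mul_neg_log_sin_cube :
    ∫ θ in 0..Real.pi / 2, θ * (-Real.log (Real.sin θ)) ^ 3 =
      Real.pi / 2 * (∫ θ in 0..Real.pi / 2, θ ^ 0 * (-Real.log (Real.cos θ)) ^ 3) -
        ∫ θ in 0..Real.pi / 2, θ ^ 1 * (-Real.log (Real.cos θ)) ^ 3 := by
  rw [← intervalIntegral.integral_const_mul, ← intervalIntegral.integral_sub
    ((intervalIntegrable_mul_neg_log_cos_pow (by fun_prop) 3).const_mul _)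
    (intervalIntegrable_mul_neg_log_cos_pow (by fun_prop) 3), ← integral_comp_pi_div_two_sub]
  refine intervalIntegral.integral_congr fun θ _ => ?_
  simp only [Real.sin_pi_div_two_sub]
  ring

theorem integral_cube_mul_neg_log_sin :
    ∫ θ in 0..Real.pi / 2, θ ^ 3 * (-Real.log (Real.sin θ)) ^ 1 =
      (Real.pi / 2) ^ 3 * (∫ θ in 0..Real.pi / 2, θ ^ 0 * (-Real.log (Real.cos θ)) ^ 1) -
        3 * (Real.pi / 2) ^ 2 * (∫ θ in 0..Real.pi / 2, θ ^ 1 * (-Real.log (Real.cos θ)) ^ 1) +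
        3 * (Real.pi / 2) * (∫ θ in 0..Real.pi / 2, θ ^ 2 * (-Real.log (Real.cos θ)) ^ 1) -
        ∫ θ in 0..Real.pi / 2, θ ^ 3 * (-Real.log (Real.cos θ)) ^ 1 := by
  have hi : ∀ j, IntervalIntegrable (fun θ : ℝ => θ ^ j * (-Real.log (Real.cos θ)) ^ 1) volume 0 (Real.pi / 2) :=
    fun j => intervalIntegrable_mul_neg_log_cos_pow (by fun_prop) 1
  rw [← intervalIntegral.integral_const_mul, ← intervalIntegral.integral_const_mul,
    ← intervalIntegral.integral_const_mul,
    ← intervalIntegral.integral_sub ((hi 0).const_mul _) ((hi 1).const_mul _),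
    ← intervalIntegral.integral_add (((hi 0).const_mul _).sub ((hi 1).const_mul _)) ((hi 2).const_mul _),
    ← intervalIntegral.integral_sub
      ((((hi 0).const_mul _).sub ((hi 1).const_mul _)).add ((hi 2).const_mul _)) (hi 3),
    ← integral_comp_pi_div_two_sub]
  refine intervalIntegral.integral_congr fun θ _ => ?_
  simp only [Real.sin_pi_div_two_sub]
  ring

/-- For m = 1 the moment on the left is elementary, so the contour identity evaluates Li_2(1/2). For
m = 2 the Fourier value does the same for Li_3(1/2). -/
theorem realPolylog_two_one_half :
    realPolylog 2 (1 / 2) = Real.pi ^ 2 / 12 - Real.log 2 ^ 2 / 2 := by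
  have h := logCosMoment_one.2
  rw [integral_log_one_add_div, logCosMoment_pow_zero, realZeta_two] at h
  norm_num at h ⊢
  linarith

theorem logCosMoment_one_one : logCosMoment 1 1 = -(7 / 4) * realZeta 3 := by
  rw [← integral_mul_logCos]
  simp [logCosMoment]

theorem logCosMoment_two_one : logCosMoment 2 1 = -2 * Real.pi * realZeta 3 := by
  rw [← integral_sq_mul_logCos]
  simp [logCosMoment]

theorem logCosMoment_three_one :
    logCosMoment 3 1 = -3 * Real.pi ^ 2 * realZeta 3 + 93 / 8 * realZeta 5 := by
  rw [← integral_cube_mul_logCos]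
  simp [logCosMoment]

theorem realPolylog_three_one_half : realPolylog 3 (1 / 2) =
    7 / 8 * realZeta 3 - Real.pi ^ 2 / 12 * Real.log 2 + Real.log 2 ^ 3 / 6 := by
  have h := logCosMoment_two.2
  rw [integral_log_one_add_sq_div, realPolylog_two_one_half, logCosMoment_one_one] at h
  linarith

theorem logCosMoment_zero_three : logCosMoment 0 3 = -(3 / 2) * Real.pi * realZeta 3 := by
  rw [logCosMoment_three.1, logCosMoment_two_one]
  ring

theorem logCosMoment_zero_two : logCosMoment 0 2 = Real.pi ^ 3 / 12 := by
  rw [logCosMoment_two.1, logCosMoment_pow_zero]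
  norm_num
  ring

theorem logCosMoment_one_two : logCosMoment 1 2 = 79 / 720 * Real.pi ^ 4 - 4 * realPolylog 4 (1 / 2)
    - 7 / 2 * Real.log 2 * realZeta 3 + Real.pi ^ 2 / 6 * Real.log 2 ^ 2 - Real.log 2 ^ 4 / 6 := by
  have h := logCosMoment_three.2
  rw [integral_log_one_add_cube_div, realPolylog_two_one_half, realPolylog_three_one_half,
    logCosMoment_pow_zero, realZeta_four] at h
  push_cast at h
  linarith

theorem logCosMoment_one_three : logCosMoment 1 3 = 93 / 32 * realZeta 5 - 3 / 4 * Real.pi ^ 2 * realZeta 3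
    - 12 * realPolylog 5 (1 / 2) - 12 * Real.log 2 * realPolylog 4 (1 / 2) - 21 / 4 * Real.log 2 ^ 2 * realZeta 3
    + Real.pi ^ 2 / 3 * Real.log 2 ^ 3 - 2 / 5 * Real.log 2 ^ 5 := by
  have h := logCosMoment_four
  rw [integral_log_one_add_pow_four_div, realPolylog_two_one_half, realPolylog_three_one_half,
    logCosMoment_three_one] at h
  linarith

/-- Li_4(1/2) enters through the moments with two and three logarithms, and its contributions cancel
in this combination. -/
theorem integral_mul_neg_log_cos_cube :
    ∫ θ in 0..Real.pi / 2, θ ^ 1 * (-Real.log (Real.cos θ)) ^ 3 =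
      79 / 960 * Real.pi ^ 4 * Real.log 2 + Real.pi ^ 2 / 6 * Real.log 2 ^ 3 - Real.log 2 ^ 5 / 40
        + 3 / 16 * Real.pi ^ 2 * realZeta 3 - 93 / 128 * realZeta 5 + 3 * realPolylog 5 (1 / 2) := by
  rw [integral_pow_mul_neg_log_cos_pow]
  simp only [sum_range_succ, sum_range_zero, logCosMoment_one_one, logCosMoment_one_two, logCosMoment_one_three,
    logCosMoment_pow_zero]
  norm_num [Nat.choose]
  ring

theorem integral_neg_log_cos_cube :
    ∫ θ in 0..Real.pi / 2, θ ^ 0 * (-Real.log (Real.cos θ)) ^ 3 =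
      Real.pi / 2 * Real.log 2 ^ 3 + Real.pi ^ 3 / 8 * Real.log 2 + 3 / 4 * Real.pi * realZeta 3 := by
  rw [integral_pow_mul_neg_log_cos_pow]
  simp only [sum_range_succ, sum_range_zero, logCosMoment_one.1, logCosMoment_zero_two, logCosMoment_zero_three,
    logCosMoment_pow_zero]
  norm_num [Nat.choose]
  ring

theorem hasSum_harm_two_mul_natInv_cube :
    HasSum (fun k => harm 2 k * natInv k * natInv k * natInv k * connector (k + 1) 0)
      (15 / 2 * Real.log 2 * realZeta 4 - 9 / 2 * realZeta 2 * realZeta 3 + 31 / 8 * realZeta 5) := by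
  convert hasSum_harm_two_mul_connector using 1
  rw [integral_cube_mul_neg_log_sin]
  simp only [integral_pow_mul_neg_log_cos_pow, sum_range_succ, sum_range_zero, logCosMoment_one.1,
    logCosMoment_one_one, logCosMoment_two_one, logCosMoment_three_one, logCosMoment_pow_zero, realZeta_two,
    realZeta_four]
  norm_num [Nat.choose]
  ring

theorem hasSum_natInv_pow_five_mul_connector :
    HasSum (fun k => natInv k ^ 5 * connector (k + 1) 0)
      (8 / 3 * Real.log 2 ^ 3 * realZeta 2 - 19 / 2 * Real.log 2 * realZeta 4 + 6 * realZeta 2 * realZeta 3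
        + 31 / 8 * realZeta 5 - 16 * realPolylog 5 (1 / 2) + 2 / 15 * Real.log 2 ^ 5) := by
  convert hasSum_connector_mul_natInv_pow_five using 1
  rw [integral_mul_neg_log_sin_cube, integral_mul_neg_log_cos_cube, integral_neg_log_cos_cube, realZeta_two,
    realZeta_four]
  ring

theorem hasSum_complete_three :
    HasSum (fun k => (harm 1 (k + 1) ^ 3 + 3 * harm 1 (k + 1) * harm 2 (k + 1) + 2 * harm 3 (k + 1)) / 6 *
      natInv k * natInv k * connector (k + 1) 0)
      (79 / 2 * Real.log 2 * realZeta 4 + 16 / 3 * Real.log 2 ^ 3 * realZeta 2 - 2 / 15 * Real.log 2 ^ 5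
        + 6 * realZeta 2 * realZeta 3 - 31 / 8 * realZeta 5 + 16 * realPolylog 5 (1 / 2)) := by
  convert hasSum_complete_three_mul_connector using 1
  have h := integral_mul_neg_log_cos_cube
  simp only [pow_one] at h
  rw [h, realZeta_two, realZeta_four]
  ring

/-! ### The six series -/

theorem genHarmonic_eq_harm (m k : ℕ) : genHarmonic m k = harm m k := by
  induction k with
  | zero => simp [genHarmonic, harm]
  | succ k ih =>
    rw [harm_succ, ← ih, genHarmonic, sum_Icc_succ_top (by lia), natInv, div_pow, one_pow, genHarmonic]
    push_cast
    rfl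

theorem sum_harm_one_mul_natInv (k : ℕ) :
    ∑ j ∈ range k, harm 1 j * natInv j = (harm 1 k ^ 2 - harm 2 k) / 2 := by
  induction k with
  | zero => simp [harm]
  | succ k ih =>
    rw [sum_range_succ, ih, harm_succ, harm_succ]
    ring

theorem sum_elementary_two_mul_natInv (k : ℕ) :
    ∑ i ∈ range k, (∑ j ∈ range i, harm 1 j * natInv j) * natInv i =
      (harm 1 k ^ 3 - 3 * harm 1 k * harm 2 k + 2 * harm 3 k) / 6 := by
  induction k with
  | zero => simp [harm]
  | succ k ih =>
    rw [sum_range_succ, ih, sum_harm_one_mul_natInv, harm_succ, harm_succ, harm_succ]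
    ring

theorem sum_nested_two_one_add_one_two (k : ℕ) :
    (∑ j ∈ range k, harm 1 j * natInv j * natInv j) + ∑ j ∈ range k, harm 2 j * natInv j =
      harm 1 k * harm 2 k - harm 3 k := by
  induction k with
  | zero => simp [harm]
  | succ k ih =>
    rw [sum_range_succ, sum_range_succ, harm_succ, harm_succ, harm_succ]
    linear_combination ih

theorem four_pow_mul_div_eq (k s : ℕ) (x : ℝ) :
    (4 : ℝ) ^ (k + 1) * x / (((k + 1 : ℕ) : ℝ) ^ s * (Nat.centralBinom (k + 1) : ℝ)) =
      x * natInv k ^ s * connector (k + 1) 0 := by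
  rw [connector_zero_right, natInv, Nat.cast_succ, div_pow, one_pow]
  have h1 : (k : ℝ) + 1 ≠ 0 := by positivity
  have h2 : (Nat.centralBinom (k + 1) : ℝ) ≠ 0 := Nat.cast_ne_zero.2 (Nat.centralBinom_ne_zero _)
  field_simp

theorem mainTheorem1 :
    HasSum
      (fun k : ℕ => (4 : ℝ) ^ (k + 1) * genHarmonic 3 (k + 1) /
        (((k + 1 : ℕ) : ℝ) ^ 2 * (Nat.centralBinom (k + 1) : ℝ)))
      (217 / 8 * realZeta 5 - 9 / 2 * realZeta 2 * realZeta 3 - 16 * realPolylog 5 (1 / 2)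
        - 19 / 2 * Real.log 2 * realZeta 4 + 8 / 3 * Real.log 2 ^ 3 * realZeta 2 + 2 / 15 * Real.log 2 ^ 5) ∧
    HasSum
      (fun k : ℕ => (4 : ℝ) ^ (k + 1) * genHarmonic 2 (k + 1) /
        (((k + 1 : ℕ) : ℝ) ^ 3 * (Nat.centralBinom (k + 1) : ℝ)))
      (31 / 4 * realZeta 5 + 3 / 2 * realZeta 2 * realZeta 3 - 16 * realPolylog 5 (1 / 2)
        - 2 * Real.log 2 * realZeta 4 + 8 / 3 * Real.log 2 ^ 3 * realZeta 2 + 2 / 15 * Real.log 2 ^ 5) ∧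
    HasSum
      (fun k : ℕ => (4 : ℝ) ^ (k + 1) * (harmonic (k + 1) : ℝ) ^ 2 /
        (((k + 1 : ℕ) : ℝ) ^ 3 * (Nat.centralBinom (k + 1) : ℝ)))
      (-62 * realZeta 5 - 21 / 2 * realZeta 2 * realZeta 3 + 48 * realPolylog 5 (1 / 2)
        + 81 * Real.log 2 * realZeta 4 + 8 * Real.log 2 ^ 3 * realZeta 2 - 2 / 5 * Real.log 2 ^ 5) ∧
    HasSum
      (fun k : ℕ => (4 : ℝ) ^ (k + 1) * (harmonic (k + 1) : ℝ) /
        (((k + 1 : ℕ) : ℝ) ^ 4 * (Nat.centralBinom (k + 1) : ℝ)))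
      (-(31 / 2) * realZeta 5 + 3 * realZeta 2 * realZeta 3 + 16 * realPolylog 5 (1 / 2)
        + 2 * Real.log 2 * realZeta 4 + 16 / 3 * Real.log 2 ^ 3 * realZeta 2 - 2 / 15 * Real.log 2 ^ 5) ∧
    HasSum
      (fun k : ℕ => (4 : ℝ) ^ (k + 1) * ((harmonic (k + 1) : ℝ) * genHarmonic 2 (k + 1)) /
        (((k + 1 : ℕ) : ℝ) ^ 2 * (Nat.centralBinom (k + 1) : ℝ)))
      (-(155 / 8) * realZeta 5 + 9 * realZeta 2 * realZeta 3 + 16 * realPolylog 5 (1 / 2)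
        + 19 / 2 * Real.log 2 * realZeta 4 + 16 / 3 * Real.log 2 ^ 3 * realZeta 2 - 2 / 15 * Real.log 2 ^ 5) ∧
    HasSum
      (fun k : ℕ => (4 : ℝ) ^ (k + 1) * (harmonic (k + 1) : ℝ) ^ 3 /
        (((k + 1 : ℕ) : ℝ) ^ 2 * (Nat.centralBinom (k + 1) : ℝ)))
      (-(155 / 8) * realZeta 5 + 18 * realZeta 2 * realZeta 3 + 80 * realPolylog 5 (1 / 2)
        + 455 / 2 * Real.log 2 * realZeta 4 + 32 / 3 * Real.log 2 ^ 3 * realZeta 2 - 2 / 3 * Real.log 2 ^ 5) := by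
  simp only [← genHarmonic_one, genHarmonic_eq_harm, four_pow_mul_div_eq]
  have hR := hasSum_complete_three
  have h7 := hasSum_natInv_pow_five_mul_connector
  have h5' := hasSum_harm_two_mul_natInv_cube
  have h3' := hasSum_harm_three_of_harm_two h5'
  have hg := hasSum_elementary_three
  have hM := hasSum_elementary_two
  have hN := hasSum_nested_two_one_add_one_two
  simp only [sum_elementary_two_mul_natInv] at hg
  simp only [sum_harm_one_mul_natInv] at hM
  simp only [sum_nested_two_one_add_one_two] at hN
  -- The evaluated series carry sums over n < k, the stated ones over n ≤ k; the difference here is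
  -- the diagonal t^5.
  have h5 := (h5'.add h7).congr_fun (g := fun k => harm 2 (k + 1) * natInv k ^ 3 * connector (k + 1) 0)
    fun k => by rw [harm_succ]; ring
  have h3 := (h3'.add h7).congr_fun (g := fun k => harm 3 (k + 1) * natInv k ^ 2 * connector (k + 1) 0)
    fun k => by rw [harm_succ]; ring
  -- Splitting off the last variable, h_3(n ≤ k) = h_3 + h_2 t + p_1 t^2 + t^3 with h_3 = e_3 + (p_1
  -- p_2 - p_3) + p_3 and h_2 = e_2 + p_2 over n < k. After multiplication by t^2 only p_1 t^4 is
  -- unknown.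
  have h6 := ((((((hR.sub hg).sub hN).sub hM).sub h5).sub h3).add (h7.mul_left 2)).congr_fun
    (g := fun k => harm 1 (k + 1) * natInv k ^ 4 * connector (k + 1) 0)
    fun k => by simp only [harm_succ]; ring
  have h2 := ((((h6.add h5).add h3).sub (h7.mul_left 2)).add hN).congr_fun
    (g := fun k => harm 1 (k + 1) * harm 2 (k + 1) * natInv k ^ 2 * connector (k + 1) 0)
    fun k => by simp only [harm_succ]; ring
  have h4 := ((((hM.mul_left 2).add h5).add (h6.mul_left 2)).sub (h7.mul_left 2)).congr_fun
    (g := fun k => harm 1 (k + 1) ^ 2 * natInv k ^ 3 * connector (k + 1) 0)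
    fun k => by simp only [harm_succ]; ring
  -- Newton's identity p_1^3 = 6 e_3 + 3 p_1 p_2 - 2 p_3 over n < k, corrected for the term n = k.
  have h1 := (((((((hg.mul_left 6).add (h2.mul_left 3)).sub (h3.mul_left 2)).add (h4.mul_left 3)).sub
    (h5.mul_left 3)).sub (h6.mul_left 6)).add (h7.mul_left 6)).congr_fun
    (g := fun k => harm 1 (k + 1) ^ 3 * natInv k ^ 2 * connector (k + 1) 0)
    fun k => by simp only [harm_succ]; ring
  -- The square of ζ(2) enters with the factor log 2 through the stuffle product of triple sums; the
  -- stated values use ζ(4) instead.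
  have hz : realZeta 2 ^ 2 = 5 / 2 * realZeta 4 := by
    rw [realZeta_two, realZeta_four]
    ring
  rw [hz] at h3 h6 h2 h4 h1
  have key : ∀ {f : ℕ → ℝ} {a b : ℝ}, HasSum f a → a = b → HasSum f b := fun h e => e ▸ h
  exact ⟨key h3 (by ring), key h5 (by ring), key h4 (by ring), key h6 (by ring), key h2 (by ring), key h1 (by ring)⟩
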